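/- Let \(\Gamma\subset\mathbb{R}^2\) be a trapezoid (a convex quadrilateral with a designated pair of parallel sides; parallelograms are allowed), let \(m\) be the mean of the lengths of its two parallel sides, let \(h\) be its height (the distance between the lines carrying the parallel sides), and let \(Q_1,Q_2\) be its two legs. Let \(\Gamma^{*}\) be a rectangle with two opposite sides of length \(m\) (its parallel sides) and with its other two sides, the legs, again denoted by \(Q_1,Q_2\), of length \(h\). For \(\Omega\in\{\Gamma,\Gamma^{*}\}\) let \[\lambda_1^{Q_1Q_2}(\Omega)\le\lambda_2^{Q_1Q_2}(\Omega)\le\cdots\] be the eigenvalues, counted with multiplicity, of the mixed problem \(\Delta u+\lambda u=0\) in \(\Omega\), \(u=0\) on \(Q_1\cup Q_2\), \(\partial_\nu u=0\) on \(\partial\Omega\setminus(Q_1\cup Q_2)\), understood in the weak sense in the space of \(u\in W^{1,2}(\Omega)\) with \(u=0\) on \(Q_1\cup Q_2\). If \(k\ge 1\) is an integer with \(h/m\le 1/k\), then \[\lambda_k^{Q_1Q_2}(\Gamma)\ \ge\ \lambda_k^{Q_1Q_2}(\Gamma^{*})=\frac{\pi^2k^2}{m^2}.\] -/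

import Mathlib

open MeasureTheory
open scoped ContDiff ENNReal

noncomputable section

/-- The Euclidean plane. -/
abbrev Plane : Type := EuclideanSpace ℝ (Fin 2)

/-- Real-valued `L²` functions on `Ω`. -/
abbrev L2 (Ω : Set Plane) : Type := Lp ℝ 2 ((volume : Measure Plane).restrict Ω)

/-- Square integrable vector fields on `Ω`. -/
abbrev L2Field (Ω : Set Plane) : Type := Lp Plane 2 ((volume : Measure Plane).restrict Ω)

/-- `g` is the weak gradient on `Ω` of `u`. As both are square integrable, this says that `u`
belongs to `W^{1,2}(Ω)` and `∇u = g`. -/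
def IsWeakGradient (Ω : Set Plane) (u : L2 Ω) (g : L2Field Ω) : Prop :=
  ∀ φ : Plane → ℝ, ContDiff ℝ ∞ φ → HasCompactSupport φ → tsupport φ ⊆ Ω →
    ∫ x in Ω, u x • gradient φ x = - ∫ x in Ω, φ x • g x

/-- The boundary condition `u = 0` on `S` for a function `u` with weak gradient `g`: `u` is a limit,
in the norm of `W^{1,2}(Ω)`, of (restrictions of) smooth functions on the plane that vanish in a
neighbourhood of `S`. -/
def VanishesOn (Ω S : Set Plane) (u : L2 Ω) (g : L2Field Ω) : Prop :=
  ∀ ε : ℝ≥0∞, 0 < ε → ∃ φ : Plane → ℝ, ContDiff ℝ ∞ φ ∧ Disjoint (tsupport φ) S ∧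
    eLpNorm (fun x => u x - φ x) 2 (volume.restrict Ω) ≤ ε ∧
    eLpNorm (fun x => g x - gradient φ x) 2 (volume.restrict Ω) ≤ ε

/-- `u ∈ W^{1,2}(Ω)` with `∇u = g`, and `u = 0` on `S`. -/
def MemMixedSobolev (Ω S : Set Plane) (u : L2 Ω) (g : L2Field Ω) : Prop :=
  IsWeakGradient Ω u g ∧ VanishesOn Ω S u g

/-- `u` is a weak solution of `Δu + μu = 0` in `Ω`, `u = 0` on `S`, `∂u/∂ν = 0` on `∂Ω ∖ S`:
`u` lies in the form domain and `∫ ∇u · ∇v = μ ∫ u v` for all `v` in the form domain. -/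
def IsMixedEigenfunction (Ω S : Set Plane) (μ : ℝ) (u : L2 Ω) : Prop :=
  ∃ g : L2Field Ω, MemMixedSobolev Ω S u g ∧
    ∀ (v : L2 Ω) (w : L2Field Ω), MemMixedSobolev Ω S v w →
      ∫ x in Ω, inner ℝ (g x) (w x) = μ * ∫ x in Ω, u x * v x

/-- The `k`-th eigenvalue (`k ≥ 1`, counted with multiplicity, in non-decreasing order) of the
Laplacian on `Ω` with Dirichlet condition on `S` and Neumann condition on `∂Ω ∖ S`: the least `Λ`
such that there are `k` linearly independent eigenfunctions with eigenvalues at most `Λ`. -/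
def mixedEigenvalue (Ω S : Set Plane) (k : ℕ) : ℝ :=
  sInf {Λ : ℝ | ∃ u : Fin k → L2 Ω, LinearIndependent ℝ u ∧
    ∀ i, ∃ μ : ℝ, μ ≤ Λ ∧ IsMixedEigenfunction Ω S μ (u i)}

/-- A trapezoid `ABCD`, given by its vertices in cyclic order, in an arbitrary position in the plane.
The parallel sides are `AB` and `DC` and the legs are `AD` and `BC`. -/
structure Trapezoid where
  A : Plane
  B : Plane
  C : Plane
  D : Plane
  nondegenerate : AffineIndependent ℝ ![A, B, D]
  parallel : ∃ t : ℝ, 0 < t ∧ C - D = t • (B - A)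

namespace Trapezoid

/-- The open region bounded by the trapezoid. -/
def domain (T : Trapezoid) : Set Plane :=
  interior (convexHull ℝ {T.A, T.B, T.C, T.D})

/-- The union of the two legs. -/
def legs (T : Trapezoid) : Set Plane :=
  segment ℝ T.A T.D ∪ segment ℝ T.B T.C

/-- The mean of the lengths of the two parallel sides. -/
def meanWidth (T : Trapezoid) : ℝ :=
  (dist T.A T.B + dist T.D T.C) / 2

/-- The distance between the lines that carry the two parallel sides. -/
def height (T : Trapezoid) : ℝ :=
  Metric.infDist T.D (line[ℝ, T.A, T.B] : Set Plane)

/-- The trapezoid is a rectangle: a parallelogram with a right angle at `A`. -/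
def IsRectangle (T : Trapezoid) : Prop :=
  T.C - T.D = T.B - T.A ∧ inner ℝ (T.B - T.A) (T.D - T.A) = 0

/-- The `k`-th eigenvalue for the Dirichlet condition on the legs and the Neumann condition on the
parallel sides. -/
def eigenvalueLegs (T : Trapezoid) (k : ℕ) : ℝ :=
  mixedEigenvalue T.domain T.legs k

end Trapezoid

end

/-! Glue the trapezoid along the leg `BC` to its image under the point reflection in the midpoint of
`BC`. The slices at height `y` have lengths `w(y)` and `w(h - y)`, whose sum is always `2m`, so the
result is a parallelogram all of whose horizontal slices have length `2m`. A pair of functions that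
vanish on the legs glues to a function that vanishes on the outer sides, so it is `2m`-periodic on
every slice and may be expanded in the Fourier modes `exp (-2πinx/2m)`.

Let `κ = (πk/m)²`. The modes with `|n| ≥ k` cost at least `(2πk/2m)² = κ` in the horizontal part of
the Dirichlet integral. The coefficient of a mode with `|n| < k` is a function of `y ∈ [0, h]`; if
its mean vanishes, the Neumann form of Wirtinger's inequality gives the factor `(π/h)²` in the
vertical part, and this is at least `κ` exactly because `h/m ≤ 1/k`. This is `poincare_strip`,
carried over to the form domain in `TrapezoidFrame.poincare_mixedSpace`.

For real functions the vanishing of these means amounts to `2k - 1` real conditions. If `k`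
independent eigenfunctions have eigenvalues at most `Λ`, the pairs of their combinations form a
space of dimension `2k`, so some non-zero pair meets all the conditions
(`TrapezoidFrame.exists_coefficient_eq_zero`). On the span the Dirichlet integral is at most `Λ`
times the squared norm (`norm_sum_snd_sq_le`), hence `κ ≤ Λ` (`Trapezoid.le_of_eigenfunctions`).

The `k`-th eigenvalue is an infimum, so `k` eigenfunctions must exist. Cutting the strip into `N`
thin slabs makes the vertical gap `πN/h` as large as desired; the same inequality then shows that
the form domain embeds compactly in `L²`, and the spectral theorem applies
(`Trapezoid.exists_eigenfunctions`). For the rectangle the first `k` sines of the abscissa attain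
the bound (`Trapezoid.exists_eigenfunctions_of_isRectangle`). -/

/-! ### Wirtinger inequalities in one variable, by Fourier series. -/

/-- The conjugate of the `n`-th Fourier monomial of period `T`. -/
noncomputable def fourierMode (T : ℝ) (n : ℤ) (x : ℝ) : ℂ :=
  Complex.exp (((-(2 * Real.pi * n * x / T) : ℝ) : ℂ) * Complex.I)

lemma continuous_fourierMode (T : ℝ) (n : ℤ) : Continuous (fourierMode T n) := by
  unfold fourierMode
  fun_prop

lemma norm_fourierMode (T : ℝ) (n : ℤ) (x : ℝ) : ‖fourierMode T n x‖ = 1 :=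
  Complex.norm_exp_ofReal_mul_I _

lemma fourierMode_neg (T : ℝ) (n : ℤ) (x : ℝ) :
    fourierMode T (-n) x = starRingEnd ℂ (fourierMode T n x) := by
  unfold fourierMode
  rw [← Complex.exp_conj]
  congr 1
  simp only [map_mul, Complex.conj_ofReal, Complex.conj_I]
  push_cast
  ring

lemma fourierMode_zero (T : ℝ) (x : ℝ) : fourierMode T 0 x = 1 := by
  simp [fourierMode]

lemma fourierCoeffOn_eq_fourierMode {a T : ℝ} (hab : a < a + T) (f : ℝ → ℂ) (n : ℤ) :
    fourierCoeffOn hab f n = (1 / T : ℝ) * ∫ x in a..a + T, fourierMode T n x * f x := by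
  rw [fourierCoeffOn_eq_integral, add_sub_cancel_left, Complex.real_smul]
  congr 1
  refine intervalIntegral.integral_congr fun x _ => ?_
  simp only [smul_eq_mul, fourier_coe_apply, fourierMode]
  congr 2
  push_cast
  ring

/-- Bessel's inequality on an interval of length `T`. -/
lemma sum_sq_fourierMode_le {a T : ℝ} (hT : 0 < T) {f : ℝ → ℂ}
    (hf : MemLp f 2 (volume.restrict (Set.Ioc a (a + T)))) (s : Finset ℤ) :
    T * ∑ n ∈ s, ‖(1 / T : ℝ) * ∫ x in a..a + T, fourierMode T n x * f x‖ ^ 2 ≤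
      ∫ x in a..a + T, ‖f x‖ ^ 2 := by
  have hab : a < a + T := by linarith
  have h := hasSum_sq_fourierCoeffOn hab hf
  simp_rw [fourierCoeffOn_eq_fourierMode hab, add_sub_cancel_left] at h
  have h2 := sum_le_hasSum s (fun i _ => by positivity) h
  rw [smul_eq_mul, inv_mul_eq_div, le_div_iff₀ hT] at h2
  linarith

/-- Wirtinger's inequality for periodic functions, with the low Fourier modes removed. -/
lemma wirtinger_periodic {a T : ℝ} (hT : 0 < T) {g g' : ℝ → ℂ}
    (hg : ContinuousOn g (Set.Icc a (a + T)))
    (hg' : ∀ x ∈ Set.Ioo a (a + T), HasDerivWithinAt g (g' x) (Set.Ioi x) x)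
    (hL : MemLp g' 2 (volume.restrict (Set.Ioc a (a + T)))) (hper : g (a + T) = g a) (M : ℕ) :
    (2 * Real.pi * M / T) ^ 2 * ((∫ x in a..a + T, ‖g x‖ ^ 2) -
      T * ∑ n ∈ Finset.Ioo (-M : ℤ) M,
        ‖(1 / T : ℝ) * ∫ x in a..a + T, fourierMode T n x * g x‖ ^ 2) ≤
      ∫ x in a..a + T, ‖g' x‖ ^ 2 := by
  have hab : a < a + T := by linarith
  have hgL : MemLp g 2 (volume.restrict (Set.Ioc a (a + T))) := by
    have h1 : MemLp g 2 (volume.restrict (Set.Icc a (a + T))) := by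
      obtain ⟨C, hC⟩ := isCompact_Icc.exists_bound_of_continuousOn hg
      exact MemLp.of_bound (hg.aestronglyMeasurable measurableSet_Icc) C
        ((ae_restrict_iff' measurableSet_Icc).mpr (.of_forall hC))
    exact h1.mono_measure (Measure.restrict_mono Set.Ioc_subset_Icc_self le_rfl)
  have h := hasSum_sq_fourierCoeffOn hab hgL
  have h' := hasSum_sq_fourierCoeffOn hab hL
  have hint : IntervalIntegrable g' volume a (a + T) := by
    rw [intervalIntegrable_iff_integrableOn_Ioc_of_le hab.le]
    exact hL.integrable (by norm_num)
  -- Integration by parts in the Fourier coefficient; the boundary term is cancelled by `hper`.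
  have hrel : ∀ n : ℤ, n ≠ 0 →
      ‖fourierCoeffOn hab g' n‖ ^ 2 = (2 * Real.pi * n / T) ^ 2 * ‖fourierCoeffOn hab g n‖ ^ 2 := by
    intro n hn
    have := fourierCoeffOn_of_hasDeriv_right hab hn (by rwa [Set.uIcc_of_le hab.le])
      (by rwa [min_eq_left hab.le, max_eq_right hab.le]) hint
    rw [this, hper, sub_self, mul_zero, zero_sub, norm_mul, norm_neg, norm_mul, mul_pow, mul_pow]
    have e1 : ‖((a + T : ℝ) : ℂ) - (a : ℂ)‖ = T := by
      rw [← Complex.ofReal_sub, Complex.norm_real, add_sub_cancel_left, Real.norm_eq_abs,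
        abs_of_pos hT]
    have e2 : ‖(1 : ℂ) / (-2 * Real.pi * Complex.I * n)‖ ^ 2 = 1 / (2 * Real.pi * n) ^ 2 := by
      rw [norm_div, norm_one, div_pow, one_pow]
      congr 1
      simp [mul_pow]
    rw [e1, e2]
    have : (n : ℝ) ≠ 0 := by exact_mod_cast hn
    field_simp
  simp_rw [← fourierCoeffOn_eq_fourierMode hab]
  set c := fourierCoeffOn hab g
  set d := fourierCoeffOn hab g'
  set ν := 2 * Real.pi * M / T with hν
  -- The finite sum is written as a series over all of `ℤ`, so that the two Parseval identities can
  -- be compared term by term.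
  have hfin : HasSum (fun n => if n ∈ Finset.Ioo (-M : ℤ) M then ‖c n‖ ^ 2 else 0)
      (∑ n ∈ Finset.Ioo (-M : ℤ) M, ‖c n‖ ^ 2) := by
    have := hasSum_sum_of_ne_finset_zero (f := fun n => if n ∈ Finset.Ioo (-M : ℤ) M then
      ‖c n‖ ^ 2 else 0) (s := Finset.Ioo (-M : ℤ) M)
      (L := .unconditional ℤ) (fun b hb => if_neg hb)
    rwa [Finset.sum_congr rfl (fun n hn => if_pos hn)] at this
  have hle := hasSum_le (fun n => ?_) ((h.sub hfin).mul_left (ν ^ 2)) h'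
  · rw [add_sub_cancel_left, smul_eq_mul, smul_eq_mul, inv_mul_eq_div, inv_mul_eq_div] at hle
    rw [le_div_iff₀ hT] at hle
    calc _ = _ := ?_
      _ ≤ _ := hle
    field_simp
  · by_cases hn : n ∈ Finset.Ioo (-M : ℤ) M
    · simp only [hn, if_true, sub_self, mul_zero]
      positivity
    · simp only [hn, if_false, sub_zero]
      have hn' : M ≤ |n| := by
        rw [Finset.mem_Ioo, ← abs_lt] at hn
        exact not_lt.mp hn
      by_cases hn0 : n = 0
      · have hM : M = 0 := by simpa [hn0] using hn'
        simp only [hν, hM]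
        simp
      · rw [hrel n hn0]
        refine mul_le_mul_of_nonneg_right ?_ (by positivity)
        rw [sq_le_sq]
        have : (M : ℝ) ≤ |(n : ℝ)| := by exact_mod_cast hn'
        rw [hν, abs_div, abs_div, abs_mul, abs_mul (2 * Real.pi)]
        rw [Nat.abs_cast]
        gcongr

/-- The even extension may have a kink at `0`, so only right derivatives exist everywhere; these
suffice for the Fourier coefficients of a derivative. -/
lemma hasDerivWithinAt_comp_abs {c c' : ℝ → ℂ} (hc : ∀ y, HasDerivAt c (c' y) y) (x : ℝ) :
    HasDerivWithinAt (fun x => c |x|) (if 0 ≤ x then c' x else -c' (-x)) (Set.Ioi x) x := by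
  split_ifs with hx
  · refine ((hc x).hasDerivWithinAt (s := Set.Ioi x)).congr (fun y hy => ?_) ?_
    · rw [abs_of_nonneg (hx.trans hy.le)]
    · rw [abs_of_nonneg hx]
  · have h1 : HasDerivAt (fun x => c (-x)) (-c' (-x)) x := by
      have := (hc (-x)).scomp x (hasDerivAt_neg x)
      rwa [neg_one_smul] at this
    refine (h1.congr_of_eventuallyEq ?_).hasDerivWithinAt
    filter_upwards [Iio_mem_nhds (not_le.mp hx)] with y hy
    rw [abs_of_neg hy]

lemma integral_even_extension {E : Type*} [NormedAddCommGroup E] [NormedSpace ℝ E]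
    {f : ℝ → E} {l : ℝ}
    (hf : IntervalIntegrable f volume 0 l) {g : ℝ → E} (hl : 0 ≤ l)
    (hg : ∀ x, 0 < x → g x = f x) (hg' : ∀ x, x < 0 → g x = f (-x)) :
    ∫ x in (-l)..l, g x = 2 • ∫ x in (0 : ℝ)..l, f x := by
  have e1 : ∫ x in (0 : ℝ)..l, g x = ∫ x in (0 : ℝ)..l, f x := by
    refine intervalIntegral.integral_congr_ae (.of_forall fun x hx => ?_)
    rw [Set.uIoc_of_le hl] at hx
    exact hg x hx.1
  have h2 : ∀ᵐ x : ℝ, x ∈ Set.uIoc (-l) 0 → g x = f (-x) := by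
    filter_upwards [Measure.ae_ne volume (0 : ℝ)] with x hx0 hx
    rw [Set.uIoc_of_le (by linarith)] at hx
    exact hg' x (lt_of_le_of_ne hx.2 hx0)
  have e2 : ∫ x in (-l)..0, g x = ∫ x in (0 : ℝ)..l, f x := by
    rw [intervalIntegral.integral_congr_ae h2, intervalIntegral.integral_comp_neg]
    simp
  have i1 : IntervalIntegrable g volume 0 l := by
    refine hf.congr_ae ?_
    refine (ae_restrict_iff' measurableSet_uIoc).mpr (.of_forall fun x hx => ?_)
    rw [Set.uIoc_of_le hl] at hx
    exact (hg x hx.1).symm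
  have i2 : IntervalIntegrable g volume (-l) 0 := by
    have : IntervalIntegrable (fun x => f (-x)) volume (-l) 0 := by
      simpa using ((IntervalIntegrable.iff_comp_neg).mp hf).symm
    refine this.congr_ae ?_
    refine (ae_restrict_iff' measurableSet_uIoc).mpr ?_
    filter_upwards [h2] with x hx hx'
    exact (hx hx').symm
  rw [← intervalIntegral.integral_add_adjacent_intervals i2 i1, e1, e2, two_smul]

/-- The Neumann form of Wirtinger's inequality on `[0, l]`. -/
lemma wirtinger_neumann_zero {l : ℝ} (hl : 0 < l) {c c' : ℝ → ℂ}
    (hc : ∀ y, HasDerivAt c (c' y) y) (hc' : Continuous c') :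
    (Real.pi / l) ^ 2 * ((∫ x in (0 : ℝ)..l, ‖c x‖ ^ 2) -
      l * ‖(1 / l : ℝ) * ∫ x in (0 : ℝ)..l, c x‖ ^ 2) ≤ ∫ x in (0 : ℝ)..l, ‖c' x‖ ^ 2 := by
  have hcc : Continuous c := continuous_iff_continuousAt.mpr fun y => (hc y).continuousAt
  have hT : -l + 2 * l = l := by ring
  -- The even extension has equal values at `-l` and `l` whatever the boundary values of `c`, hence
  -- the Neumann form. `M = 1` removes the mean only, and `2π / (2l) = π / l`.
  have key := wirtinger_periodic (a := -l) (T := 2 * l) (by linarith) (g := fun x => c |x|)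
    (g' := fun x => if 0 ≤ x then c' x else -c' (-x)) (by fun_prop)
    (fun x _ => hasDerivWithinAt_comp_abs hc x) ?_ (by simp [hT]) 1
  · rw [hT] at key
    have e1 : ∫ x in (-l)..l, ‖c |x|‖ ^ 2 = 2 • ∫ x in (0 : ℝ)..l, ‖c x‖ ^ 2 :=
      integral_even_extension (by apply Continuous.intervalIntegrable; fun_prop) hl.le
        (fun x hx => by rw [abs_of_pos hx]) (fun x hx => by rw [abs_of_neg hx])
    have e2 : ∫ x in (-l)..l, ‖if 0 ≤ x then c' x else -c' (-x)‖ ^ 2 =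
        2 • ∫ x in (0 : ℝ)..l, ‖c' x‖ ^ 2 :=
      integral_even_extension (by apply Continuous.intervalIntegrable; fun_prop) hl.le
        (fun x hx => by rw [if_pos hx.le]) (fun x hx => by rw [if_neg (not_le.mpr hx), norm_neg])
    have e3 : ∫ x in (-l)..l, c |x| = 2 • ∫ x in (0 : ℝ)..l, c x :=
      integral_even_extension (by apply Continuous.intervalIntegrable; fun_prop) hl.le
        (fun x hx => by rw [abs_of_pos hx]) (fun x hx => by rw [abs_of_neg hx])
    have e4 : Finset.Ioo (-((1 : ℕ) : ℤ)) ((1 : ℕ) : ℤ) = {0} := by decide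
    rw [e1, e2, e4, Finset.sum_singleton] at key
    simp only [fourierMode_zero, one_mul] at key
    rw [e3] at key
    have e5 : ((1 / (2 * l) : ℝ) : ℂ) * (2 • ∫ x in (0 : ℝ)..l, c x) =
        ((1 / l : ℝ) : ℂ) * ∫ x in (0 : ℝ)..l, c x := by
      rw [two_smul, ← two_mul, ← mul_assoc]
      congr 1
      push_cast
      field_simp
    rw [e5, two_smul, two_smul] at key
    have e6 : 2 * Real.pi * ((1 : ℕ) : ℝ) / (2 * l) = Real.pi / l := by
      push_cast
      field_simp
    rw [e6] at key
    linarith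
  · have hb : ∃ C, ∀ x ∈ Set.Icc (-l) l, ‖c' x‖ ≤ C :=
      isCompact_Icc.exists_bound_of_continuousOn hc'.continuousOn
    obtain ⟨C, hC⟩ := hb
    refine MemLp.of_bound ?_ C ?_
    · refine (Measurable.ite measurableSet_Ici hc'.measurable ?_).aestronglyMeasurable
      exact (hc'.comp continuous_neg).neg.measurable
    · refine (ae_restrict_iff' measurableSet_Ioc).mpr (.of_forall fun x hx => ?_)
      rw [hT] at hx
      split_ifs
      · exact hC x ⟨hx.1.le, hx.2⟩
      · rw [norm_neg]
        exact hC _ ⟨by linarith [hx.2], by linarith [hx.1]⟩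

/-- The Neumann form of Wirtinger's inequality. -/
lemma wirtinger_neumann {α β : ℝ} (hαβ : α < β) {c c' : ℝ → ℂ}
    (hc : ∀ y, HasDerivAt c (c' y) y) (hc' : Continuous c') :
    (Real.pi / (β - α)) ^ 2 * ((∫ x in α..β, ‖c x‖ ^ 2) -
      (β - α) * ‖(1 / (β - α) : ℝ) * ∫ x in α..β, c x‖ ^ 2) ≤ ∫ x in α..β, ‖c' x‖ ^ 2 := by
  have key := wirtinger_neumann_zero (l := β - α) (by linarith) (c := fun x => c (x + α))
    (c' := fun x => c' (x + α)) (fun y => (hc (y + α)).comp_add_const y α) (by fun_prop)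
  have e (f : ℝ → ℝ) : ∫ x in (0 : ℝ)..(β - α), f (x + α) = ∫ x in α..β, f x := by simp
  have e' (f : ℝ → ℂ) : ∫ x in (0 : ℝ)..(β - α), f (x + α) = ∫ x in α..β, f x := by simp
  rw [e (fun x => ‖c x‖ ^ 2), e (fun x => ‖c' x‖ ^ 2), e'] at key
  exact key

/-! ### Poincaré inequalities on a sheared strip and on its slabs. -/

/-- Lowers the constant of a Wirtinger inequality without first showing that the deficit `D`, a norm
minus the removed modes, is non-negative. -/
lemma mul_le_of_le_of_mul_le {κ ν D E : ℝ} (h0 : 0 ≤ κ) (hκ : κ ≤ ν) (h : ν * D ≤ E) (hE : 0 ≤ E) :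
    κ * D ≤ E := by
  rcases le_total 0 D with hD | hD
  · exact (mul_le_mul_of_nonneg_right hκ hD).trans h
  · exact (mul_nonpos_of_nonneg_of_nonpos h0 hD).trans hE

/-- The limits of integration stay fixed although the slices of the strip move with the height: the
function vanishes outside its slice, so no boundary terms are wanted. -/
lemma hasDerivAt_intervalIntegral_mul {F : ℝ × ℝ → ℝ} (hF : ContDiff ℝ 1 F) {w : ℝ → ℂ}
    (hw : Continuous w) (x₀ x₁ y : ℝ) :
    HasDerivAt (fun y => ∫ x in x₀..x₁, w x * (F (y, x) : ℂ))
      (∫ x in x₀..x₁, w x * (fderiv ℝ F (y, x) (1, 0) : ℂ)) y := by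
  have hFc : Continuous F := hF.continuous
  have hF' : Continuous fun p : ℝ × ℝ => fderiv ℝ F p (1, 0) :=
    (hF.continuous_fderiv one_ne_zero).clm_apply continuous_const
  obtain ⟨C, hC⟩ := ((isCompact_closedBall y 1).prod
    (isCompact_uIcc (a := x₀) (b := x₁))).exists_bound_of_continuousOn
    (f := fun p : ℝ × ℝ => w p.2 * (fderiv ℝ F p (1, 0) : ℂ)) (by fun_prop)
  refine (intervalIntegral.hasDerivAt_integral_of_dominated_loc_of_deriv_le
    (s := Metric.ball y 1) (F' := fun y x => w x * (fderiv ℝ F (y, x) (1, 0) : ℂ))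
    (bound := fun _ => C) (Metric.ball_mem_nhds y one_pos) (.of_forall fun y' => ?_) ?_ ?_ ?_ ?_ ?_).2
  · exact Continuous.aestronglyMeasurable (by fun_prop)
  · exact Continuous.intervalIntegrable (by fun_prop) _ _
  · refine Continuous.aestronglyMeasurable ?_
    exact hw.mul (Complex.continuous_ofReal.comp (hF'.comp (by fun_prop)))
  · refine .of_forall fun x hx y' hy' => ?_
    exact hC (y', x) ⟨Metric.ball_subset_closedBall hy', Set.uIoc_subset_uIcc hx⟩
  · exact intervalIntegrable_const
  · refine .of_forall fun x _ y' _ => ?_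
    have h1 : HasDerivAt (fun y => F (y, x)) (fderiv ℝ F (y', x) (1, 0)) y' :=
      ((hF.differentiable one_ne_zero (y', x)).hasFDerivAt).comp_hasDerivAt y'
        ((hasDerivAt_id y').prodMk (hasDerivAt_const y' x))
    exact h1.ofReal_comp.const_mul (w x)

/-- Passes between the fixed interval, where one differentiates in the height, and the moving slice,
where one uses periodicity. -/
lemma intervalIntegral_eq_of_eq_zero {E : Type*} [NormedAddCommGroup E] [NormedSpace ℝ E]
    {f : ℝ → E} {a b x₀ x₁ : ℝ} (hf : ∀ x ∈ Set.Icc x₀ x₁, x ∉ Set.Ioo a b → f x = 0)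
    (h0 : x₀ ≤ a) (hab : a ≤ b) (h1 : b ≤ x₁) : ∫ x in x₀..x₁, f x = ∫ x in a..b, f x := by
  have hs : Function.support ((Set.Icc x₀ x₁).indicator f) ⊆ Set.Ioo a b := fun x hx => by
    by_contra h
    exact hx (Set.indicator_apply_eq_zero.mpr fun hx' => hf x hx' h)
  have e1 : ∫ x in x₀..x₁, f x = ∫ x in x₀..x₁, (Set.Icc x₀ x₁).indicator f x := by
    refine intervalIntegral.integral_congr fun x hx => ?_
    rw [Set.uIcc_of_le (h0.trans (hab.trans h1))] at hx
    exact (Set.indicator_of_mem hx f).symm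
  have e2 : ∫ x in a..b, f x = ∫ x in a..b, (Set.Icc x₀ x₁).indicator f x := by
    refine intervalIntegral.integral_congr fun x hx => ?_
    rw [Set.uIcc_of_le hab] at hx
    exact (Set.indicator_of_mem (Set.Icc_subset_Icc h0 h1 hx) f).symm
  rw [e1, e2, intervalIntegral.integral_eq_integral_of_support_subset
      (hs.trans Set.Ioo_subset_Ioc_self), intervalIntegral.integral_eq_integral_of_support_subset
      (hs.trans ((Set.Ioo_subset_Ioo h0 h1).trans Set.Ioo_subset_Ioc_self))]

/-- A Poincaré inequality on a strip for functions each of whose horizontal slices vanishes outside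
an interval of length `T`: up to the means of the low Fourier modes, the Dirichlet integral
controls the `L²` norm. -/
lemma poincare_strip {F : ℝ × ℝ → ℝ} (hF : ContDiff ℝ 1 F) {α β x₀ x₁ T κ : ℝ} (hαβ : α < β)
    (hT : 0 < T) {a : ℝ → ℝ} (ha : ∀ y ∈ Set.Icc α β, x₀ ≤ a y ∧ a y + T ≤ x₁)
    (h0 : ∀ y ∈ Set.Icc α β, ∀ x ∈ Set.Icc x₀ x₁, x ∉ Set.Ioo (a y) (a y + T) →
      F (y, x) = 0 ∧ fderiv ℝ F (y, x) = 0)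
    (M : ℕ) (hκ0 : 0 ≤ κ) (hκM : κ ≤ (2 * Real.pi * M / T) ^ 2)
    (hκβ : κ ≤ (Real.pi / (β - α)) ^ 2) :
    κ * ∫ y in α..β, ∫ x in x₀..x₁, F (y, x) ^ 2 ≤
      (∫ y in α..β, ∫ x in x₀..x₁, (fderiv ℝ F (y, x) (1, 0) ^ 2 + fderiv ℝ F (y, x) (0, 1) ^ 2)) +
      κ / (T * (β - α)) * ∑ n ∈ Finset.Ioo (-M : ℤ) M,
        ‖∫ y in α..β, ∫ x in x₀..x₁, fourierMode T n x * (F (y, x) : ℂ)‖ ^ 2 := by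
  have hFc : Continuous F := hF.continuous
  have hFy : Continuous fun p : ℝ × ℝ => fderiv ℝ F p (1, 0) :=
    (hF.continuous_fderiv one_ne_zero).clm_apply continuous_const
  have hFx : Continuous fun p : ℝ × ℝ => fderiv ℝ F p (0, 1) :=
    (hF.continuous_fderiv one_ne_zero).clm_apply continuous_const
  have hmode := continuous_fourierMode T
  set c : ℤ → ℝ → ℂ := fun n y => (1 / T : ℝ) * ∫ x in x₀..x₁, fourierMode T n x * (F (y, x) : ℂ)
    with hc
  set c' : ℤ → ℝ → ℂ := fun n y =>
    (1 / T : ℝ) * ∫ x in x₀..x₁, fourierMode T n x * (fderiv ℝ F (y, x) (1, 0) : ℂ) with hc'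
  have hder (n : ℤ) (y : ℝ) : HasDerivAt (c n) (c' n y) y :=
    (hasDerivAt_intervalIntegral_mul hF (hmode n) x₀ x₁ y).const_mul _
  have hccont (n : ℤ) : Continuous (c n) :=
    continuous_iff_continuousAt.mpr fun y => (hder n y).continuousAt
  have hccont' (n : ℤ) : Continuous (c' n) := by
    refine continuous_const.mul ?_
    refine intervalIntegral.continuous_parametric_intervalIntegral_of_continuous' ?_ _ _
    exact ((hmode n).comp continuous_snd).mul (Complex.continuous_ofReal.comp hFy)
  have hcontF : Continuous fun y => ∫ x in x₀..x₁, F (y, x) ^ 2 :=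
    intervalIntegral.continuous_parametric_intervalIntegral_of_continuous' (by fun_prop) _ _
  have hcontFy : Continuous fun y => ∫ x in x₀..x₁, fderiv ℝ F (y, x) (1, 0) ^ 2 :=
    intervalIntegral.continuous_parametric_intervalIntegral_of_continuous' (hFy.pow 2) _ _
  have hcontFx : Continuous fun y => ∫ x in x₀..x₁, fderiv ℝ F (y, x) (0, 1) ^ 2 :=
    intervalIntegral.continuous_parametric_intervalIntegral_of_continuous' (hFx.pow 2) _ _
  -- On each slice the function vanishes at both ends, hence is periodic, and its horizontal
  -- derivative controls the modes with `|n| ≥ M`.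
  have slice_x : ∀ y ∈ Set.Icc α β, κ * ((∫ x in x₀..x₁, F (y, x) ^ 2) -
      T * ∑ n ∈ Finset.Ioo (-M : ℤ) M, ‖c n y‖ ^ 2) ≤
        ∫ x in x₀..x₁, fderiv ℝ F (y, x) (0, 1) ^ 2 := by
    intro y hy
    have hz := h0 y hy
    have hFcy : Continuous fun x => F (y, x) := by fun_prop
    have hFxy : Continuous fun x => fderiv ℝ F (y, x) (0, 1) := hFx.comp (by fun_prop)
    have key := wirtinger_periodic (a := a y) hT (g := fun x => (F (y, x) : ℂ))
      (g' := fun x => (fderiv ℝ F (y, x) (0, 1) : ℂ)) (by fun_prop) (fun x _ => ?_) ?_ ?_ M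
    · have e1 : ∫ x in x₀..x₁, F (y, x) ^ 2 = ∫ x in a y..a y + T, ‖(F (y, x) : ℂ)‖ ^ 2 := by
        rw [intervalIntegral_eq_of_eq_zero _ (ha y hy).1 (by linarith) (ha y hy).2]
        · simp
        · intro x hx' hx
          simp [(hz x hx' hx).1]
      have e2 : ∫ x in x₀..x₁, fderiv ℝ F (y, x) (0, 1) ^ 2 =
          ∫ x in a y..a y + T, ‖(fderiv ℝ F (y, x) (0, 1) : ℂ)‖ ^ 2 := by
        rw [intervalIntegral_eq_of_eq_zero _ (ha y hy).1 (by linarith) (ha y hy).2]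
        · simp
        · intro x hx' hx
          simp [(hz x hx' hx).2]
      have e3 (n : ℤ) : c n y =
          (1 / T : ℝ) * ∫ x in a y..a y + T, fourierMode T n x * (F (y, x) : ℂ) := by
        rw [hc]
        simp only
        rw [intervalIntegral_eq_of_eq_zero _ (ha y hy).1 (by linarith) (ha y hy).2]
        intro x hx' hx
        simp [(hz x hx' hx).1]
      simp_rw [e3]
      rw [e1, e2]
      refine mul_le_of_le_of_mul_le hκ0 hκM key ?_
      exact intervalIntegral.integral_nonneg (by linarith) fun _ _ => by positivity
    · have h1 : HasDerivAt (fun x => F (y, x)) (fderiv ℝ F (y, x) (0, 1)) x :=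
        ((hF.differentiable one_ne_zero (y, x)).hasFDerivAt).comp_hasDerivAt x
          ((hasDerivAt_const x y).prodMk (hasDerivAt_id x))
      exact h1.ofReal_comp.hasDerivWithinAt
    · have : Continuous fun x => (fderiv ℝ F (y, x) (0, 1) : ℂ) :=
        Complex.continuous_ofReal.comp hFxy
      obtain ⟨C, hC⟩ := (isCompact_Icc (a := a y) (b := a y + T)).exists_bound_of_continuousOn
        this.continuousOn
      exact MemLp.of_bound this.aestronglyMeasurable C ((ae_restrict_iff' measurableSet_Ioc).mpr
        (.of_forall fun x hx => hC x (Set.Ioc_subset_Icc_self hx)))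
    · rw [(hz (a y + T) ⟨by linarith [(ha y hy).1], (ha y hy).2⟩ (by simp)).1,
        (hz (a y) ⟨(ha y hy).1, by linarith [(ha y hy).2]⟩ (by simp)).1]
  -- The low modes are controlled by the vertical derivative: by Bessel its slice norm dominates the
  -- derivatives of their coefficients.
  have slice_y : ∀ y ∈ Set.Icc α β, T * ∑ n ∈ Finset.Ioo (-M : ℤ) M, ‖c' n y‖ ^ 2 ≤
      ∫ x in x₀..x₁, fderiv ℝ F (y, x) (1, 0) ^ 2 := by
    intro y hy
    have hz := h0 y hy
    have hcont : Continuous fun x => (fderiv ℝ F (y, x) (1, 0) : ℂ) :=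
      Complex.continuous_ofReal.comp (hFy.comp (by fun_prop))
    obtain ⟨C, hC⟩ := (isCompact_Icc (a := a y) (b := a y + T)).exists_bound_of_continuousOn
      hcont.continuousOn
    have key := sum_sq_fourierMode_le (a := a y) hT (MemLp.of_bound hcont.aestronglyMeasurable C
      ((ae_restrict_iff' measurableSet_Ioc).mpr
        (.of_forall fun x hx => hC x (Set.Ioc_subset_Icc_self hx)))) (Finset.Ioo (-M : ℤ) M)
    have e2 : ∫ x in x₀..x₁, fderiv ℝ F (y, x) (1, 0) ^ 2 =
        ∫ x in a y..a y + T, ‖(fderiv ℝ F (y, x) (1, 0) : ℂ)‖ ^ 2 := by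
      rw [intervalIntegral_eq_of_eq_zero _ (ha y hy).1 (by linarith) (ha y hy).2]
      · simp
      · intro x hx' hx
        simp [(hz x hx' hx).2]
    have e3 (n : ℤ) : c' n y = (1 / T : ℝ) * ∫ x in a y..a y + T,
        fourierMode T n x * (fderiv ℝ F (y, x) (1, 0) : ℂ) := by
      rw [hc']
      simp only
      rw [intervalIntegral_eq_of_eq_zero _ (ha y hy).1 (by linarith) (ha y hy).2]
      intro x hx' hx
      simp [(hz x hx' hx).2]
    simp_rw [e3]
    rw [e2]
    exact key
  -- Wirtinger in the height, for each low coefficient. Nothing is known at `α` and `β`, so the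
  -- Neumann form is the one that applies.
  have hn (n : ℤ) : κ * ((∫ y in α..β, ‖c n y‖ ^ 2) -
      (β - α) * ‖(1 / (β - α) : ℝ) * ∫ y in α..β, c n y‖ ^ 2) ≤ ∫ y in α..β, ‖c' n y‖ ^ 2 :=
    mul_le_of_le_of_mul_le hκ0 hκβ (wirtinger_neumann hαβ (hder n) (hccont' n))
      (intervalIntegral.integral_nonneg hαβ.le fun _ _ => by positivity)
  have ix := intervalIntegral.integral_mono_on (μ := volume) hαβ.le
    (Continuous.intervalIntegrable (by fun_prop) _ _) (hcontFx.intervalIntegrable _ _) slice_x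
  have iy := intervalIntegral.integral_mono_on (μ := volume) hαβ.le
    (Continuous.intervalIntegrable (by fun_prop) _ _) (hcontFy.intervalIntegrable _ _) slice_y
  have hint (n : ℤ) : IntervalIntegrable (fun y => ‖c n y‖ ^ 2) volume α β :=
    Continuous.intervalIntegrable (by fun_prop) _ _
  have hint' (n : ℤ) : IntervalIntegrable (fun y => ‖c' n y‖ ^ 2) volume α β :=
    Continuous.intervalIntegrable (by fun_prop) _ _
  rw [intervalIntegral.integral_const_mul, intervalIntegral.integral_sub
    (hcontF.intervalIntegrable _ _) (Continuous.intervalIntegrable (by fun_prop) _ _),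
    intervalIntegral.integral_const_mul, intervalIntegral.integral_finsetSum
    (fun n _ => hint n)] at ix
  rw [intervalIntegral.integral_const_mul, intervalIntegral.integral_finsetSum
    (fun n _ => hint' n)] at iy
  have hsum := Finset.sum_le_sum fun n (_ : n ∈ Finset.Ioo (-M : ℤ) M) => hn n
  rw [← Finset.mul_sum, Finset.sum_sub_distrib] at hsum
  -- The coefficient carries a factor `1 / T` and its mean a factor `1 / (β - α)`; squared and
  -- multiplied by `κ * T * (β - α)` they leave `κ / (T * (β - α))`.
  have hmean : κ / (T * (β - α)) * ∑ n ∈ Finset.Ioo (-M : ℤ) M,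
        ‖∫ y in α..β, ∫ x in x₀..x₁, fourierMode T n x * (F (y, x) : ℂ)‖ ^ 2 =
      κ * T * ∑ n ∈ Finset.Ioo (-M : ℤ) M,
        (β - α) * ‖(1 / (β - α) : ℝ) * ∫ y in α..β, c n y‖ ^ 2 := by
    rw [Finset.mul_sum, Finset.mul_sum]
    refine Finset.sum_congr rfl fun n _ => ?_
    simp only [hc]
    rw [intervalIntegral.integral_const_mul, norm_mul, norm_mul, Complex.norm_real,
      Complex.norm_real, mul_pow, mul_pow, Real.norm_eq_abs, Real.norm_eq_abs, sq_abs, sq_abs]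
    have : β - α ≠ 0 := by linarith
    field_simp
  have hgrad : (∫ y in α..β, ∫ x in x₀..x₁,
        (fderiv ℝ F (y, x) (1, 0) ^ 2 + fderiv ℝ F (y, x) (0, 1) ^ 2)) =
      (∫ y in α..β, ∫ x in x₀..x₁, fderiv ℝ F (y, x) (1, 0) ^ 2) +
        ∫ y in α..β, ∫ x in x₀..x₁, fderiv ℝ F (y, x) (0, 1) ^ 2 := by
    rw [← intervalIntegral.integral_add (hcontFy.intervalIntegrable _ _)
      (hcontFx.intervalIntegrable _ _)]
    refine intervalIntegral.integral_congr fun y _ => ?_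
    rw [← intervalIntegral.integral_add]
    · exact ((hFy.comp (by fun_prop)).pow 2).intervalIntegrable _ _
    · exact ((hFx.comp (by fun_prop)).pow 2).intervalIntegrable _ _
  rw [hmean, hgrad]
  have := mul_le_mul_of_nonneg_left hsum hT.le
  linarith

/-- A Fourier monomial in the second variable, cut off to the `i`-th of `N` slabs in the first. -/
noncomputable def slabMode (T h : ℝ) (N i : ℕ) (n : ℤ) (q : ℝ × ℝ) : ℂ :=
  (Set.Ioc (i * (h / N)) ((i + 1 : ℕ) * (h / N))).indicator (fun _ => fourierMode T n q.2) q.1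

lemma measurable_slabMode (T h : ℝ) (N i : ℕ) (n : ℤ) : Measurable (slabMode T h N i n) := by
  have : slabMode T h N i n = (Prod.fst ⁻¹' Set.Ioc (i * (h / N)) ((i + 1 : ℕ) * (h / N))).indicator
      (fun q => fourierMode T n q.2) := by
    ext q
    simp [slabMode, Set.indicator]
  rw [this]
  exact ((continuous_fourierMode T n).comp continuous_snd).measurable.indicator
    (measurable_fst measurableSet_Ioc)

lemma norm_slabMode_le (T h : ℝ) (N i : ℕ) (n : ℤ) (q : ℝ × ℝ) : ‖slabMode T h N i n q‖ ≤ 1 := by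
  unfold slabMode
  refine (norm_indicator_le_norm_self _ _).trans ?_
  rw [norm_fourierMode]

lemma slabMode_neg (T h : ℝ) (N i : ℕ) (n : ℤ) (q : ℝ × ℝ) :
    slabMode T h N i (-n) q = starRingEnd ℂ (slabMode T h N i n q) := by
  unfold slabMode Set.indicator
  split_ifs
  · exact fourierMode_neg T n q.2
  · simp

lemma intervalIntegral_intervalIntegral_eq {E : Type*} [NormedAddCommGroup E] [NormedSpace ℝ E]
    {f : ℝ × ℝ → E} (hf : Continuous f) {α β x₀ x₁ : ℝ} (hαβ : α ≤ β) (hx : x₀ ≤ x₁) :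
    ∫ y in α..β, ∫ x in x₀..x₁, f (y, x) = ∫ q in Set.Ioc α β ×ˢ Set.Ioc x₀ x₁, f q := by
  rw [Measure.volume_eq_prod, setIntegral_prod]
  · simp only [intervalIntegral.integral_of_le hαβ, intervalIntegral.integral_of_le hx]
  · refine IntegrableOn.mono_set ?_ (Set.prod_mono Set.Ioc_subset_Icc_self Set.Ioc_subset_Icc_self)
    exact hf.continuousOn.integrableOn_compact (isCompact_Icc.prod isCompact_Icc)

/-- Applying the strip inequality on `N` slabs of height `h / N` raises the vertical gap to `π N /
h`, at the price of `N` times as many means. The lower bound uses `N = 1`, compactness uses large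
`N`. -/
lemma poincare_slabs {F : ℝ × ℝ → ℝ} (hF : ContDiff ℝ 1 F) {h x₀ x₁ T κ : ℝ} (hh : 0 < h)
    (hT : 0 < T) {a : ℝ → ℝ} (ha : ∀ y ∈ Set.Icc 0 h, x₀ ≤ a y ∧ a y + T ≤ x₁)
    (h0 : ∀ y ∈ Set.Icc 0 h, ∀ x ∈ Set.Icc x₀ x₁, x ∉ Set.Ioo (a y) (a y + T) →
      F (y, x) = 0 ∧ fderiv ℝ F (y, x) = 0)
    (M : ℕ) {N : ℕ} (hN : 0 < N) (hκ0 : 0 ≤ κ) (hκM : κ ≤ (2 * Real.pi * M / T) ^ 2)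
    (hκN : κ ≤ (Real.pi * N / h) ^ 2) :
    κ * ∫ q in Set.Ioc 0 h ×ˢ Set.Ioc x₀ x₁, F q ^ 2 ≤
      (∫ q in Set.Ioc 0 h ×ˢ Set.Ioc x₀ x₁,
        (fderiv ℝ F q (1, 0) ^ 2 + fderiv ℝ F q (0, 1) ^ 2)) +
      κ / (T * (h / N)) * ∑ i ∈ Finset.range N, ∑ n ∈ Finset.Ioo (-M : ℤ) M,
        ‖∫ q in Set.Ioc 0 h ×ˢ Set.Ioc x₀ x₁, slabMode T h N i n q * (F q : ℂ)‖ ^ 2 := by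
  have hx : x₀ ≤ x₁ := by
    have := ha 0 ⟨le_rfl, hh.le⟩
    linarith
  have hFc : Continuous F := hF.continuous
  have hFy : Continuous fun p : ℝ × ℝ => fderiv ℝ F p (1, 0) :=
    (hF.continuous_fderiv one_ne_zero).clm_apply continuous_const
  have hFx : Continuous fun p : ℝ × ℝ => fderiv ℝ F p (0, 1) :=
    (hF.continuous_fderiv one_ne_zero).clm_apply continuous_const
  have hN' : (0 : ℝ) < N := by exact_mod_cast hN
  have hδ : 0 < h / N := by positivity
  have hslab (i : ℕ) : (i : ℝ) * (h / N) < (i + 1 : ℕ) * (h / N) := by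
    push_cast
    linarith
  have hsub (i : ℕ) (hi : i ∈ Finset.range N) :
      0 ≤ (i : ℝ) * (h / N) ∧ ((i + 1 : ℕ) : ℝ) * (h / N) ≤ h := by
    refine ⟨by positivity, ?_⟩
    have : ((i + 1 : ℕ) : ℝ) ≤ N := by exact_mod_cast Finset.mem_range.mp hi
    calc ((i + 1 : ℕ) : ℝ) * (h / N) ≤ N * (h / N) := by gcongr
      _ = h := by field_simp
  have key : ∀ i ∈ Finset.range N, _ := fun i hi =>
    poincare_strip hF (hslab i) hT (a := a) (x₀ := x₀) (x₁ := x₁)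
      (fun y hy => ha y ⟨(hsub i hi).1.trans hy.1, hy.2.trans (hsub i hi).2⟩)
      (fun y hy => h0 y ⟨(hsub i hi).1.trans hy.1, hy.2.trans (hsub i hi).2⟩) M hκ0 hκM
      (by
        have : ((i + 1 : ℕ) : ℝ) * (h / N) - i * (h / N) = h / N := by push_cast; ring
        rw [this]
        convert hκN using 2
        field_simp)
  have hsum := Finset.sum_le_sum key
  rw [← Finset.mul_sum, Finset.sum_add_distrib] at hsum
  have adj {f : ℝ → ℝ} (hf : Continuous f) :
      ∑ i ∈ Finset.range N, ∫ y in (i : ℝ) * (h / N)..(i + 1 : ℕ) * (h / N), f y =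
        ∫ y in (0 : ℝ)..h, f y := by
    rw [intervalIntegral.sum_integral_adjacent_intervals (a := fun i : ℕ => (i : ℝ) * (h / N))
      (fun _ _ => hf.intervalIntegrable _ _)]
    congr 1
    · simp
    · field_simp
  rw [adj, adj, intervalIntegral_intervalIntegral_eq (f := fun q => F q ^ 2) (hFc.pow 2) hh.le hx,
    intervalIntegral_intervalIntegral_eq (f := fun q => fderiv ℝ F q (1, 0) ^ 2 +
      fderiv ℝ F q (0, 1) ^ 2) ((hFy.pow 2).add (hFx.pow 2)) hh.le hx] at hsum
  · refine hsum.trans_eq ?_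
    congr 1
    rw [Finset.mul_sum]
    refine Finset.sum_congr rfl fun i hi => ?_
    congr 1
    · congr 2
      push_cast
      ring
    · refine Finset.sum_congr rfl fun n _ => ?_
      congr 2
      rw [intervalIntegral_intervalIntegral_eq (f := fun q => fourierMode T n q.2 * (F q : ℂ))
        (((continuous_fourierMode T n).comp continuous_snd).mul
          (Complex.continuous_ofReal.comp hFc)) (hslab i).le hx]
      set I := Set.Ioc ((i : ℝ) * (h / N)) ((i + 1 : ℕ) * (h / N))
      have hI : I ⊆ Set.Ioc 0 h := fun y hy =>
        ⟨(hsub i hi).1.trans_lt hy.1, hy.2.trans (hsub i hi).2⟩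
      have e : (fun q : ℝ × ℝ => slabMode T h N i n q * (F q : ℂ)) =
          (Prod.fst ⁻¹' I).indicator (fun q => fourierMode T n q.2 * (F q : ℂ)) := by
        ext q
        by_cases hq : q.1 ∈ I
        · rw [Set.indicator_of_mem (by exact hq), slabMode, Set.indicator_of_mem hq]
        · rw [Set.indicator_of_notMem (by exact hq), slabMode, Set.indicator_of_notMem hq, zero_mul]
      rw [e, setIntegral_indicator (measurable_fst measurableSet_Ioc)]
      congr 2
      ext q
      simp only [Set.mem_prod, Set.mem_inter_iff, Set.mem_preimage]
      exact ⟨fun hq => ⟨⟨hI hq.1, hq.2⟩, hq.1⟩, fun hq => ⟨hq.2, hq.1.2⟩⟩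
  · exact intervalIntegral.continuous_parametric_intervalIntegral_of_continuous'
      ((hFy.pow 2).add (hFx.pow 2)) _ _
  · exact intervalIntegral.continuous_parametric_intervalIntegral_of_continuous' (hFc.pow 2) _ _

/-- A function that is `C¹` near a compact set agrees near that set with a `C¹` function. -/
lemma exists_contDiff_eventuallyEq_of_isCompact {F : ℝ × ℝ → ℝ} {K : Set (ℝ × ℝ)}
    (hK : IsCompact K) (hF : ∀ p ∈ K, ContDiffAt ℝ 1 F p) :
    ∃ G : ℝ × ℝ → ℝ, ContDiff ℝ 1 G ∧ ∀ p ∈ K, G =ᶠ[nhds p] F := by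
  set U : Set (ℝ × ℝ) := {p | ContDiffAt ℝ 1 F p}
  have hU : IsOpen U := isOpen_iff_mem_nhds.mpr fun p hp => ContDiffAt.eventually hp (by simp)
  -- A cutoff that is `1` near `K` and `0` off `K' ⊆ U` makes the product `C¹` everywhere, whatever
  -- `F` does outside `U`.
  obtain ⟨K', hK', hKK', hK'U⟩ := exists_compact_between hK hU hF
  obtain ⟨χ, h1, h0, -⟩ := exists_contMDiffMap_one_nhds_of_subset_interior (n := 1)
    (modelWithCornersSelf ℝ (ℝ × ℝ)) hK.isClosed hKK'
  have hχ : ContDiff ℝ 1 χ := χ.contMDiff.contDiff.of_le (by simp)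
  refine ⟨fun p => χ p * F p, contDiff_iff_contDiffAt.mpr fun p => ?_, fun p hp => ?_⟩
  · by_cases hp : p ∈ U
    · exact hχ.contDiffAt.mul hp
    · have : K'ᶜ ∈ nhds p := hK'.isClosed.isOpen_compl.mem_nhds fun h => hp (hK'U h)
      refine (contDiffAt_const (c := (0 : ℝ))).congr_of_eventuallyEq ?_
      filter_upwards [this] with q hq
      rw [h0 q hq, zero_mul]
  · filter_upwards [(Filter.eventually_of_mem (nhds_le_nhdsSet hp h1) fun q hq => hq :
      ∀ᶠ q in nhds p, χ q = 1)] with q hq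
    rw [hq, one_mul]

/-! ### Cartesian coordinates adapted to a trapezoid. -/

/-- Cartesian coordinates adapted to a trapezoid: the origin is `A`, the first axis carries `AB`,
and the trapezoid is the region `0 ≤ y ≤ h`, `σ y ≤ x ≤ b + ρ y`. -/
structure TrapezoidFrame (T : Trapezoid) where
  basis : OrthonormalBasis (Fin 2) ℝ Plane
  b : ℝ
  h : ℝ
  σ : ℝ
  ρ : ℝ
  b_pos : 0 < b
  h_pos : 0 < h
  top_pos : 0 < b + ρ * h - σ * h
  B_eq : T.B = T.A + b • basis 0
  D_eq : T.D = T.A + (h • basis 1 + (σ * h) • basis 0)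
  C_eq : T.C = T.A + (h • basis 1 + (b + ρ * h) • basis 0)
  height_eq : T.height = h

/-- The second axis points from the foot `P` of the perpendicular dropped from `D` to `D` itself, so
the height of `D` is positive and orientation plays no role. -/
lemma Trapezoid.nonempty_frame (T : Trapezoid) : Nonempty (TrapezoidFrame T) := by
  have hAB : T.B - T.A ≠ 0 := by
    intro h
    have := T.nondegenerate.injective.ne (show (1 : Fin 3) ≠ 0 by decide)
    exact this (sub_eq_zero.mp h)
  have hD : T.D ∉ line[ℝ, T.A, T.B] := by
    have := T.nondegenerate.notMem_affineSpan_sdiff 2 Set.univ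
    have e : (![T.A, T.B, T.D] '' (Set.univ \ {2}) : Set Plane) = {T.A, T.B} := by
      ext p
      constructor
      · rintro ⟨i, hi, rfl⟩
        fin_cases i
        · simp
        · simp
        · exact absurd rfl hi.2
      · rintro (rfl | rfl)
        · exact ⟨0, by simp, rfl⟩
        · exact ⟨1, by simp, rfl⟩
    rwa [e] at this
  set b := ‖T.B - T.A‖ with hb
  have hb0 : 0 < b := norm_pos_iff.mpr hAB
  have : Nonempty line[ℝ, T.A, T.B] := ⟨⟨T.A, left_mem_affineSpan_pair ℝ _ _⟩⟩
  set P : Plane := 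
    Subtype.val (EuclideanGeometry.orthogonalProjection line[ℝ, T.A, T.B] T.D) with hP
  have hPmem : P ∈ line[ℝ, T.A, T.B] := EuclideanGeometry.orthogonalProjection_mem _
  set h := ‖T.D - P‖ with hh
  have hh0 : 0 < h := by
    refine norm_pos_iff.mpr fun h0 => hD ?_
    rw [sub_eq_zero.mp h0]
    exact hPmem
  have horth : inner ℝ (T.B - T.A) (T.D - P) = 0 := by
    have h1 := EuclideanGeometry.vsub_orthogonalProjection_mem_direction_orthogonal
      line[ℝ, T.A, T.B] T.D
    rw [Submodule.mem_orthogonal] at h1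
    refine h1 _ ?_
    rw [direction_affineSpan]
    exact vsub_mem_vectorSpan ℝ (by simp) (by simp)
  have hon : Orthonormal ℝ ![b⁻¹ • (T.B - T.A), h⁻¹ • (T.D - P)] := by
    refine ⟨fun i => ?_, fun i j hij => ?_⟩
    · fin_cases i
      · simp [norm_smul, ← hb, hb0.ne', abs_of_pos hb0]
      · simp [norm_smul, ← hh, hh0.ne', abs_of_pos hh0]
    · have h2 : inner ℝ (T.D - P) (T.B - T.A) = 0 := by rw [real_inner_comm, horth]
      fin_cases i <;> fin_cases j
      · exact absurd rfl hij
      · simp [real_inner_smul_left, real_inner_smul_right, horth]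
      · simp [real_inner_smul_left, real_inner_smul_right, h2]
      · exact absurd rfl hij
  obtain ⟨e, he⟩ := Orthonormal.exists_orthonormalBasis_extension_of_card_eq (𝕜 := ℝ)
    (s := Set.univ) (by simp) (hon.comp _ Subtype.val_injective)
  have he0 : e 0 = b⁻¹ • (T.B - T.A) := he 0 trivial
  have he1 : e 1 = h⁻¹ • (T.D - P) := he 1 trivial
  have hB : T.B - T.A = b • e 0 := by rw [he0, smul_inv_smul₀ hb0.ne']
  have hDP : T.D - P = h • e 1 := by rw [he1, smul_inv_smul₀ hh0.ne']
  have hPv := AffineSubspace.vsub_mem_direction hPmem (left_mem_affineSpan_pair ℝ T.A T.B)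
  rw [direction_affineSpan] at hPv
  obtain ⟨r, hr⟩ := mem_vectorSpan_pair_rev.mp hPv
  have hPA : P = T.A + (r * b) • e 0 := by
    rw [← smul_smul, ← hB, ← vsub_eq_sub, hr, vsub_eq_sub]
    abel
  obtain ⟨t, ht, hC⟩ := T.parallel
  -- `D` has the abscissa `r * b` of its foot, and `C` has `r * b + t * b`. The slopes of the legs
  -- are the shifts from `A` to `D` and from `B` to `C`, divided by `h`.
  refine ⟨⟨e, b, h, r * b / h, (r * b + t * b - b) / h, hb0, hh0, ?_, ?_, ?_, ?_, ?_⟩⟩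
  · have : b + (r * b + t * b - b) / h * h - r * b / h * h = t * b := by
      field_simp
      ring
    rw [this]
    positivity
  · rw [← hB]; abel
  · have : r * b / h * h = r * b := by field_simp
    rw [this, ← hDP, hPA]
    abel
  · have e1 : b + (r * b + t * b - b) / h * h = r * b + t * b := by field_simp; ring
    have e2 : T.C = T.D + t • (T.B - T.A) := by rw [← hC]; abel
    rw [e1, e2, hB, smul_smul, ← hDP, add_smul, hPA]
    abel
  · rw [Trapezoid.height, ← EuclideanGeometry.dist_orthogonalProjection_eq_infDist, dist_eq_norm]

namespace TrapezoidFrame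

variable {T : Trapezoid} (Fr : TrapezoidFrame T)

/-- The period of the strip obtained by gluing the trapezoid to its point reflections. -/
noncomputable def period : ℝ := Fr.b + (Fr.b + Fr.ρ * Fr.h - Fr.σ * Fr.h)

lemma period_pos : 0 < Fr.period := add_pos Fr.b_pos Fr.top_pos

lemma dist_A_B : dist T.A T.B = Fr.b := by
  rw [Fr.B_eq, dist_self_add_right, norm_smul, Fr.basis.norm_eq_one, mul_one, Real.norm_eq_abs,
    abs_of_pos Fr.b_pos]

lemma period_eq : Fr.period = 2 * T.meanWidth := by
  have h2 : dist T.D T.C = Fr.b + Fr.ρ * Fr.h - Fr.σ * Fr.h := by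
    rw [Fr.C_eq, Fr.D_eq, dist_add_left, dist_add_left, dist_comm, dist_eq_norm, ← sub_smul,
      norm_smul, Fr.basis.norm_eq_one, mul_one, Real.norm_eq_abs, abs_of_pos Fr.top_pos]
  rw [Trapezoid.meanWidth, Fr.dist_A_B, h2, period]
  ring

/-- The point with height `q.1` and abscissa `q.2`. -/
noncomputable def chart (q : ℝ × ℝ) : Plane := T.A + (q.1 • Fr.basis 1 + q.2 • Fr.basis 0)

/-- The height and the abscissa of a point. -/
noncomputable def coord (p : Plane) : ℝ × ℝ := (inner ℝ (Fr.basis 1) (p - T.A), inner ℝ (Fr.basis 0) (p - T.A))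

lemma coord_chart (q : ℝ × ℝ) : Fr.coord (Fr.chart q) = q := by
  have h01 : inner ℝ (Fr.basis 0) (Fr.basis 1) = 0 := Fr.basis.orthonormal.2 (by decide)
  have h10 : inner ℝ (Fr.basis 1) (Fr.basis 0) = 0 := Fr.basis.orthonormal.2 (by decide)
  simp [coord, chart, inner_add_right, real_inner_smul_right, h01, h10]

lemma chart_coord (p : Plane) : Fr.chart (Fr.coord p) = p := by
  have := Fr.basis.sum_repr' (p - T.A)
  rw [Fin.sum_univ_two] at this
  rw [chart, coord, add_comm (_ • _), this]
  abel

lemma contDiff_chart : ContDiff ℝ ∞ Fr.chart := by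
  unfold chart
  fun_prop

lemma contDiff_coord : ContDiff ℝ ∞ Fr.coord := by
  exact (contDiff_const.inner ℝ (contDiff_id.sub contDiff_const)).prodMk
    (contDiff_const.inner ℝ (contDiff_id.sub contDiff_const))

lemma continuous_chart : Continuous Fr.chart := Fr.contDiff_chart.continuous

lemma continuous_coord : Continuous Fr.coord := Fr.contDiff_coord.continuous

/-- The coordinates as a homeomorphism. -/
noncomputable def chartHomeomorph : ℝ × ℝ ≃ₜ Plane where
  toFun := Fr.chart
  invFun := Fr.coord
  left_inv := Fr.coord_chart
  right_inv := Fr.chart_coord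
  continuous_toFun := Fr.continuous_chart
  continuous_invFun := Fr.continuous_coord

lemma measurePreserving_coord : MeasurePreserving Fr.coord volume volume := by
  have h1 := measurePreserving_sub_right (volume : Measure Plane) T.A
  have h2 := Fr.basis.measurePreserving_repr
  have h3 := EuclideanSpace.volume_preserving_symm_measurableEquiv_toLp (Fin 2)
  have h4 := volume_preserving_finTwoArrow ℝ
  -- The swap is needed because `coord` lists the height, the component along `basis 1`, first.
  have h5 : MeasurePreserving (Prod.swap : ℝ × ℝ → ℝ × ℝ) volume volume :=
    Measure.measurePreserving_swap
  have h := h5.comp (h4.comp (h3.comp (h2.comp h1)))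
  convert h using 1
  ext p
  · simp [coord, OrthonormalBasis.repr_apply_apply, inner_sub_right]
  · simp [coord, OrthonormalBasis.repr_apply_apply, inner_sub_right]

lemma measurePreserving_chart : MeasurePreserving Fr.chart volume volume :=
  MeasurePreserving.symm Fr.chartHomeomorph.symm.toMeasurableEquiv Fr.measurePreserving_coord

lemma measurableEmbedding_chart : MeasurableEmbedding Fr.chart :=
  Fr.chartHomeomorph.measurableEmbedding

/-- The closed trapezoid in coordinates. -/
lemma mem_convexHull_iff (q : ℝ × ℝ) :
    Fr.chart q ∈ convexHull ℝ {T.A, T.B, T.C, T.D} ↔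
      (0 ≤ q.1 ∧ q.1 ≤ Fr.h) ∧ Fr.σ * q.1 ≤ q.2 ∧ q.2 ≤ Fr.b + Fr.ρ * q.1 := by
  have hA : T.A = Fr.chart (0, 0) := by simp [chart]
  have hB : T.B = Fr.chart (0, Fr.b) := by simp [chart, Fr.B_eq]
  have hC : T.C = Fr.chart (Fr.h, Fr.b + Fr.ρ * Fr.h) := by simp [chart, Fr.C_eq]
  have hD : T.D = Fr.chart (Fr.h, Fr.σ * Fr.h) := by simp [chart, Fr.D_eq]
  have hb := Fr.b_pos
  have hh := Fr.h_pos
  have htop := Fr.top_pos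
  have hcomb (u v : ℝ) (huv : u + v = 1) (q r : ℝ × ℝ) :
      u • Fr.chart q + v • Fr.chart r = Fr.chart (u • q + v • r) := by
    simp only [chart, Prod.fst_add, Prod.snd_add, Prod.smul_fst, Prod.smul_snd, smul_eq_mul,
      add_smul, smul_add, smul_smul]
    have : T.A = u • T.A + v • T.A := by rw [← add_smul, huv, one_smul]
    nth_rewrite 3 [this]
    abel
  constructor
  · intro hq
    set S : Set (ℝ × ℝ) := {q | (0 ≤ q.1 ∧ q.1 ≤ Fr.h) ∧ Fr.σ * q.1 ≤ q.2 ∧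
      q.2 ≤ Fr.b + Fr.ρ * q.1}
    have hconv : Convex ℝ (Fr.coord ⁻¹' S) := by
      intro p hp r hr u v hu hv huv
      have e : Fr.coord (u • p + v • r) = u • Fr.coord p + v • Fr.coord r := by
        nth_rewrite 1 [← Fr.chart_coord p, ← Fr.chart_coord r]
        rw [hcomb u v huv, Fr.coord_chart]
      rw [Set.mem_preimage, e]
      obtain ⟨⟨p1, p2⟩, p3, p4⟩ := hp
      obtain ⟨⟨r1, r2⟩, r3, r4⟩ := hr
      have hv' : v = 1 - u := by linarith
      refine ⟨⟨?_, ?_⟩, ?_, ?_⟩ <;>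
        simp only [Prod.fst_add, Prod.snd_add, Prod.smul_fst, Prod.smul_snd, smul_eq_mul]
      · positivity
      · have := mul_le_mul_of_nonneg_left p2 hu
        have := mul_le_mul_of_nonneg_left r2 hv
        subst hv'
        linarith
      · have := mul_le_mul_of_nonneg_left p3 hu
        have := mul_le_mul_of_nonneg_left r3 hv
        linarith
      · have := mul_le_mul_of_nonneg_left p4 hu
        have := mul_le_mul_of_nonneg_left r4 hv
        subst hv'
        linarith
    have hsub : ({T.A, T.B, T.C, T.D} : Set Plane) ⊆ Fr.coord ⁻¹' S := by
      rintro p (rfl | rfl | rfl | rfl)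
      · rw [Set.mem_preimage, hA, coord_chart]
        exact ⟨⟨le_rfl, hh.le⟩, by simp, by simpa using hb.le⟩
      · rw [Set.mem_preimage, hB, coord_chart]
        exact ⟨⟨le_rfl, hh.le⟩, by simpa using hb.le, by simp⟩
      · rw [Set.mem_preimage, hC, coord_chart]
        exact ⟨⟨hh.le, le_rfl⟩, by simp only; linarith, le_rfl⟩
      · rw [Set.mem_preimage, hD, coord_chart]
        exact ⟨⟨hh.le, le_rfl⟩, le_rfl, by simp only; linarith⟩
    have := convexHull_min hsub hconv hq
    rwa [Set.mem_preimage, coord_chart] at this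
  · rintro ⟨⟨h0, h1⟩, h2, h3⟩
    have hcv := convex_convexHull ℝ ({T.A, T.B, T.C, T.D} : Set Plane)
    have mA : Fr.chart (0, 0) ∈ convexHull ℝ {T.A, T.B, T.C, T.D} := by
      rw [← hA]
      exact subset_convexHull ℝ _ (by simp)
    have mB : Fr.chart (0, Fr.b) ∈ convexHull ℝ {T.A, T.B, T.C, T.D} := by
      rw [← hB]
      exact subset_convexHull ℝ _ (by simp)
    have mC : Fr.chart (Fr.h, Fr.b + Fr.ρ * Fr.h) ∈ convexHull ℝ {T.A, T.B, T.C, T.D} := by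
      rw [← hC]
      exact subset_convexHull ℝ _ (by simp)
    have mD : Fr.chart (Fr.h, Fr.σ * Fr.h) ∈ convexHull ℝ {T.A, T.B, T.C, T.D} := by
      rw [← hD]
      exact subset_convexHull ℝ _ (by simp)
    have hu : 0 ≤ 1 - q.1 / Fr.h := by rw [sub_nonneg, div_le_one hh]; exact h1
    have hv : 0 ≤ q.1 / Fr.h := by positivity
    have huv : 1 - q.1 / Fr.h + q.1 / Fr.h = 1 := by ring
    -- `m1` and `m2` concern the points of the two legs at the height of `q`; the point `q` divides
    -- the segment between them with parameter `θ`.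
    have m1 := hcv mA mD hu hv huv
    have m2 := hcv mB mC hu hv huv
    rw [hcomb _ _ huv] at m1 m2
    set w := Fr.b + Fr.ρ * q.1 - Fr.σ * q.1 with hw
    have hwpos : 0 < w := by
      have e : w = (1 - q.1 / Fr.h) * Fr.b + q.1 / Fr.h * (Fr.b + Fr.ρ * Fr.h - Fr.σ * Fr.h) := by
        rw [hw]; field_simp; ring
      rw [e]
      rcases hv.eq_or_lt with h' | h'
      · rw [← h']; simpa using hb
      · have := mul_pos h' htop
        have := mul_nonneg hu hb.le
        linarith
    set θ := (q.2 - Fr.σ * q.1) / w with hθ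
    have hθ0 : 0 ≤ θ := div_nonneg (by linarith) hwpos.le
    have hθ1 : 0 ≤ 1 - θ := by rw [sub_nonneg, hθ, div_le_one hwpos]; linarith
    have m := hcv m1 m2 hθ1 hθ0 (by ring)
    rw [hcomb _ _ (by ring)] at m
    convert m using 2
    ext
    · simp only [Prod.fst_add, Prod.smul_fst, smul_eq_mul]
      field_simp
      ring
    · simp only [Prod.snd_add, Prod.smul_snd, smul_eq_mul]
      have : θ * w = q.2 - Fr.σ * q.1 := by rw [hθ]; field_simp
      have e1 : q.1 / Fr.h * (Fr.σ * Fr.h) = Fr.σ * q.1 := by field_simp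
      have e2 : q.1 / Fr.h * (Fr.b + Fr.ρ * Fr.h) = q.1 / Fr.h * Fr.b + Fr.ρ * q.1 := by
        field_simp
      rw [e1, e2]
      rw [hw] at this
      linarith

end TrapezoidFrame

/-! ### Gluing the trapezoid to its point reflection. -/

namespace TrapezoidFrame

variable {T : Trapezoid} (Fr : TrapezoidFrame T)

/-- The region between the two lines that carry the legs, in coordinates. -/
def wedge : Set (ℝ × ℝ) := {q | Fr.σ * q.1 < q.2 ∧ q.2 < Fr.b + Fr.ρ * q.1}

/-- The point reflection in the midpoint of the leg `BC`, in coordinates. -/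
def flip (q : ℝ × ℝ) : ℝ × ℝ := (Fr.h - q.1, 2 * Fr.b + Fr.ρ * Fr.h - q.2)

lemma isOpen_wedge : IsOpen Fr.wedge :=
  IsOpen.and (isOpen_lt (f := fun q : ℝ × ℝ => Fr.σ * q.1) (g := Prod.snd) (by fun_prop)
    (by fun_prop)) (isOpen_lt (f := Prod.snd) (g := fun q : ℝ × ℝ => Fr.b + Fr.ρ * q.1)
      (by fun_prop) (by fun_prop))

lemma flip_flip (q : ℝ × ℝ) : Fr.flip (Fr.flip q) = q := by
  simp [flip]

lemma continuous_flip : Continuous Fr.flip := by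
  unfold flip
  fun_prop

lemma measurePreserving_flip : MeasurePreserving Fr.flip volume volume :=
  (volume.measurePreserving_sub_left Fr.h).prod
    (volume.measurePreserving_sub_left (2 * Fr.b + Fr.ρ * Fr.h))

lemma measurableEmbedding_flip : MeasurableEmbedding Fr.flip :=
  (Homeomorph.mk ⟨Fr.flip, Fr.flip, Fr.flip_flip, Fr.flip_flip⟩ Fr.continuous_flip
    Fr.continuous_flip).measurableEmbedding

/-- The reflection maps the line `BC` to itself and the line `AD` to its translate by `period`. So
the reflected trapezoid fills exactly the gap that makes every slice of the union have length
`period`. -/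
lemma flip_mem_wedge_iff (q : ℝ × ℝ) :
    Fr.flip q ∈ Fr.wedge ↔ Fr.b + Fr.ρ * q.1 < q.2 ∧ q.2 < Fr.σ * q.1 + Fr.period := by
  simp only [wedge, flip, period, Set.mem_ofPred_eq, mul_sub]
  constructor <;> rintro ⟨h1, h2⟩ <;> constructor <;> linarith

lemma chart_mem_domain_iff (q : ℝ × ℝ) :
    Fr.chart q ∈ T.domain ↔ (0 < q.1 ∧ q.1 < Fr.h) ∧ q ∈ Fr.wedge := by
  have e : Fr.chart q ∈ T.domain ↔ q ∈ interior (Fr.chart ⁻¹' convexHull ℝ {T.A, T.B, T.C, T.D}) := by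
    have := Fr.chartHomeomorph.preimage_interior (convexHull ℝ {T.A, T.B, T.C, T.D})
    exact Set.ext_iff.mp this q
  rw [e]
  constructor
  · intro hq
    rw [mem_interior_iff_mem_nhds] at hq
    have h1 : ∀ᶠ t in nhds (0 : ℝ), (q.1 + t, q.2) ∈
        Fr.chart ⁻¹' convexHull ℝ {T.A, T.B, T.C, T.D} := by
      have : Filter.Tendsto (fun t : ℝ => (q.1 + t, q.2)) (nhds 0) (nhds q) := by
        have : Continuous fun t : ℝ => (q.1 + t, q.2) := by fun_prop
        simpa using this.tendsto 0
      exact this.eventually hq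
    have h2 : ∀ᶠ t in nhds (0 : ℝ), (q.1, q.2 + t) ∈
        Fr.chart ⁻¹' convexHull ℝ {T.A, T.B, T.C, T.D} := by
      have : Filter.Tendsto (fun t : ℝ => (q.1, q.2 + t)) (nhds 0) (nhds q) := by
        have : Continuous fun t : ℝ => (q.1, q.2 + t) := by fun_prop
        simpa using this.tendsto 0
      exact this.eventually hq
    -- A small negative shift and a small positive one, in each coordinate, turn the weak
    -- inequalities of the closed trapezoid into strict ones.
    obtain ⟨t, ht, ht0⟩ := ((h1.and h2).filter_mono nhdsWithin_le_nhds |>.and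
      (self_mem_nhdsWithin : Set.Iio (0 : ℝ) ∈ nhdsWithin 0 (Set.Iio 0))).exists
    obtain ⟨s, hs, hs0⟩ := ((h1.and h2).filter_mono nhdsWithin_le_nhds |>.and
      (self_mem_nhdsWithin : Set.Ioi (0 : ℝ) ∈ nhdsWithin 0 (Set.Ioi 0))).exists
    simp only [Set.mem_preimage, mem_convexHull_iff] at ht hs
    refine ⟨⟨?_, ?_⟩, ?_, ?_⟩
    · linarith [ht.1.1.1]
    · linarith [hs.1.1.2]
    · linarith [ht.2.2.1]
    · linarith [hs.2.2.2]
  · intro hq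
    refine (?_ : {q : ℝ × ℝ | (0 < q.1 ∧ q.1 < Fr.h) ∧ q ∈ Fr.wedge} ⊆ _) hq
    refine interior_maximal (fun r hr => ?_) ?_
    · rw [Set.mem_preimage, mem_convexHull_iff]
      exact ⟨⟨hr.1.1.le, hr.1.2.le⟩, hr.2.1.le, hr.2.2.le⟩
    · exact ((isOpen_lt continuous_const continuous_fst).and
        (isOpen_lt continuous_fst continuous_const)).and Fr.isOpen_wedge

lemma chart_left_mem_legs {y : ℝ} (h0 : 0 ≤ y) (h1 : y ≤ Fr.h) :
    Fr.chart (y, Fr.σ * y) ∈ T.legs := by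
  have hh := Fr.h_pos
  left
  refine ⟨1 - y / Fr.h, y / Fr.h, by rw [sub_nonneg, div_le_one hh]; exact h1, by positivity,
    by ring, ?_⟩
  rw [Fr.D_eq, smul_add, ← add_assoc, ← add_smul, sub_add_cancel, one_smul, smul_add, smul_smul,
    smul_smul, chart]
  congr 3
  · field_simp
  · field_simp

lemma chart_right_mem_legs {y : ℝ} (h0 : 0 ≤ y) (h1 : y ≤ Fr.h) :
    Fr.chart (y, Fr.b + Fr.ρ * y) ∈ T.legs := by
  have hh := Fr.h_pos
  right
  refine ⟨1 - y / Fr.h, y / Fr.h, by rw [sub_nonneg, div_le_one hh]; exact h1, by positivity,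
    by ring, ?_⟩
  have e1 : y / Fr.h * Fr.h = y := by field_simp
  have e2 : Fr.b + Fr.ρ * y =
      (1 - y / Fr.h) * Fr.b + (y / Fr.h * Fr.b + y / Fr.h * (Fr.ρ * Fr.h)) := by
    field_simp
    ring
  have e3 : T.A = (1 - y / Fr.h) • T.A + (y / Fr.h) • T.A := by
    rw [← add_smul, sub_add_cancel, one_smul]
  rw [Fr.B_eq, Fr.C_eq, chart, e2]
  simp only [smul_add, smul_smul, add_smul, e1]
  nth_rewrite 3 [e3]
  abel

/-- The function `φ` on the trapezoid, extended by zero across the legs, in coordinates. -/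
noncomputable def wedgeExt (φ : Plane → ℝ) : ℝ × ℝ → ℝ := Fr.wedge.indicator (φ ∘ Fr.chart)

lemma wedgeExt_eventuallyEq (φ : Plane → ℝ) {q : ℝ × ℝ} (hq : q ∈ Fr.wedge) :
    Fr.wedgeExt φ =ᶠ[nhds q] φ ∘ Fr.chart := by
  filter_upwards [Fr.isOpen_wedge.mem_nhds hq] with r hr
  exact Set.indicator_of_mem hr _

/-- At a point of a leg `φ` itself vanishes nearby; strictly beyond the leg lines the indicator
does. The height must lie in `[0, h]`, since `φ` need not vanish on the leg lines beyond the legs.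
-/
lemma wedgeExt_eventuallyEq_zero {φ : Plane → ℝ} (hφ : Disjoint (tsupport φ) T.legs) {q : ℝ × ℝ}
    (h0 : 0 ≤ q.1) (h1 : q.1 ≤ Fr.h) (hq : q ∉ Fr.wedge) : Fr.wedgeExt φ =ᶠ[nhds q] 0 := by
  have hleg : Fr.chart q ∈ T.legs → Fr.wedgeExt φ =ᶠ[nhds q] 0 := by
    intro hl
    have : φ =ᶠ[nhds (Fr.chart q)] 0 :=
      notMem_tsupport_iff_eventuallyEq.mp fun h => hφ.notMem_of_mem_left h hl
    filter_upwards [Fr.continuous_chart.continuousAt.eventually this] with r hr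
    refine (Set.indicator_apply_eq_zero).mpr fun _ => hr
  rcases lt_trichotomy q.2 (Fr.σ * q.1) with h | h | h
  · have : IsOpen {r : ℝ × ℝ | r.2 < Fr.σ * r.1} := isOpen_lt (by fun_prop) (by fun_prop)
    filter_upwards [this.mem_nhds h] with r hr
    exact Set.indicator_of_notMem (fun hw => lt_asymm hw.1 hr) _
  · apply hleg
    have := Fr.chart_left_mem_legs h0 h1
    rwa [← h] at this
  · rcases lt_trichotomy q.2 (Fr.b + Fr.ρ * q.1) with h' | h' | h'
    · exact absurd ⟨h, h'⟩ hq
    · apply hleg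
      have := Fr.chart_right_mem_legs h0 h1
      rwa [← h'] at this
    · have : IsOpen {r : ℝ × ℝ | Fr.b + Fr.ρ * r.1 < r.2} := isOpen_lt (by fun_prop) (by fun_prop)
      filter_upwards [this.mem_nhds h'] with r hr
      exact Set.indicator_of_notMem (fun hw => lt_asymm hw.2 hr) _

/-- A function on the trapezoid and a function on its reflection, glued along the leg `BC`. -/
noncomputable def glue (φ ψ : Plane → ℝ) (q : ℝ × ℝ) : ℝ := Fr.wedgeExt φ q + Fr.wedgeExt ψ (Fr.flip q)

lemma flip_fst_nonneg {q : ℝ × ℝ} (h1 : q.1 ≤ Fr.h) : 0 ≤ (Fr.flip q).1 := sub_nonneg.mpr h1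

lemma flip_fst_le {q : ℝ × ℝ} (h0 : 0 ≤ q.1) : (Fr.flip q).1 ≤ Fr.h := sub_le_self _ h0

lemma flip_notMem_wedge {q : ℝ × ℝ} (hq : q ∈ Fr.wedge) : Fr.flip q ∉ Fr.wedge := fun h =>
  lt_asymm hq.2 ((Fr.flip_mem_wedge_iff q).mp h).1

lemma glue_eventuallyEq_left {φ ψ : Plane → ℝ} (hψ : Disjoint (tsupport ψ) T.legs)
    {q : ℝ × ℝ} (h0 : 0 ≤ q.1) (h1 : q.1 ≤ Fr.h) (hq : q ∈ Fr.wedge) :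
    Fr.glue φ ψ =ᶠ[nhds q] φ ∘ Fr.chart := by
  filter_upwards [Fr.wedgeExt_eventuallyEq φ hq, Fr.continuous_flip.continuousAt.eventually
    (Fr.wedgeExt_eventuallyEq_zero hψ (Fr.flip_fst_nonneg h1) (Fr.flip_fst_le h0)
      (Fr.flip_notMem_wedge hq))] with r hr hr'
  rw [glue, hr, hr', Pi.zero_apply, add_zero]

lemma glue_eventuallyEq_right {φ ψ : Plane → ℝ} (hφ : Disjoint (tsupport φ) T.legs)
    {q : ℝ × ℝ} (h0 : 0 ≤ q.1) (h1 : q.1 ≤ Fr.h)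
    (hq : Fr.flip q ∈ Fr.wedge) : Fr.glue φ ψ =ᶠ[nhds q] ψ ∘ Fr.chart ∘ Fr.flip := by
  have hq' : q ∉ Fr.wedge := fun h => Fr.flip_notMem_wedge h hq
  filter_upwards [Fr.wedgeExt_eventuallyEq_zero hφ h0 h1 hq',
    Fr.continuous_flip.continuousAt.eventually (Fr.wedgeExt_eventuallyEq ψ hq)] with r hr hr'
  rw [glue, hr, hr', Pi.zero_apply, zero_add]
  rfl

lemma glue_eventuallyEq_zero {φ ψ : Plane → ℝ} (hφ : Disjoint (tsupport φ) T.legs)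
    (hψ : Disjoint (tsupport ψ) T.legs) {q : ℝ × ℝ} (h0 : 0 ≤ q.1) (h1 : q.1 ≤ Fr.h) (hq : q ∉ Fr.wedge)
    (hq' : Fr.flip q ∉ Fr.wedge) : Fr.glue φ ψ =ᶠ[nhds q] 0 := by
  filter_upwards [Fr.wedgeExt_eventuallyEq_zero hφ h0 h1 hq,
    Fr.continuous_flip.continuousAt.eventually (Fr.wedgeExt_eventuallyEq_zero hψ
      (Fr.flip_fst_nonneg h1) (Fr.flip_fst_le h0) hq')] with r hr hr'
  rw [glue, hr, hr', Pi.zero_apply, Pi.zero_apply, add_zero]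

lemma contDiff_flip : ContDiff ℝ ∞ Fr.flip := by
  unfold flip
  fun_prop

lemma contDiffAt_glue {φ ψ : Plane → ℝ} (hφ : Disjoint (tsupport φ) T.legs)
    (hψ : Disjoint (tsupport ψ) T.legs) (hφs : ContDiff ℝ ∞ φ) (hψs : ContDiff ℝ ∞ ψ) {q : ℝ × ℝ} (h0 : 0 ≤ q.1)
    (h1 : q.1 ≤ Fr.h) : ContDiffAt ℝ 1 (Fr.glue φ ψ) q := by
  by_cases hq : q ∈ Fr.wedge
  · refine ContDiffAt.congr_of_eventuallyEq ?_ (Fr.glue_eventuallyEq_left hψ h0 h1 hq)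
    exact ((hφs.comp Fr.contDiff_chart).of_le (by simp)).contDiffAt
  by_cases hq' : Fr.flip q ∈ Fr.wedge
  · refine ContDiffAt.congr_of_eventuallyEq ?_ (Fr.glue_eventuallyEq_right hφ h0 h1 hq')
    exact ((hψs.comp (Fr.contDiff_chart.comp Fr.contDiff_flip)).of_le (by simp)).contDiffAt
  · exact contDiffAt_const.congr_of_eventuallyEq (Fr.glue_eventuallyEq_zero hφ hψ h0 h1 hq hq')

/-- The derivative of the chart. -/
noncomputable def chartDeriv : ℝ × ℝ →L[ℝ] Plane :=
  (ContinuousLinearMap.fst ℝ ℝ ℝ).smulRight (Fr.basis 1) +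
    (ContinuousLinearMap.snd ℝ ℝ ℝ).smulRight (Fr.basis 0)

lemma hasFDerivAt_chart (q : ℝ × ℝ) : HasFDerivAt Fr.chart Fr.chartDeriv q :=
  Fr.chartDeriv.hasFDerivAt.const_add T.A

lemma hasFDerivAt_flip (q : ℝ × ℝ) : HasFDerivAt Fr.flip (-ContinuousLinearMap.id ℝ (ℝ × ℝ)) q :=
  (hasFDerivAt_id q).const_sub (Fr.h, 2 * Fr.b + Fr.ρ * Fr.h)

lemma norm_gradient_sq {φ : Plane → ℝ} {p : Plane} (hφ : DifferentiableAt ℝ φ p) :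
    ‖gradient φ p‖ ^ 2 = fderiv ℝ φ p (Fr.basis 1) ^ 2 + fderiv ℝ φ p (Fr.basis 0) ^ 2 := by
  rw [← Fr.basis.sum_sq_inner_left, Fin.sum_univ_two, add_comm]
  simp only [hφ.hasGradientAt.hasFDerivAt.fderiv, InnerProductSpace.toDual_apply_apply]

lemma fderiv_comp_chart_sq {φ : Plane → ℝ} (hφ : Differentiable ℝ φ) (q : ℝ × ℝ) :
    fderiv ℝ (φ ∘ Fr.chart) q (1, 0) ^ 2 + fderiv ℝ (φ ∘ Fr.chart) q (0, 1) ^ 2 =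
      ‖gradient φ (Fr.chart q)‖ ^ 2 := by
  rw [Fr.norm_gradient_sq (hφ _),
    ((hφ (Fr.chart q)).hasFDerivAt.comp q (Fr.hasFDerivAt_chart q)).fderiv]
  simp [chartDeriv]

lemma fderiv_comp_chart_flip_sq {φ : Plane → ℝ} (hφ : Differentiable ℝ φ) (q : ℝ × ℝ) :
    fderiv ℝ (φ ∘ Fr.chart ∘ Fr.flip) q (1, 0) ^ 2 +
      fderiv ℝ (φ ∘ Fr.chart ∘ Fr.flip) q (0, 1) ^ 2 =
      ‖gradient φ (Fr.chart (Fr.flip q))‖ ^ 2 := by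
  rw [Fr.norm_gradient_sq (hφ _),
    ((hφ (Fr.chart (Fr.flip q))).hasFDerivAt.comp q ((Fr.hasFDerivAt_chart _).comp q
      (Fr.hasFDerivAt_flip q))).fderiv]
  simp [chartDeriv]

end TrapezoidFrame

/-! ### Integrals over the glued strip, and its Poincaré inequality for smooth functions. -/

namespace TrapezoidFrame

variable {T : Trapezoid} (Fr : TrapezoidFrame T)

lemma width_pos {y : ℝ} (h0 : 0 ≤ y) (h1 : y ≤ Fr.h) : 0 < Fr.b + Fr.ρ * y - Fr.σ * y := by
  have hh := Fr.h_pos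
  have hb := Fr.b_pos
  have htop := Fr.top_pos
  have e : Fr.h * (Fr.b + Fr.ρ * y - Fr.σ * y) =
      (Fr.h - y) * Fr.b + y * (Fr.b + Fr.ρ * Fr.h - Fr.σ * Fr.h) := by ring
  have : 0 < Fr.h * (Fr.b + Fr.ρ * y - Fr.σ * y) := by
    rw [e]
    rcases h0.eq_or_lt with h | h
    · rw [← h]
      simpa using mul_pos hh hb
    · have := mul_pos h htop
      have := mul_nonneg (sub_nonneg.mpr h1) hb.le
      linarith
  exact (pos_iff_pos_of_mul_pos this).mp hh

/-- The gap is the width of the trapezoid at height `h - y`, which is the slice of its reflection at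
height `y`. -/
lemma right_lt {y : ℝ} (h0 : 0 ≤ y) (h1 : y ≤ Fr.h) :
    Fr.b + Fr.ρ * y < Fr.σ * y + Fr.period := by
  have := Fr.width_pos (sub_nonneg.mpr h1) (sub_le_self _ h0)
  rw [mul_sub, mul_sub] at this
  rw [period]
  linarith

/-- A rectangle, in coordinates, that contains the trapezoid and its reflection. -/
def box : Set (ℝ × ℝ) :=
  Set.Ioc 0 Fr.h ×ˢ Set.Ioc (-(|Fr.σ| * Fr.h)) (|Fr.σ| * Fr.h + Fr.period)

lemma box_bounds {y : ℝ} (hy : y ∈ Set.Icc 0 Fr.h) :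
    -(|Fr.σ| * Fr.h) ≤ Fr.σ * y ∧ Fr.σ * y + Fr.period ≤ |Fr.σ| * Fr.h + Fr.period := by
  have h1 : |Fr.σ * y| ≤ |Fr.σ| * Fr.h := by
    rw [abs_mul, abs_of_nonneg hy.1]
    exact mul_le_mul_of_nonneg_left hy.2 (abs_nonneg _)
  have := abs_le.mp h1
  exact ⟨this.1, by linarith [this.2]⟩

/-- The interior of `Fr.box`. -/
def openBox : Set (ℝ × ℝ) :=
  Set.Ioo 0 Fr.h ×ˢ Set.Ioo (-(|Fr.σ| * Fr.h)) (|Fr.σ| * Fr.h + Fr.period)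

/-- The half-open box fits iterated interval integrals, while the open one meets the wedge in
precisely the open trapezoid. -/
lemma box_ae_eq : Fr.box =ᵐ[volume] Fr.openBox :=
  Measure.set_prod_ae_eq Ioo_ae_eq_Ioc.symm Ioo_ae_eq_Ioc.symm

lemma openBox_inter_wedge : Fr.openBox ∩ Fr.wedge = Fr.chart ⁻¹' T.domain := by
  ext q
  rw [Set.mem_preimage, chart_mem_domain_iff]
  refine ⟨fun h => ⟨h.1.1, h.2⟩, fun h => ⟨⟨h.1, ?_, ?_⟩, h.2⟩⟩
  · exact (Fr.box_bounds ⟨h.1.1.le, h.1.2.le⟩).1.trans_lt h.2.1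
  · exact h.2.2.trans ((Fr.right_lt h.1.1.le h.1.2.le).trans_le
      (Fr.box_bounds ⟨h.1.1.le, h.1.2.le⟩).2)

lemma openBox_inter_flip_wedge :
    Fr.openBox ∩ Fr.flip ⁻¹' Fr.wedge = (Fr.chart ∘ Fr.flip) ⁻¹' T.domain := by
  ext q
  rw [Set.mem_preimage, Function.comp_apply, chart_mem_domain_iff, Set.mem_inter_iff,
    Set.mem_preimage]
  have e : (0 < (Fr.flip q).1 ∧ (Fr.flip q).1 < Fr.h) ↔ 0 < q.1 ∧ q.1 < Fr.h := by
    simp only [flip]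
    constructor <;> rintro ⟨h1, h2⟩ <;> constructor <;> linarith
  rw [e]
  refine ⟨fun h => ⟨h.1.1, h.2⟩, fun h => ⟨⟨h.1, ?_, ?_⟩, h.2⟩⟩
  · have h2 := ((Fr.flip_mem_wedge_iff q).mp h.2).1
    have h3 := Fr.width_pos h.1.1.le h.1.2.le
    have := (Fr.box_bounds ⟨h.1.1.le, h.1.2.le⟩).1
    linarith
  · exact ((Fr.flip_mem_wedge_iff q).mp h.2).2.trans_le
      (Fr.box_bounds ⟨h.1.1.le, h.1.2.le⟩).2

section Integrals

variable {E : Type*} [NormedAddCommGroup E]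

lemma integrableOn_wedge {f : Plane → E} (hf : IntegrableOn f T.domain) :
    IntegrableOn (Fr.wedge.indicator (f ∘ Fr.chart)) Fr.box := by
  rw [integrableOn_congr_set_ae Fr.box_ae_eq, IntegrableOn,
    integrable_indicator_iff Fr.isOpen_wedge.measurableSet, IntegrableOn,
    Measure.restrict_restrict Fr.isOpen_wedge.measurableSet, Set.inter_comm, openBox_inter_wedge]
  exact (Fr.measurePreserving_chart.integrableOn_comp_preimage Fr.measurableEmbedding_chart).mpr hf

lemma integrableOn_flip_wedge {f : Plane → E} (hf : IntegrableOn f T.domain) :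
    IntegrableOn (fun q => Fr.wedge.indicator (f ∘ Fr.chart) (Fr.flip q)) Fr.box := by
  have hm : MeasurableSet (Fr.flip ⁻¹' Fr.wedge) :=
    (Fr.isOpen_wedge.preimage Fr.continuous_flip).measurableSet
  have e : (fun q => Fr.wedge.indicator (f ∘ Fr.chart) (Fr.flip q)) =
      (Fr.flip ⁻¹' Fr.wedge).indicator (f ∘ (Fr.chart ∘ Fr.flip)) := rfl
  rw [e, integrableOn_congr_set_ae Fr.box_ae_eq, IntegrableOn, integrable_indicator_iff hm,
    IntegrableOn, Measure.restrict_restrict hm, Set.inter_comm, openBox_inter_flip_wedge]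
  exact ((Fr.measurePreserving_chart.comp Fr.measurePreserving_flip).integrableOn_comp_preimage
    (Fr.measurableEmbedding_chart.comp Fr.measurableEmbedding_flip)).mpr hf

variable [NormedSpace ℝ E]

lemma setIntegral_wedge (f : Plane → E) :
    ∫ q in Fr.box, Fr.wedge.indicator (f ∘ Fr.chart) q = ∫ p in T.domain, f p := by
  rw [setIntegral_congr_set Fr.box_ae_eq, setIntegral_indicator Fr.isOpen_wedge.measurableSet,
    openBox_inter_wedge]
  exact Fr.measurePreserving_chart.setIntegral_preimage_emb Fr.measurableEmbedding_chart f _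

lemma setIntegral_flip_wedge (f : Plane → E) :
    ∫ q in Fr.box, Fr.wedge.indicator (f ∘ Fr.chart) (Fr.flip q) = ∫ p in T.domain, f p := by
  have hm : MeasurableSet (Fr.flip ⁻¹' Fr.wedge) :=
    (Fr.isOpen_wedge.preimage Fr.continuous_flip).measurableSet
  have e : (fun q => Fr.wedge.indicator (f ∘ Fr.chart) (Fr.flip q)) =
      (Fr.flip ⁻¹' Fr.wedge).indicator (f ∘ (Fr.chart ∘ Fr.flip)) := rfl
  rw [e, setIntegral_congr_set Fr.box_ae_eq, setIntegral_indicator hm, openBox_inter_flip_wedge]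
  exact (Fr.measurePreserving_chart.comp Fr.measurePreserving_flip).setIntegral_preimage_emb
    (Fr.measurableEmbedding_chart.comp Fr.measurableEmbedding_flip) f _

/-- The integral over the glued strip is the sum of the integrals over the two trapezoids. -/
lemma setIntegral_box {f g : Plane → E} (hf : IntegrableOn f T.domain)
    (hg : IntegrableOn g T.domain) {H : ℝ × ℝ → E}
    (hH : ∀ q ∈ Fr.box, H q = Fr.wedge.indicator (f ∘ Fr.chart) q +
      Fr.wedge.indicator (g ∘ Fr.chart) (Fr.flip q)) :
    ∫ q in Fr.box, H q = (∫ p in T.domain, f p) + ∫ p in T.domain, g p := by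
  have hm : MeasurableSet Fr.box := measurableSet_Ioc.prod measurableSet_Ioc
  rw [setIntegral_congr_fun hm hH,
    integral_add (Fr.integrableOn_wedge hf) (Fr.integrableOn_flip_wedge hg), Fr.setIntegral_wedge,
    Fr.setIntegral_flip_wedge]

end Integrals

lemma _root_.Trapezoid.isOpen_domain (T : Trapezoid) : IsOpen T.domain := isOpen_interior

lemma _root_.Trapezoid.exists_isCompact_domain_subset (T : Trapezoid) :
    ∃ K : Set Plane, IsCompact K ∧ T.domain ⊆ K :=
  ⟨_, (Set.toFinite {T.A, T.B, T.C, T.D}).isCompact_convexHull ℝ, interior_subset⟩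

lemma _root_.Continuous.integrableOn_domain {E : Type*} [NormedAddCommGroup E] {f : Plane → E}
    (hf : Continuous f) (T : Trapezoid) : IntegrableOn f T.domain := by
  obtain ⟨K, hK, hsub⟩ := T.exists_isCompact_domain_subset
  exact (hf.continuousOn.integrableOn_compact hK).mono_set hsub

/-- The weight on the trapezoid whose means are Fourier coefficients on the glued strip. -/
noncomputable def weight (N i : ℕ) (n : ℤ) (p : Plane) : ℂ :=
  slabMode Fr.period Fr.h N i n (Fr.coord p)

/-- The weight on the reflected trapezoid. -/
noncomputable def flipWeight (N i : ℕ) (n : ℤ) (p : Plane) : ℂ :=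
  slabMode Fr.period Fr.h N i n (Fr.flip (Fr.coord p))

lemma measurable_weight (N i : ℕ) (n : ℤ) : Measurable (Fr.weight N i n) :=
  (measurable_slabMode _ _ N i n).comp Fr.continuous_coord.measurable

lemma measurable_flipWeight (N i : ℕ) (n : ℤ) : Measurable (Fr.flipWeight N i n) :=
  (measurable_slabMode _ _ N i n).comp (Fr.continuous_flip.comp Fr.continuous_coord).measurable

lemma norm_weight_le (N i : ℕ) (n : ℤ) (p : Plane) : ‖Fr.weight N i n p‖ ≤ 1 :=
  norm_slabMode_le _ _ _ _ _ _

lemma norm_flipWeight_le (N i : ℕ) (n : ℤ) (p : Plane) : ‖Fr.flipWeight N i n p‖ ≤ 1 :=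
  norm_slabMode_le _ _ _ _ _ _

lemma _root_.ContDiff.continuous_gradient {φ : Plane → ℝ} (hφ : ContDiff ℝ ∞ φ) :
    Continuous (gradient φ) :=
  (InnerProductSpace.toDual ℝ Plane).symm.continuous.comp (hφ.continuous_fderiv (by simp))

/-- The Poincaré inequality on a trapezoid and its reflection for smooth functions vanishing near
the legs. -/
lemma poincare_smooth {φ ψ : Plane → ℝ} (hφs : ContDiff ℝ ∞ φ) (hψs : ContDiff ℝ ∞ ψ)
    (hφ : Disjoint (tsupport φ) T.legs) (hψ : Disjoint (tsupport ψ) T.legs) {κ : ℝ}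
    (M : ℕ) {N : ℕ} (hN : 0 < N) (hκ0 : 0 ≤ κ) (hκM : κ ≤ (2 * Real.pi * M / Fr.period) ^ 2)
    (hκN : κ ≤ (Real.pi * N / Fr.h) ^ 2) :
    κ * ((∫ p in T.domain, φ p ^ 2) + ∫ p in T.domain, ψ p ^ 2) ≤
      (∫ p in T.domain, ‖gradient φ p‖ ^ 2) + (∫ p in T.domain, ‖gradient ψ p‖ ^ 2) +
      κ / (Fr.period * (Fr.h / N)) * ∑ i ∈ Finset.range N, ∑ n ∈ Finset.Ioo (-M : ℤ) M,
        ‖(∫ p in T.domain, Fr.weight N i n p * (φ p : ℂ)) +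
          ∫ p in T.domain, Fr.flipWeight N i n p * (ψ p : ℂ)‖ ^ 2 := by
  set K : Set (ℝ × ℝ) :=
    Set.Icc 0 Fr.h ×ˢ Set.Icc (-(|Fr.σ| * Fr.h)) (|Fr.σ| * Fr.h + Fr.period) with hK
  -- `glue` is known to be `C¹` only at heights in `[0, h]`, and the strip inequality asks for a
  -- function that is `C¹` on the plane.
  obtain ⟨G, hG, hGK⟩ := exists_contDiff_eventuallyEq_of_isCompact (F := Fr.glue φ ψ)
    (isCompact_Icc.prod isCompact_Icc : IsCompact K)
    (fun p hp => Fr.contDiffAt_glue hφ hψ hφs hψs hp.1.1 hp.1.2)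
  have hbox : Fr.box ⊆ K := Set.prod_mono Set.Ioc_subset_Icc_self Set.Ioc_subset_Icc_self
  have hvan : ∀ y ∈ Set.Icc 0 Fr.h, ∀ x ∈ Set.Icc (-(|Fr.σ| * Fr.h)) (|Fr.σ| * Fr.h + Fr.period),
      x ∉ Set.Ioo (Fr.σ * y) (Fr.σ * y + Fr.period) → G (y, x) = 0 ∧ fderiv ℝ G (y, x) = 0 := by
    intro y hy x hx hxn
    have hw : (y, x) ∉ Fr.wedge := fun h => hxn ⟨h.1, h.2.trans (Fr.right_lt hy.1 hy.2)⟩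
    have hw' : Fr.flip (y, x) ∉ Fr.wedge := fun h => by
      have h' := (Fr.flip_mem_wedge_iff _).mp h
      have := Fr.width_pos hy.1 hy.2
      exact hxn ⟨by linarith [h'.1], h'.2⟩
    have hz := (hGK (y, x) ⟨hy, hx⟩).trans (Fr.glue_eventuallyEq_zero hφ hψ hy.1 hy.2 hw hw')
    refine ⟨hz.eq_of_nhds, ?_⟩
    rw [hz.fderiv_eq]
    simp
  have key := poincare_slabs hG Fr.h_pos Fr.period_pos (a := fun y => Fr.σ * y)
    (fun y hy => Fr.box_bounds hy) hvan M hN hκ0 hκM hκN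
  have hφc := hφs.continuous
  have hψc := hψs.continuous
  have hφd : Differentiable ℝ φ := hφs.differentiable (by simp)
  have hψd : Differentiable ℝ ψ := hψs.differentiable (by simp)
  have hGq : ∀ q ∈ Fr.box, G q = Fr.glue φ ψ q := fun q hq => (hGK q (hbox hq)).eq_of_nhds
  have hGd : ∀ q ∈ Fr.box, fderiv ℝ G q = fderiv ℝ (Fr.glue φ ψ) q := fun q hq =>
    (hGK q (hbox hq)).fderiv_eq
  -- At most one of the two glued summands is alive at a point, so squares of the sum have no cross
  -- terms.
  have hcases (q : ℝ × ℝ) : (Fr.flip q ∉ Fr.wedge ∧ q ∈ Fr.wedge) ∨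
      (q ∉ Fr.wedge ∧ Fr.flip q ∈ Fr.wedge) ∨ (q ∉ Fr.wedge ∧ Fr.flip q ∉ Fr.wedge) := by
    have := fun h => Fr.flip_notMem_wedge (q := q) h
    tauto
  have i1 : ∫ q in Fr.box, G q ^ 2 =
      (∫ p in T.domain, φ p ^ 2) + ∫ p in T.domain, ψ p ^ 2 := by
    refine Fr.setIntegral_box ((hφc.pow 2).integrableOn_domain T)
      ((hψc.pow 2).integrableOn_domain T) fun q hq => ?_
    rw [hGq q hq, glue, wedgeExt, wedgeExt]
    rcases hcases q with h | h | h <;> simp [h]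
  have i2 : ∫ q in Fr.box, (fderiv ℝ G q (1, 0) ^ 2 + fderiv ℝ G q (0, 1) ^ 2) =
      (∫ p in T.domain, ‖gradient φ p‖ ^ 2) + ∫ p in T.domain, ‖gradient ψ p‖ ^ 2 := by
    refine Fr.setIntegral_box ((hφs.continuous_gradient.norm.pow 2).integrableOn_domain T)
      ((hψs.continuous_gradient.norm.pow 2).integrableOn_domain T) fun q hq => ?_
    have h0 : 0 ≤ q.1 := hq.1.1.le
    have h1 : q.1 ≤ Fr.h := hq.1.2
    rw [hGd q hq]
    by_cases hw : q ∈ Fr.wedge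
    · rw [(Fr.glue_eventuallyEq_left hψ h0 h1 hw).fderiv_eq, Fr.fderiv_comp_chart_sq hφd]
      simp [hw, Fr.flip_notMem_wedge hw]
    · by_cases hw' : Fr.flip q ∈ Fr.wedge
      · rw [(Fr.glue_eventuallyEq_right hφ h0 h1 hw').fderiv_eq, Fr.fderiv_comp_chart_flip_sq hψd]
        simp [hw, hw']
      · rw [(Fr.glue_eventuallyEq_zero hφ hψ h0 h1 hw hw').fderiv_eq]
        simp [hw, hw']
  have hint {w : Plane → ℂ} (hw : Measurable w) (hw1 : ∀ p, ‖w p‖ ≤ 1) {f : Plane → ℝ}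
      (hf : Continuous f) : IntegrableOn (fun p => w p * (f p : ℂ)) T.domain :=
    ((Complex.continuous_ofReal.comp hf).integrableOn_domain T).bdd_mul
      hw.aestronglyMeasurable (.of_forall hw1)
  have i3 (i : ℕ) (n : ℤ) : ∫ q in Fr.box, slabMode Fr.period Fr.h N i n q * (G q : ℂ) =
      (∫ p in T.domain, Fr.weight N i n p * (φ p : ℂ)) +
        ∫ p in T.domain, Fr.flipWeight N i n p * (ψ p : ℂ) := by
    refine Fr.setIntegral_box (hint (Fr.measurable_weight N i n) (Fr.norm_weight_le N i n) hφc)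
      (hint (Fr.measurable_flipWeight N i n) (Fr.norm_flipWeight_le N i n) hψc) fun q hq => ?_
    rw [hGq q hq, glue, wedgeExt, wedgeExt]
    rcases hcases q with h | h | h <;> simp [h, weight, flipWeight, coord_chart, flip_flip]
  rw [← i1, ← i2]
  simp_rw [← i3]
  exact key

end TrapezoidFrame

/-! ### The form domain as a closed subspace of pairs `(u, ∇u)`. -/

/-- Pairs of a square integrable function and a square integrable vector field. -/
abbrev L2Pair (Ω : Set Plane) : Type := WithLp 2 (L2 Ω × L2Field Ω)

lemma gradient_add' {φ ψ : Plane → ℝ} (hφ : Differentiable ℝ φ) (hψ : Differentiable ℝ ψ)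
    (x : Plane) : gradient (φ + ψ) x = gradient φ x + gradient ψ x := by
  simp only [gradient, fderiv_add (hφ x) (hψ x), map_add]

lemma gradient_const_smul' {φ : Plane → ℝ} (hφ : Differentiable ℝ φ) (c : ℝ) (x : Plane) :
    gradient (c • φ) x = c • gradient φ x := by
  simp only [gradient, fderiv_const_smul (hφ x)]
  simp

/-- The classes of the pairs `(φ, ∇φ)` with `φ` smooth and vanishing near `S`. -/
noncomputable def smoothPairs (Ω S : Set Plane) : Submodule ℝ (L2Pair Ω) where
  carrier := {p | ∃ φ : Plane → ℝ, ContDiff ℝ ∞ φ ∧ Disjoint (tsupport φ) S ∧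
    p.fst =ᵐ[volume.restrict Ω] φ ∧ p.snd =ᵐ[volume.restrict Ω] gradient φ}
  zero_mem' := by
    refine ⟨0, contDiff_const, by simp [tsupport], Lp.coeFn_zero _ _ _, ?_⟩
    have : gradient (0 : Plane → ℝ) = 0 := by
      ext x : 1
      simp [gradient]
    rw [this]
    exact Lp.coeFn_zero _ _ _
  add_mem' := by
    rintro p q ⟨φ, hφ, hφS, hpφ, hpφ'⟩ ⟨ψ, hψ, hψS, hqψ, hqψ'⟩
    refine ⟨φ + ψ, hφ.add hψ, (hφS.union_left hψS).mono_left (tsupport_add φ ψ), ?_, ?_⟩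
    · exact (Lp.coeFn_add p.fst q.fst).trans (hpφ.add hqψ)
    · refine (Lp.coeFn_add p.snd q.snd).trans ?_
      filter_upwards [hpφ', hqψ'] with x h1 h2
      rw [Pi.add_apply, h1, h2,
        gradient_add' (hφ.differentiable (by simp)) (hψ.differentiable (by simp))]
  smul_mem' := by
    rintro c p ⟨φ, hφ, hφS, hpφ, hpφ'⟩
    refine ⟨c • φ, contDiff_const.smul hφ,
      hφS.mono_left (closure_mono (Function.support_const_smul_subset c φ)), ?_, ?_⟩
    · exact (Lp.coeFn_smul c p.fst).trans (hpφ.const_smul c)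
    · refine (Lp.coeFn_smul c p.snd).trans ?_
      filter_upwards [hpφ'] with x h1
      rw [Pi.smul_apply, h1, gradient_const_smul' (hφ.differentiable (by simp))]

/-- The form domain of the mixed problem, as a closed space of pairs `(u, ∇u)`. -/
noncomputable def mixedSpace (Ω S : Set Plane) : Submodule ℝ (L2Pair Ω) := (smoothPairs Ω S).topologicalClosure

lemma Continuous.memLp_restrict {E : Type*} [NormedAddCommGroup E] {f : Plane → E}
    (hf : Continuous f) {Ω K : Set Plane} (hK : IsCompact K) (hΩ : Ω ⊆ K) :
    MemLp f 2 (volume.restrict Ω) := by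
  obtain ⟨C, hC⟩ := hK.exists_bound_of_continuousOn hf.continuousOn
  have : IsFiniteMeasure (volume.restrict K) :=
    ⟨by rw [Measure.restrict_apply_univ]; exact hK.measure_lt_top⟩
  have h1 : MemLp f 2 (volume.restrict K) := MemLp.of_bound hf.aestronglyMeasurable C
    ((ae_restrict_iff' hK.measurableSet).mpr (.of_forall hC))
  exact h1.mono_measure (Measure.restrict_mono hΩ le_rfl)

section

variable {Ω S K : Set Plane}

/-- The pair `(φ, ∇φ)` of a smooth function. -/
noncomputable def smoothPair (hK : IsCompact K) (hΩ : Ω ⊆ K) {φ : Plane → ℝ}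
    (hφ : ContDiff ℝ ∞ φ) : L2Pair Ω :=
  WithLp.toLp 2 ((hφ.continuous.memLp_restrict hK hΩ).toLp φ,
    (hφ.continuous_gradient.memLp_restrict hK hΩ).toLp (gradient φ))

lemma smoothPair_mem (hK : IsCompact K) (hΩ : Ω ⊆ K) {φ : Plane → ℝ} (hφ : ContDiff ℝ ∞ φ)
    (hS : Disjoint (tsupport φ) S) : smoothPair hK hΩ hφ ∈ smoothPairs Ω S :=
  ⟨φ, hφ, hS, (hφ.continuous.memLp_restrict hK hΩ).coeFn_toLp,
    (hφ.continuous_gradient.memLp_restrict hK hΩ).coeFn_toLp⟩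

lemma eLpNorm_coeFn_sub {E : Type*} [NormedAddCommGroup E] {μ : Measure Plane} {u v : Lp E 2 μ}
    {f : Plane → E} (h : v =ᵐ[μ] f) : eLpNorm (fun x => u x - f x) 2 μ = ENNReal.ofReal ‖u - v‖ := by
  rw [Lp.norm_def, ENNReal.ofReal_toReal (Lp.eLpNorm_ne_top _)]
  refine eLpNorm_congr_ae ?_
  filter_upwards [Lp.coeFn_sub u v, h] with x h1 h2
  rw [h1, Pi.sub_apply, h2]

/-- The boundary condition is approximation by smooth pairs in the product norm, so the form domain
becomes a closed linear subspace of a Hilbert space. The compact set `K` makes the restrictions of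
smooth functions and of their gradients square integrable. -/
lemma vanishesOn_iff (hK : IsCompact K) (hΩ : Ω ⊆ K) (u : L2 Ω) (g : L2Field Ω) :
    VanishesOn Ω S u g ↔ WithLp.toLp 2 (u, g) ∈ mixedSpace Ω S := by
  rw [mixedSpace, ← SetLike.mem_coe, Submodule.topologicalClosure_coe, Metric.mem_closure_iff]
  constructor
  · intro h ε hε
    obtain ⟨φ, hφ, hS, h1, h2⟩ := h (ENNReal.ofReal (ε / 2)) (by simpa using hε)
    refine ⟨_, smoothPair_mem hK hΩ hφ hS, ?_⟩
    rw [eLpNorm_coeFn_sub (MemLp.coeFn_toLp (hφ.continuous.memLp_restrict hK hΩ)),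
      ENNReal.ofReal_le_ofReal_iff (by positivity)] at h1
    rw [eLpNorm_coeFn_sub (MemLp.coeFn_toLp (hφ.continuous_gradient.memLp_restrict hK hΩ)),
      ENNReal.ofReal_le_ofReal_iff (by positivity)] at h2
    rw [dist_eq_norm, ← abs_of_pos hε, ← abs_of_nonneg (norm_nonneg (_ - _)), ← sq_lt_sq,
      WithLp.prod_norm_sq_eq_of_L2]
    have h1' := pow_le_pow_left₀ (norm_nonneg _) h1 2
    have h2' := pow_le_pow_left₀ (norm_nonneg _) h2 2
    simp only [smoothPair, WithLp.sub_fst, WithLp.sub_snd, WithLp.toLp_fst, WithLp.toLp_snd]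
    nlinarith [sq_pos_of_pos hε]
  · intro h ε hε
    obtain ⟨δ, hδ0, hδ⟩ : ∃ δ : ℝ, 0 < δ ∧ ENNReal.ofReal δ ≤ ε := by
      rcases eq_or_ne ε ∞ with rfl | hε'
      · exact ⟨1, one_pos, le_top⟩
      · exact ⟨ε.toReal, ENNReal.toReal_pos hε.ne' hε', by rw [ENNReal.ofReal_toReal hε']⟩
    obtain ⟨p, ⟨φ, hφ, hS, h1, h2⟩, hp⟩ := h δ hδ0
    rw [dist_eq_norm, ← abs_of_pos hδ0, ← abs_of_nonneg (norm_nonneg (_ - _)), ← sq_lt_sq,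
      WithLp.prod_norm_sq_eq_of_L2] at hp
    simp only [WithLp.sub_fst, WithLp.sub_snd, WithLp.toLp_fst, WithLp.toLp_snd] at hp
    refine ⟨φ, hφ, hS, ?_, ?_⟩
    · rw [eLpNorm_coeFn_sub h1]
      refine (ENNReal.ofReal_le_ofReal (abs_le_of_sq_le_sq' ?_ hδ0.le).2).trans hδ
      nlinarith [sq_nonneg ‖g - p.snd‖]
    · rw [eLpNorm_coeFn_sub h2]
      refine (ENNReal.ofReal_le_ofReal (abs_le_of_sq_le_sq' ?_ hδ0.le).2).trans hδ
      nlinarith [sq_nonneg ‖u - p.fst‖]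

/-- Since `φ` is supported inside `Ω`, both integrals are integrals over the plane; no boundary term
appears and no regularity of the boundary is needed. -/
lemma integral_smul_gradient {φ ψ : Plane → ℝ} (hψ : ContDiff ℝ ∞ ψ) (hφ : ContDiff ℝ ∞ φ)
    (hc : HasCompactSupport φ) (hs : tsupport φ ⊆ Ω) (e : Plane) :
    ∫ x in Ω, ψ x * inner ℝ e (gradient φ x) = -∫ x in Ω, φ x * inner ℝ e (gradient ψ x) := by
  have hψd : Differentiable ℝ ψ := hψ.differentiable (by simp)
  have hφd : Differentiable ℝ φ := hφ.differentiable (by simp)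
  have e1 {f : Plane → ℝ} (hf : Differentiable ℝ f) (x : Plane) :
      inner ℝ e (gradient f x) = fderiv ℝ f x e := by
    rw [real_inner_comm, (hf x).hasGradientAt.hasFDerivAt.fderiv, 
      InnerProductSpace.toDual_apply_apply]
  simp_rw [e1 hψd, e1 hφd]
  have hφ' : Continuous fun x => fderiv ℝ φ x e :=
    (hφ.continuous_fderiv (by simp)).clm_apply continuous_const
  have hψ' : Continuous fun x => fderiv ℝ ψ x e :=
    (hψ.continuous_fderiv (by simp)).clm_apply continuous_const
  have hφc' : HasCompactSupport fun x => fderiv ℝ φ x e :=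
    (hc.fderiv (𝕜 := ℝ)).comp_left (g := fun L : Plane →L[ℝ] ℝ => L e) rfl
  rw [setIntegral_eq_integral_of_forall_compl_eq_zero, setIntegral_eq_integral_of_forall_compl_eq_zero,
    integral_mul_fderiv_eq_neg_fderiv_mul_of_integrable]
  · simp_rw [mul_comm]
  · exact ((hψ'.mul hφ.continuous).integrable_of_hasCompactSupport hc.mul_left)
  · exact ((hψ.continuous.mul hφ').integrable_of_hasCompactSupport hφc'.mul_left)
  · exact ((hψ.continuous.mul hφ.continuous).integrable_of_hasCompactSupport hc.mul_left)
  · exact fun x _ => hψd x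
  · exact fun x _ => hφd x
  · intro x hx
    rw [image_eq_zero_of_notMem_tsupport fun h => hx (hs h), zero_mul]
  · intro x hx
    rw [fderiv_of_notMem_tsupport (𝕜 := ℝ) fun h => hx (hs h)]
    simp

end

section

variable {Ω S K : Set Plane}

lemma isFiniteMeasure_restrict_of_subset (hK : IsCompact K) (hΩ : Ω ⊆ K) :
    IsFiniteMeasure ((volume : Measure Plane).restrict Ω) :=
  ⟨by
    rw [Measure.restrict_apply_univ]
    exact (measure_mono hΩ).trans_lt hK.measure_lt_top⟩

lemma inner_L2Field_eq (g w : L2Field Ω) : inner ℝ g w = ∫ x in Ω, inner ℝ (g x) (w x) :=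
  L2.inner_def g w

lemma inner_L2_eq (u v : L2 Ω) : inner ℝ u v = ∫ x in Ω, u x * v x := by
  rw [L2.inner_def]
  refine integral_congr_ae (.of_forall fun x => ?_)
  simp [mul_comm]

lemma norm_L2_sq_of_ae_eq {E : Type*} [NormedAddCommGroup E] [InnerProductSpace ℝ E]
    {u : Lp E 2 ((volume : Measure Plane).restrict Ω)} {f : Plane → E}
    (h : u =ᵐ[volume.restrict Ω] f) : ‖u‖ ^ 2 = ∫ x in Ω, ‖f x‖ ^ 2 := by
  rw [← real_inner_self_eq_norm_sq, L2.inner_def]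
  refine integral_congr_ae ?_
  filter_upwards [h] with x hx
  rw [real_inner_self_eq_norm_sq, hx]

/-- Tested against a fixed vector `e`, the identity equates two continuous functionals of the pair,
so it passes from smooth pairs to their closure. Hence the weak gradient clause of `MemMixedSobolev`
follows from the boundary condition. -/
lemma isWeakGradient_of_mem_mixedSpace (hK : IsCompact K) (hΩ : Ω ⊆ K) {p : L2Pair Ω}
    (hp : p ∈ mixedSpace Ω S) : IsWeakGradient Ω p.fst p.snd := by
  intro φ hφ hc hs
  have hfin := isFiniteMeasure_restrict_of_subset hK hΩ
  have hgr : Continuous (gradient φ) := hφ.continuous_gradient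
  have hgc : HasCompactSupport (gradient φ) :=
    (hc.fderiv (𝕜 := ℝ)).comp_left (g := (InnerProductSpace.toDual ℝ Plane).symm) (map_zero _)
  obtain ⟨C, hC⟩ := hgc.exists_bound_of_continuous hgr
  obtain ⟨C', hC'⟩ := hc.exists_bound_of_continuous hφ.continuous
  have hint (u : L2 Ω) : Integrable (fun x => u x • gradient φ x) (volume.restrict Ω) :=
    ((Lp.memLp u).integrable (by norm_num)).smul_bdd C hgr.aestronglyMeasurable (.of_forall hC)
  have hint' (g : L2Field Ω) : Integrable (fun x => φ x • g x) (volume.restrict Ω) :=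
    ((Lp.memLp g).integrable (by norm_num)).bdd_smul C' hφ.continuous.aestronglyMeasurable
      (.of_forall hC')
  refine ext_inner_left ℝ fun e => ?_
  rw [inner_neg_right, ← integral_inner (hint _), ← integral_inner (hint' _)]
  have hL : MemLp (fun x => inner ℝ e (gradient φ x)) 2 (volume.restrict Ω) :=
    (hgr.memLp_restrict hK hΩ).const_inner e
  have hR : MemLp (fun x => φ x • e) 2 (volume.restrict Ω) :=
    (hφ.continuous.smul continuous_const).memLp_restrict hK hΩ
  have eL (u : L2 Ω) : ∫ x in Ω, inner ℝ e (u x • gradient φ x) = inner ℝ u (hL.toLp _) := by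
    rw [inner_L2_eq]
    refine integral_congr_ae ?_
    filter_upwards [hL.coeFn_toLp] with x hx
    rw [hx, real_inner_smul_right]
  have eR (g : L2Field Ω) : ∫ x in Ω, inner ℝ e (φ x • g x) = inner ℝ (hR.toLp _) g := by
    rw [inner_L2Field_eq]
    refine integral_congr_ae ?_
    filter_upwards [hR.coeFn_toLp] with x hx
    rw [hx, real_inner_smul_right, real_inner_smul_left]
  rw [eL, eR]
  have hfst : Continuous fun p : L2Pair Ω => p.fst := by fun_prop
  have hsnd : Continuous fun p : L2Pair Ω => p.snd := by fun_prop
  have hcl : IsClosed {p : L2Pair Ω | inner ℝ p.fst (hL.toLp _) = -inner ℝ (hR.toLp _) p.snd} :=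
    isClosed_eq (hfst.inner continuous_const) (continuous_const.inner hsnd).neg
  refine closure_minimal ?_ hcl hp
  rintro q ⟨ψ, hψ, -, h1, h2⟩
  rw [Set.mem_ofPred_eq, ← eL, ← eR]
  have := integral_smul_gradient hψ hφ hc hs e
  calc _ = _ := ?_
    _ = _ := this
    _ = _ := ?_
  · refine integral_congr_ae ?_
    filter_upwards [h1] with x hx
    rw [hx, real_inner_smul_right]
  · congr 1
    refine integral_congr_ae ?_
    filter_upwards [h2] with x hx
    rw [hx, real_inner_smul_right]

lemma memMixedSobolev_iff (hK : IsCompact K) (hΩ : Ω ⊆ K) (u : L2 Ω) (g : L2Field Ω) :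
    MemMixedSobolev Ω S u g ↔ WithLp.toLp 2 (u, g) ∈ mixedSpace Ω S :=
  ⟨fun h => (vanishesOn_iff hK hΩ u g).mp h.2, fun h =>
    ⟨isWeakGradient_of_mem_mixedSpace hK hΩ h, (vanishesOn_iff hK hΩ u g).mpr h⟩⟩

/-- Eigenfunctions in terms of the form domain. -/
lemma isMixedEigenfunction_iff (hK : IsCompact K) (hΩ : Ω ⊆ K) {μ : ℝ} {u : L2 Ω} :
    IsMixedEigenfunction Ω S μ u ↔ ∃ p ∈ mixedSpace Ω S, p.fst = u ∧
      ∀ q ∈ mixedSpace Ω S, inner ℝ p.snd q.snd = μ * inner ℝ p.fst q.fst := by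
  constructor
  · rintro ⟨g, hg, h⟩
    refine ⟨WithLp.toLp 2 (u, g), (memMixedSobolev_iff hK hΩ u g).mp hg, rfl, fun q hq => ?_⟩
    have := h q.fst q.snd ((memMixedSobolev_iff hK hΩ _ _).mpr hq)
    rwa [inner_L2Field_eq, inner_L2_eq]
  · rintro ⟨p, hp, rfl, h⟩
    refine ⟨p.snd, (memMixedSobolev_iff hK hΩ _ _).mpr hp, fun v w hvw => ?_⟩
    have := h _ ((memMixedSobolev_iff hK hΩ v w).mp hvw)
    rwa [inner_L2Field_eq, inner_L2_eq] at this

/-- The integral against a bounded complex weight, as a functional. -/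
noncomputable def weightedIntegral (hK : IsCompact K) (hΩ : Ω ⊆ K) (w : Plane → ℂ)
    (hw : Measurable w) (hw1 : ∀ p, ‖w p‖ ≤ 1) : L2 Ω →L[ℝ] ℂ :=
  have := isFiniteMeasure_restrict_of_subset hK hΩ
  (innerSL ℝ ((MemLp.of_bound (Complex.measurable_re.comp hw).aestronglyMeasurable 1
    (.of_forall fun p => (Complex.abs_re_le_norm _).trans (hw1 p)) :
      MemLp (fun p => (w p).re) 2 (volume.restrict Ω)).toLp _)).smulRight (1 : ℂ) +
  (innerSL ℝ ((MemLp.of_bound (Complex.measurable_im.comp hw).aestronglyMeasurable 1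
    (.of_forall fun p => (Complex.abs_im_le_norm _).trans (hw1 p)) :
      MemLp (fun p => (w p).im) 2 (volume.restrict Ω)).toLp _)).smulRight Complex.I

lemma weightedIntegral_apply (hK : IsCompact K) (hΩ : Ω ⊆ K) {w : Plane → ℂ}
    (hw : Measurable w) (hw1 : ∀ p, ‖w p‖ ≤ 1) (u : L2 Ω) :
    weightedIntegral hK hΩ w hw hw1 u = ∫ x in Ω, w x * (u x : ℂ) := by
  have := isFiniteMeasure_restrict_of_subset hK hΩ
  have hint : Integrable (fun x => w x * (u x : ℂ)) (volume.restrict Ω) :=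
    (((Lp.memLp u).integrable (by norm_num)).ofReal).bdd_mul hw.aestronglyMeasurable
      (.of_forall hw1)
  rw [← integral_re_add_im hint]
  simp only [weightedIntegral, _root_.add_apply, ContinuousLinearMap.smulRight_apply,
    innerSL_apply_apply, Complex.real_smul, mul_one, RCLike.I_to_complex, RCLike.re_to_complex,
    RCLike.im_to_complex, Complex.re_mul_ofReal, Complex.im_mul_ofReal]
  congr 3
  · rw [inner_L2_eq]
    refine integral_congr_ae ?_
    filter_upwards [MemLp.coeFn_toLp (MemLp.of_bound
      (Complex.measurable_re.comp hw).aestronglyMeasurable 1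
      (.of_forall fun p => (Complex.abs_re_le_norm _).trans (hw1 p)) :
      MemLp (fun p => (w p).re) 2 (volume.restrict Ω))] with x hx
    rw [hx]
  · rw [inner_L2_eq]
    refine integral_congr_ae ?_
    filter_upwards [MemLp.coeFn_toLp (MemLp.of_bound
      (Complex.measurable_im.comp hw).aestronglyMeasurable 1
      (.of_forall fun p => (Complex.abs_im_le_norm _).trans (hw1 p)) :
      MemLp (fun p => (w p).im) 2 (volume.restrict Ω))] with x hx
    rw [hx]

end

/-! ### Fourier coefficients as functionals, and the Poincaré inequality in the form domain. -/

namespace TrapezoidFrame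

variable {T : Trapezoid} (Fr : TrapezoidFrame T)

/-- The Fourier coefficient of a function on the trapezoid. -/
noncomputable def coefficient (N i : ℕ) (n : ℤ) : L2 T.domain →L[ℝ] ℂ :=
  weightedIntegral T.exists_isCompact_domain_subset.choose_spec.1
    T.exists_isCompact_domain_subset.choose_spec.2 (Fr.weight N i n) (Fr.measurable_weight N i n)
    (Fr.norm_weight_le N i n)

/-- The Fourier coefficient of a function on the reflected trapezoid. -/
noncomputable def flipCoefficient (N i : ℕ) (n : ℤ) : L2 T.domain →L[ℝ] ℂ :=
  weightedIntegral T.exists_isCompact_domain_subset.choose_spec.1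
    T.exists_isCompact_domain_subset.choose_spec.2 (Fr.flipWeight N i n)
    (Fr.measurable_flipWeight N i n) (Fr.norm_flipWeight_le N i n)

lemma coefficient_apply (N i : ℕ) (n : ℤ) (u : L2 T.domain) :
    Fr.coefficient N i n u = ∫ x in T.domain, Fr.weight N i n x * (u x : ℂ) :=
  weightedIntegral_apply _ _ _ _ u

lemma flipCoefficient_apply (N i : ℕ) (n : ℤ) (u : L2 T.domain) :
    Fr.flipCoefficient N i n u = ∫ x in T.domain, Fr.flipWeight N i n x * (u x : ℂ) :=
  weightedIntegral_apply _ _ _ _ u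

/-- Because `u` is real, the negative modes impose no further conditions and the mode `0` imposes a
single real one; the dimension count depends on this. -/
lemma coefficient_neg (N i : ℕ) (n : ℤ) (u : L2 T.domain) :
    Fr.coefficient N i (-n) u = starRingEnd ℂ (Fr.coefficient N i n u) := by
  rw [coefficient_apply, coefficient_apply, ← integral_conj]
  simp [weight, slabMode_neg]

lemma flipCoefficient_neg (N i : ℕ) (n : ℤ) (u : L2 T.domain) :
    Fr.flipCoefficient N i (-n) u = starRingEnd ℂ (Fr.flipCoefficient N i n u) := by
  rw [flipCoefficient_apply, flipCoefficient_apply, ← integral_conj]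
  simp [flipWeight, slabMode_neg]

end TrapezoidFrame

namespace TrapezoidFrame

variable {T : Trapezoid} (Fr : TrapezoidFrame T)

/-- The Poincaré inequality on a trapezoid and its reflection in the form domain. -/
lemma poincare_mixedSpace {p q : L2Pair T.domain} (hp : p ∈ mixedSpace T.domain T.legs)
    (hq : q ∈ mixedSpace T.domain T.legs) {κ : ℝ}
    (M : ℕ) {N : ℕ} (hN : 0 < N) (hκ0 : 0 ≤ κ) (hκM : κ ≤ (2 * Real.pi * M / Fr.period) ^ 2)
    (hκN : κ ≤ (Real.pi * N / Fr.h) ^ 2) :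
    κ * (‖p.fst‖ ^ 2 + ‖q.fst‖ ^ 2) ≤ ‖p.snd‖ ^ 2 + ‖q.snd‖ ^ 2 +
      κ / (Fr.period * (Fr.h / N)) * ∑ i ∈ Finset.range N, ∑ n ∈ Finset.Ioo (-M : ℤ) M,
        ‖Fr.coefficient N i n p.fst + Fr.flipCoefficient N i n q.fst‖ ^ 2 := by
  have hfst : Continuous fun p : L2Pair T.domain => p.fst := by fun_prop
  have hsnd : Continuous fun p : L2Pair T.domain => p.snd := by fun_prop
  -- Both sides are continuous in the pair of functions, so it is enough to treat smooth ones, which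
  -- are dense.
  have hcl : IsClosed {r : L2Pair T.domain × L2Pair T.domain |
      κ * (‖r.1.fst‖ ^ 2 + ‖r.2.fst‖ ^ 2) ≤ ‖r.1.snd‖ ^ 2 + ‖r.2.snd‖ ^ 2 +
      κ / (Fr.period * (Fr.h / N)) * ∑ i ∈ Finset.range N, ∑ n ∈ Finset.Ioo (-M : ℤ) M,
        ‖Fr.coefficient N i n r.1.fst + Fr.flipCoefficient N i n r.2.fst‖ ^ 2} := by
    have h1 : Continuous fun r : L2Pair T.domain × L2Pair T.domain => r.1.fst :=
      hfst.comp continuous_fst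
    have h2 : Continuous fun r : L2Pair T.domain × L2Pair T.domain => r.2.fst :=
      hfst.comp continuous_snd
    have h3 : Continuous fun r : L2Pair T.domain × L2Pair T.domain => r.1.snd :=
      hsnd.comp continuous_fst
    have h4 : Continuous fun r : L2Pair T.domain × L2Pair T.domain => r.2.snd :=
      hsnd.comp continuous_snd
    refine isClosed_le ?_ ?_
    · exact continuous_const.mul ((h1.norm.pow 2).add (h2.norm.pow 2))
    · refine ((h3.norm.pow 2).add (h4.norm.pow 2)).add (continuous_const.mul ?_)
      refine continuous_finsetSum _ fun i _ => continuous_finsetSum _ fun n _ => ?_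
      exact (((Fr.coefficient N i n).continuous.comp h1).add
        ((Fr.flipCoefficient N i n).continuous.comp h2)).norm.pow 2
  have hpq : (p, q) ∈ closure ((smoothPairs T.domain T.legs : Set (L2Pair T.domain)) ×ˢ
      (smoothPairs T.domain T.legs : Set (L2Pair T.domain))) := by
    rw [closure_prod_eq]
    exact ⟨hp, hq⟩
  have hmem := closure_minimal ?_ hcl hpq
  · exact hmem
  rintro ⟨r, s⟩ hrs
  obtain ⟨φ, hφ, hφS, h1, h2⟩ := hrs.1
  obtain ⟨ψ, hψ, hψS, h3, h4⟩ := hrs.2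
  have key := Fr.poincare_smooth hφ hψ hφS hψS M hN hκ0 hκM hκN
  have e1 (N i : ℕ) (n : ℤ) :
      Fr.coefficient N i n r.fst = ∫ x in T.domain, Fr.weight N i n x * (φ x : ℂ) := by
    rw [coefficient_apply]
    refine integral_congr_ae ?_
    filter_upwards [h1] with x hx
    rw [hx]
  have e2 (N i : ℕ) (n : ℤ) :
      Fr.flipCoefficient N i n s.fst = ∫ x in T.domain, Fr.flipWeight N i n x * (ψ x : ℂ) := by
    rw [flipCoefficient_apply]
    refine integral_congr_ae ?_
    filter_upwards [h3] with x hx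
    rw [hx]
  rw [Set.mem_ofPred_eq, norm_L2_sq_of_ae_eq h1, norm_L2_sq_of_ae_eq h2, norm_L2_sq_of_ae_eq h3,
    norm_L2_sq_of_ae_eq h4]
  simp only [e1, e2, Real.norm_eq_abs, sq_abs]
  exact key

end TrapezoidFrame

/-! ### The lower bound by a dimension count. -/

/-- On the span of eigenfunctions with eigenvalues at most `Λ` the Dirichlet integral is at most
`Λ` times the square of the `L²` norm. -/
lemma norm_sum_snd_sq_le {Ω S : Set Plane} {ι : Type*} [Fintype ι] {p : ι → L2Pair Ω}
    (hp : ∀ i, p i ∈ mixedSpace Ω S) {μ : ι → ℝ} {Λ : ℝ} (hμ : ∀ i, μ i ≤ Λ)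
    (h : ∀ i, ∀ q ∈ mixedSpace Ω S, inner ℝ (p i).snd q.snd = μ i * inner ℝ (p i).fst q.fst)
    (c : ι → ℝ) :
    ‖∑ i, c i • (p i).snd‖ ^ 2 ≤ Λ * ‖∑ i, c i • (p i).fst‖ ^ 2 := by
  -- The Dirichlet form is symmetric, so eigenfunctions with different eigenvalues are orthogonal.
  have hsymm (i j : ι) : μ i * inner ℝ (p i).fst (p j).fst = μ j * inner ℝ (p i).fst (p j).fst := by
    rw [← h i _ (hp j), real_inner_comm, h j _ (hp i), real_inner_comm]
  -- Where the inner product is non-zero, `μ i = μ j`. Replacing `Λ - μ i` by a product of square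
  -- roots exhibits the difference of the two sides as the squared norm of a single vector.
  have hsqrt (i j : ι) : (Λ - μ i) * inner ℝ (p i).fst (p j).fst =
      √(Λ - μ i) * √(Λ - μ j) * inner ℝ (p i).fst (p j).fst := by
    rcases eq_or_ne (inner ℝ (p i).fst (p j).fst) 0 with h0 | h0
    · rw [h0, mul_zero, mul_zero]
    · rw [← mul_right_cancel₀ h0 (hsymm i j), Real.mul_self_sqrt (sub_nonneg.mpr (hμ i))]
  have key : Λ * ‖∑ i, c i • (p i).fst‖ ^ 2 - ‖∑ i, c i • (p i).snd‖ ^ 2 =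
      ‖∑ i, (c i * √(Λ - μ i)) • (p i).fst‖ ^ 2 := by
    simp only [← real_inner_self_eq_norm_sq, sum_inner, inner_sum, real_inner_smul_left,
      real_inner_smul_right, Finset.mul_sum, ← Finset.sum_sub_distrib]
    refine Finset.sum_congr rfl fun i _ => Finset.sum_congr rfl fun j _ => ?_
    rw [h j _ (hp i)]
    linear_combination c i * c j * hsqrt j i
  have := sq_nonneg ‖∑ i, (c i * √(Λ - μ i)) • (p i).fst‖
  linarith

namespace TrapezoidFrame

variable {T : Trapezoid} (Fr : TrapezoidFrame T)

/-- Working with pairs is what makes the count succeed: `2k` real parameters against `2k - 1` real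
conditions. -/
lemma exists_coefficient_eq_zero {k : ℕ} (hk : 1 ≤ k) (u : Fin k → L2 T.domain) :
    ∃ c : (Fin k → ℝ) × (Fin k → ℝ), c ≠ 0 ∧ ∀ n ∈ Finset.Ioo (-k : ℤ) k,
      Fr.coefficient 1 0 n (∑ i, c.1 i • u i) + Fr.flipCoefficient 1 0 n (∑ i, c.2 i • u i) = 0 := by
  set z : ℤ → (Fin k → ℝ) × (Fin k → ℝ) →ₗ[ℝ] ℂ := fun n =>
    (Fr.coefficient 1 0 n).toLinearMap ∘ₗ (Fintype.linearCombination ℝ u) ∘ₗ LinearMap.fst ℝ _ _ +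
    (Fr.flipCoefficient 1 0 n).toLinearMap ∘ₗ (Fintype.linearCombination ℝ u) ∘ₗ
      LinearMap.snd ℝ _ _ with hz
  have hzc (n : ℤ) (c : (Fin k → ℝ) × (Fin k → ℝ)) : z n c =
      Fr.coefficient 1 0 n (∑ i, c.1 i • u i) +
        Fr.flipCoefficient 1 0 n (∑ i, c.2 i • u i) := by
    simp [hz, Fintype.linearCombination_apply]
  have hneg (n : ℤ) (c : (Fin k → ℝ) × (Fin k → ℝ)) : z (-n) c = starRingEnd ℂ (z n c) := by
    rw [hzc, hzc, coefficient_neg, flipCoefficient_neg, map_add]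
  -- One real condition for `n = 0` and `k - 1` complex ones for `n = 1, …, k - 1`; the rest follows
  -- by conjugation.
  set L : (Fin k → ℝ) × (Fin k → ℝ) →ₗ[ℝ] ℝ × (Fin (k - 1) → ℂ) :=
    (Complex.reLm ∘ₗ z 0).prod (LinearMap.pi fun j => z (j + 1 : ℕ)) with hL
  have hker : LinearMap.ker L ≠ ⊥ := by
    apply LinearMap.ker_ne_bot_of_finrank_lt
    simp only [Module.finrank_prod, Module.finrank_self,
      Module.finrank_pi_fintype, Complex.finrank_real_complex, Finset.sum_const, Finset.card_univ,
      Fintype.card_fin, smul_eq_mul]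
    omega
  obtain ⟨c, hc, hc0⟩ := Submodule.exists_mem_ne_zero_of_ne_bot hker
  refine ⟨c, hc0, fun n hn => ?_⟩
  rw [← hzc]
  have hLc : L c = 0 := hc
  have h1 : (z 0 c).re = 0 := congrArg Prod.fst hLc
  have h2 (j : Fin (k - 1)) : z (j + 1 : ℕ) c = 0 := congrFun (congrArg Prod.snd hLc) j
  have hpos (n : ℕ) (h0 : 0 < n) (hn : n < k) : z n c = 0 := by
    have := h2 ⟨n - 1, by omega⟩
    simpa [Nat.sub_add_cancel h0] using this
  rw [Finset.mem_Ioo] at hn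
  rcases lt_trichotomy n 0 with h | h | h
  · have h3 := hpos n.natAbs (by omega) (by omega)
    have h4 := hneg n.natAbs c
    rw [h3, map_zero] at h4
    have : -(n.natAbs : ℤ) = n := by omega
    rwa [this] at h4
  · subst h
    have h3 := hneg 0 c
    rw [neg_zero] at h3
    exact Complex.ext h1 (Complex.conj_eq_iff_im.mp h3.symm)
  · have h3 := hpos n.natAbs (by omega) (by omega)
    have : (n.natAbs : ℤ) = n := by omega
    rwa [this] at h3

/-- The lower bound: if `k` linearly independent eigenfunctions have eigenvalues at most `Λ`, then
`Λ` is at least the `k`-th eigenvalue of the rectangle. -/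
lemma _root_.Trapezoid.le_of_eigenfunctions {k : ℕ} (hk : 1 ≤ k) (hratio : T.height / T.meanWidth ≤ 1 / (k : ℝ))
    {Λ : ℝ} {u : Fin k → L2 T.domain} (hu : LinearIndependent ℝ u)
    (h : ∀ i, ∃ μ : ℝ, μ ≤ Λ ∧ IsMixedEigenfunction T.domain T.legs μ (u i)) :
    Real.pi ^ 2 * (k : ℝ) ^ 2 / T.meanWidth ^ 2 ≤ Λ := by
  obtain ⟨Fr⟩ := T.nonempty_frame
  obtain ⟨K, hK, hΩ⟩ := T.exists_isCompact_domain_subset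
  choose μ hμ hμu using h
  simp_rw [isMixedEigenfunction_iff hK hΩ] at hμu
  choose p hp hpu hpe using hμu
  obtain ⟨c, hc0, hc⟩ := Fr.exists_coefficient_eq_zero hk u
  have hk0 : (0 : ℝ) < k := by exact_mod_cast hk
  have hm : 0 < T.meanWidth := by
    have := Fr.period_pos
    rw [Fr.period_eq] at this
    linarith
  have hh := Fr.h_pos
  set κ := Real.pi ^ 2 * (k : ℝ) ^ 2 / T.meanWidth ^ 2 with hκ
  have hκ0 : 0 ≤ κ := by positivity
  -- Equality holds, since the period is twice the mean width.
  have hκM : κ ≤ (2 * Real.pi * k / Fr.period) ^ 2 := by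
    rw [Fr.period_eq, hκ]
    apply le_of_eq
    field_simp
  -- One slab is enough: here `h / m ≤ 1 / k` enters.
  have hκN : κ ≤ (Real.pi * (1 : ℕ) / Fr.h) ^ 2 := by
    have e : κ = (Real.pi * k / T.meanWidth) ^ 2 := by
      rw [hκ, div_pow, mul_pow]
    rw [e]
    refine pow_le_pow_left₀ (by positivity) ?_ 2
    rw [Fr.height_eq, div_le_div_iff₀ hm hk0, one_mul] at hratio
    rw [Nat.cast_one, mul_one, div_le_div_iff₀ hm hh]
    nlinarith [Real.pi_pos]
  have hfst (d : Fin k → ℝ) : (∑ i, d i • p i).fst = ∑ i, d i • (p i).fst := by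
    simp only [← WithLp.fstₗ_apply 2 ℝ, map_sum, map_smul]
  have hsnd (d : Fin k → ℝ) : (∑ i, d i • p i).snd = ∑ i, d i • (p i).snd := by
    simp only [← WithLp.sndₗ_apply 2 ℝ, map_sum, map_smul]
  have hmem (d : Fin k → ℝ) : ∑ i, d i • p i ∈ mixedSpace T.domain T.legs :=
    Submodule.sum_mem _ fun i _ => Submodule.smul_mem _ _ (hp i)
  have key := Fr.poincare_mixedSpace (hmem c.1) (hmem c.2) k one_pos hκ0 hκM hκN
  rw [hfst, hfst, hsnd, hsnd] at key
  have hzero : ∑ i ∈ Finset.range 1, ∑ n ∈ Finset.Ioo (-k : ℤ) k,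
      ‖Fr.coefficient 1 i n (∑ i, c.1 i • (p i).fst) +
        Fr.flipCoefficient 1 i n (∑ i, c.2 i • (p i).fst)‖ ^ 2 = 0 := by
    rw [Finset.sum_range_one]
    refine Finset.sum_eq_zero fun n hn => ?_
    simp_rw [hpu]
    rw [hc n hn]
    simp
  rw [hzero, mul_zero, add_zero] at key
  have h1 := norm_sum_snd_sq_le hp hμ hpe c.1
  have h2 := norm_sum_snd_sq_le hp hμ hpe c.2
  have hnz (d : Fin k → ℝ) (hd : ∑ i, d i • (p i).fst = 0) : d = 0 := by
    simp_rw [hpu] at hd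
    exact funext (Fintype.linearIndependent_iff.mp hu d hd)
  have hpos : 0 < ‖∑ i, c.1 i • (p i).fst‖ ^ 2 + ‖∑ i, c.2 i • (p i).fst‖ ^ 2 := by
    by_contra hneg
    have n1 := sq_nonneg ‖∑ i, c.1 i • (p i).fst‖
    have n2 := sq_nonneg ‖∑ i, c.2 i • (p i).fst‖
    have z1 : ‖∑ i, c.1 i • (p i).fst‖ ^ 2 = 0 := by linarith
    have z2 : ‖∑ i, c.2 i • (p i).fst‖ ^ 2 = 0 := by linarith
    exact hc0 (Prod.ext (hnz _ (norm_eq_zero.mp (pow_eq_zero_iff two_ne_zero |>.mp z1)))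
      (hnz _ (norm_eq_zero.mp (pow_eq_zero_iff two_ne_zero |>.mp z2))))
  refine le_of_mul_le_mul_right ?_ hpos
  linarith

end TrapezoidFrame

/-! ### Compactness of the embedding and existence of eigenfunctions. -/

/-- An operator on a Hilbert space that is small on subspaces of finite codimension is compact. -/
lemma isCompactOperator_of_finite_codim {E F : Type*} [NormedAddCommGroup E]
    [InnerProductSpace ℝ E] [CompleteSpace E] [NormedAddCommGroup F] [NormedSpace ℝ F]
    [CompleteSpace F] (A : E →L[ℝ] F)
    (h : ∀ ε : ℝ, 0 < ε → ∃ (ι : Type) (_ : Fintype ι) (l : ι → E →L[ℝ] ℂ),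
      ∀ x, (∀ i, l i x = 0) → ‖A x‖ ≤ ε * ‖x‖) : IsCompactOperator A := by
  have hcl : IsClosed {f : E →L[ℝ] F | IsCompactOperator f} := isClosed_setOfPred_isCompactOperator
  suffices hA : A ∈ closure {f : E →L[ℝ] F | IsCompactOperator f} by
    rwa [hcl.closure_eq] at hA
  rw [Metric.mem_closure_iff]
  intro ε hε
  obtain ⟨ι, _, l, hl⟩ := h (ε / 2) (by positivity)
  set L : E →L[ℝ] (ι → ℂ) := ContinuousLinearMap.pi l with hL
  set N : Submodule ℝ E := LinearMap.ker L.toLinearMap with hN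
  have hNcl : IsClosed (N : Set E) := L.isClosed_ker
  have : CompleteSpace N := hNcl.completeSpace_coe
  -- The finitely many functionals `l` are jointly injective on the orthogonal complement of their
  -- common kernel.
  have hfin : FiniteDimensional ℝ Nᗮ := by
    refine FiniteDimensional.of_injective (L.toLinearMap ∘ₗ Nᗮ.subtype) ?_
    rw [← LinearMap.ker_eq_bot, LinearMap.ker_eq_bot']
    intro x hx
    have h1 : (x : E) ∈ N := hx
    have h2 : inner ℝ (x : E) (x : E) = 0 := x.2 _ h1
    exact Subtype.ext (inner_self_eq_zero.mp h2)
  -- The approximant, of finite rank, is `A` after projection to `Nᗮ`; the error is `A` after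
  -- projection to `N`, where `A` is small.
  refine ⟨(A ∘L Nᗮ.subtypeL) ∘L Nᗮ.orthogonalProjectionOnto, ?_, ?_⟩
  · have : ProperSpace Nᗮ := FiniteDimensional.proper ℝ Nᗮ
    have hc : IsCompactOperator Nᗮ.orthogonalProjectionOnto :=
      isCompactOperator_of_locallyCompactSpace_dom Nᗮ.orthogonalProjectionOnto
    exact hc.clm_comp (A ∘L Nᗮ.subtypeL)
  · rw [dist_eq_norm]
    refine lt_of_le_of_lt (ContinuousLinearMap.opNorm_le_bound _ (by positivity) fun x => ?_)
      (half_lt_self hε)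
    have h1 : (A - (A ∘L Nᗮ.subtypeL) ∘L Nᗮ.orthogonalProjectionOnto) x =
        A (N.orthogonalProjectionOnto x : E) := by
      have h2 : ((N.orthogonalProjectionOnto x : N) : E) + (Nᗮ.orthogonalProjectionOnto x : Nᗮ) = x :=
        N.starProjection_add_starProjection_orthogonal x
      simp only [_root_.sub_apply, ContinuousLinearMap.comp_apply,
        Submodule.subtypeL_apply]
      nth_rewrite 1 [← h2]
      rw [map_add, add_sub_cancel_right]
    rw [h1]
    refine (hl _ fun i => congrFun (N.orthogonalProjectionOnto x).2 i).trans ?_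
    exact mul_le_mul_of_nonneg_left (N.norm_orthogonalProjectionOnto_apply_le x) (by positivity)

/-- A compact operator of rank at least `k` has `k` singular vectors for non-zero singular values
with linearly independent images. -/
lemma exists_singularVectors {E F : Type*} [NormedAddCommGroup E] [InnerProductSpace ℝ E]
    [CompleteSpace E] [NormedAddCommGroup F] [InnerProductSpace ℝ F] [CompleteSpace F]
    (A : E →L[ℝ] F) (hA : IsCompactOperator A) {k : ℕ} {v : Fin k → E}
    (hv : LinearIndependent ℝ fun i => A (v i)) :
    ∃ (p : Fin k → E) (κ : Fin k → ℝ), LinearIndependent ℝ (fun i => A (p i)) ∧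
      ∀ i, κ i ≠ 0 ∧ ∀ q, inner ℝ (A (p i)) (A q) = κ i * inner ℝ (p i) q := by
  set S : E →L[ℝ] E := A.adjoint ∘L A with hS
  have hSc : IsCompactOperator S := hA.clm_comp A.adjoint
  have hSs : S.IsSymmetric := (ContinuousLinearMap.isPositive_adjoint_comp_self A).isSymmetric
  have hbot := ContinuousLinearMap.orthogonalComplement_iSup_eigenspaces_eq_bot hSc hSs
  set X : Set F := {y | ∃ κ : ℝ, κ ≠ 0 ∧ ∃ p : E, S p = κ • p ∧ A p = y} with hX
  obtain ⟨b, hbX, hspan, hb⟩ := exists_linearIndependent ℝ X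
  have hker : ∀ x, S x = 0 → A x = 0 := by
    intro x hx
    have : inner ℝ (A x) (A x) = 0 := by
      rw [← ContinuousLinearMap.adjoint_inner_left]
      change inner ℝ (S x) x = 0
      rw [hx, inner_zero_left]
    exact inner_self_eq_zero.mp this
  -- If `b` had fewer than `k` elements, the span of `X` would be finite-dimensional, hence closed.
  -- Its preimage under `A` would be a closed subspace containing all eigenspaces of `S`, thus
  -- everything by the spectral theorem, and the `k` independent vectors `A (v i)` would not fit.
  have hemb : Nonempty (Fin k ↪ b) := by
    by_cases hfin : b.Finite
    · have := hfin.fintype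
      refine Function.Embedding.nonempty_of_card_le ?_
      by_contra hlt
      have hW : FiniteDimensional ℝ (Submodule.span ℝ X) := by
        rw [← hspan]
        exact FiniteDimensional.span_of_finite ℝ hfin
      have hle : (⨆ κ : ℝ, Module.End.eigenspace (S : Module.End ℝ E) κ) ≤
          (Submodule.span ℝ X).comap A.toLinearMap := by
        refine iSup_le fun κ x hx => ?_
        have hx' : S x = κ • x := Module.End.mem_eigenspace_iff.mp hx
        rw [Submodule.mem_comap]
        rcases eq_or_ne κ 0 with rfl | hκ
        · rw [zero_smul] at hx'
          change A x ∈ _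
          rw [hker x hx']
          exact Submodule.zero_mem _
        · exact Submodule.subset_span ⟨κ, hκ, x, hx', rfl⟩
      have hclosed : IsClosed ((Submodule.span ℝ X).comap A.toLinearMap : Set E) :=
        (Submodule.closed_of_finiteDimensional (Submodule.span ℝ X)).preimage A.continuous
      have htop := (Submodule.topologicalClosure_eq_top_iff).mpr hbot
      have hall : ∀ x, A x ∈ Submodule.span ℝ X := by
        intro x
        have h1 := Submodule.topologicalClosure_minimal _ hle hclosed
        rw [htop] at h1
        exact h1 (Submodule.mem_top : x ∈ ⊤)
      have h1 : Submodule.span ℝ (Set.range fun i => A (v i)) ≤ Submodule.span ℝ X :=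
        Submodule.span_le.mpr (by rintro _ ⟨i, rfl⟩; exact hall _)
      have h2 := Submodule.finrank_mono h1
      rw [finrank_span_eq_card hv, ← hspan, finrank_span_set_eq_card hb,
        Set.toFinset_card] at h2
      exact hlt h2
    · have : Infinite b := Set.infinite_coe_iff.mpr hfin
      exact ⟨(Fin.valEmbedding).trans (Infinite.natEmbedding b)⟩
  obtain ⟨f⟩ := hemb
  choose κ hκ p hp hpA using fun i => hbX (f i).2
  refine ⟨p, κ, ?_, fun i => ⟨hκ i, fun q => ?_⟩⟩
  · simp_rw [hpA]
    exact hb.comp f f.injective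
  · rw [← ContinuousLinearMap.adjoint_inner_left]
    change inner ℝ (S (p i)) q = _
    rw [hp, real_inner_smul_left]

namespace TrapezoidFrame

variable {T : Trapezoid} (Fr : TrapezoidFrame T)

lemma coord_of_mem_legs {p : Plane} (hp : p ∈ T.legs) :
    (Fr.coord p).2 = Fr.σ * (Fr.coord p).1 ∨ (Fr.coord p).2 = Fr.b + Fr.ρ * (Fr.coord p).1 := by
  rcases hp with ⟨u, v, -, -, huv, rfl⟩ | ⟨u, v, -, -, huv, rfl⟩
  · left
    have : u • T.A + v • T.D = Fr.chart (v * Fr.h, v * (Fr.σ * Fr.h)) := by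
      have hu : u = 1 - v := by linarith
      rw [Fr.D_eq, chart, hu, smul_add, smul_add, smul_smul, smul_smul, ← add_assoc, ← add_smul,
        sub_add_cancel, one_smul]
    rw [this, coord_chart]
    ring
  · right
    have : u • T.B + v • T.C = Fr.chart (v * Fr.h, u * Fr.b + v * (Fr.b + Fr.ρ * Fr.h)) := by
      have hu : T.A = u • T.A + v • T.A := by rw [← add_smul, huv, one_smul]
      rw [Fr.B_eq, Fr.C_eq, chart]
      nth_rewrite 3 [hu]
      simp only [smul_add, smul_smul, add_smul, mul_add]
      abel
    rw [this, coord_chart]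
    have hu : u = 1 - v := by linarith
    simp only [hu]
    ring

end TrapezoidFrame

namespace Trapezoid

variable (T : Trapezoid)

lemma disjoint_domain_legs : Disjoint T.domain T.legs := by
  obtain ⟨Fr⟩ := T.nonempty_frame
  rw [Set.disjoint_left]
  intro p hp hl
  rw [← Fr.chart_coord p, Fr.chart_mem_domain_iff] at hp
  rcases Fr.coord_of_mem_legs hl with h | h
  · exact hp.2.1.ne' h
  · exact hp.2.2.ne h

lemma domain_nonempty : T.domain.Nonempty := by
  obtain ⟨Fr⟩ := T.nonempty_frame
  have hh := Fr.h_pos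
  have hw := Fr.width_pos (y := Fr.h / 2) (by linarith) (by linarith)
  refine ⟨Fr.chart (Fr.h / 2,
    Fr.σ * (Fr.h / 2) + (Fr.b + Fr.ρ * (Fr.h / 2) - Fr.σ * (Fr.h / 2)) / 2),
    (Fr.chart_mem_domain_iff _).mpr ⟨⟨?_, ?_⟩, ?_, ?_⟩⟩
  all_goals simp only
  all_goals linarith

/-- The form domain contains `k` linearly independent functions. -/
lemma exists_linearIndependent_smooth (k : ℕ) : ∃ v : Fin k → L2Pair T.domain,
    (∀ i, v i ∈ mixedSpace T.domain T.legs) ∧ LinearIndependent ℝ fun i => (v i).fst := by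
  obtain ⟨K, hK, hΩ⟩ := T.exists_isCompact_domain_subset
  obtain ⟨x₀, hx₀⟩ := T.domain_nonempty
  have := Module.punctured_nhds_neBot ℝ Plane x₀
  have hinf : T.domain.Infinite := infinite_of_mem_nhds x₀ (T.isOpen_domain.mem_nhds hx₀)
  have := hinf.to_subtype
  set f : Fin k ↪ T.domain := Fin.valEmbedding.trans (Infinite.natEmbedding T.domain)
  set x : Fin k → Plane := fun i => f i
  have hxinj : Function.Injective x := Subtype.val_injective.comp f.injective
  obtain ⟨U, hU, hUd⟩ := (Set.finite_range x).t2_separation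
  have hφ (i : Fin k) := exists_contDiff_tsupport_subset (n := ⊤) (s := U (x i) ∩ T.domain)
    (((hU (x i)).2.inter T.isOpen_domain).mem_nhds ⟨(hU (x i)).1, (f i).2⟩)
  choose φ hφU hφc hφs hφ0 hφ1 using hφ
  have hleg (i : Fin k) : Disjoint (tsupport (φ i)) T.legs :=
    T.disjoint_domain_legs.mono_left ((hφU i).trans Set.inter_subset_right)
  refine ⟨fun i => smoothPair hK hΩ (hφs i), fun i =>
    subset_closure (smoothPair_mem hK hΩ (hφs i) (hleg i)), ?_⟩
  refine linearIndependent_of_ne_zero_of_inner_eq_zero (fun i h0 => ?_) fun i j hij => ?_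
  · have h1 : φ i =ᵐ[volume.restrict T.domain] 0 := by
      refine (((hφs i).continuous.memLp_restrict hK hΩ).coeFn_toLp).symm.trans ?_
      have h0' : ((hφs i).continuous.memLp_restrict hK hΩ).toLp (φ i) = 0 := h0
      rw [h0']
      exact Lp.coeFn_zero _ _ _
    have h2 := Measure.eqOn_open_of_ae_eq h1 T.isOpen_domain (hφs i).continuous.continuousOn
      continuousOn_const (f i).2
    have h3 : φ i (x i) = 0 := h2
    rw [hφ1] at h3
    exact one_ne_zero h3
  · change inner ℝ (((hφs i).continuous.memLp_restrict hK hΩ).toLp (φ i))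
      (((hφs j).continuous.memLp_restrict hK hΩ).toLp (φ j)) = 0
    rw [inner_L2_eq]
    refine integral_eq_zero_of_ae ?_
    filter_upwards [((hφs i).continuous.memLp_restrict hK hΩ).coeFn_toLp,
      ((hφs j).continuous.memLp_restrict hK hΩ).coeFn_toLp] with y h1 h2
    rw [h1, h2, Pi.zero_apply, mul_eq_zero]
    by_contra! hne
    have m1 := (hφU i (subset_tsupport _ hne.1)).1
    have m2 := (hφU j (subset_tsupport _ hne.2)).1
    exact (hUd (Set.mem_range_self i) (Set.mem_range_self j) (hxinj.ne hij)).notMem_of_mem_left m1 m2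

/-- The inclusion of the form domain in `L²`. -/
noncomputable def mixedInclusion : mixedSpace T.domain T.legs →L[ℝ] L2 T.domain :=
  (WithLp.fstL 2 ℝ (L2 T.domain) (L2Field T.domain)) ∘L (mixedSpace T.domain T.legs).subtypeL

lemma mixedInclusion_apply (p : mixedSpace T.domain T.legs) :
    T.mixedInclusion p = (p : L2Pair T.domain).fst := rfl

/-- The Poincaré inequality with zero on the reflected trapezoid and `κ = 1 / ε ^ 2`: once finitely
many coefficients vanish, the `L²` norm is at most `ε` times the norm of the pair. -/
lemma isCompactOperator_mixedInclusion : IsCompactOperator T.mixedInclusion := by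
  obtain ⟨Fr⟩ := T.nonempty_frame
  have hcomplete : CompleteSpace (mixedSpace T.domain T.legs) :=
    (Submodule.isClosed_topologicalClosure _).completeSpace_coe
  refine isCompactOperator_of_finite_codim T.mixedInclusion fun ε hε => ?_
  have hP := Fr.period_pos
  have hh := Fr.h_pos
  obtain ⟨M, hM⟩ := exists_nat_ge (Fr.period / (2 * Real.pi * ε))
  -- The summand `1` makes `N` positive.
  obtain ⟨N, hN⟩ := exists_nat_ge (Fr.h / (Real.pi * ε) + 1)
  have hπ := Real.pi_pos
  have hN0 : 0 < N := by
    have : (0 : ℝ) < N := lt_of_lt_of_le (by positivity) hN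
    exact_mod_cast this
  have hκM : (1 / ε) ^ 2 ≤ (2 * Real.pi * M / Fr.period) ^ 2 := by
    refine pow_le_pow_left₀ (by positivity) ?_ 2
    rw [div_le_iff₀ (by positivity)] at hM
    rw [div_le_div_iff₀ hε hP]
    linarith
  have hκN : (1 / ε) ^ 2 ≤ (Real.pi * N / Fr.h) ^ 2 := by
    refine pow_le_pow_left₀ (by positivity) ?_ 2
    have hN' : Fr.h / (Real.pi * ε) ≤ N := by linarith
    rw [div_le_iff₀ (by positivity)] at hN'
    rw [div_le_div_iff₀ hε hh]
    linarith
  refine ⟨(Finset.range N ×ˢ Finset.Ioo (-M : ℤ) M : Finset (ℕ × ℤ)), inferInstance,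
    fun i => (Fr.coefficient N i.1.1 i.1.2) ∘L T.mixedInclusion, fun p hp => ?_⟩
  have key := Fr.poincare_mixedSpace p.2 (Submodule.zero_mem _) M hN0 (by positivity) hκM hκN
  have hz : ∑ i ∈ Finset.range N, ∑ n ∈ Finset.Ioo (-M : ℤ) M,
      ‖Fr.coefficient N i n (p : L2Pair T.domain).fst +
        Fr.flipCoefficient N i n (0 : L2Pair T.domain).fst‖ ^ 2 = 0 := by
    refine Finset.sum_eq_zero fun i hi => Finset.sum_eq_zero fun n hn => ?_
    have h1 : Fr.coefficient N i n (p : L2Pair T.domain).fst = 0 :=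
      hp ⟨(i, n), Finset.mem_product.mpr ⟨hi, hn⟩⟩
    rw [h1, WithLp.zero_fst, map_zero, add_zero, norm_zero]
    norm_num
  rw [hz, WithLp.zero_fst, WithLp.zero_snd, norm_zero, norm_zero] at key
  have hnorm := WithLp.prod_norm_sq_eq_of_L2 (p : L2Pair T.domain)
  have hle : ‖(p : L2Pair T.domain).fst‖ ^ 2 ≤ (ε * ‖p‖) ^ 2 := by
    rw [mul_pow, Submodule.coe_norm, hnorm]
    have h2 : ‖(p : L2Pair T.domain).fst‖ ^ 2 =
        ε ^ 2 * ((1 / ε) ^ 2 * (‖(p : L2Pair T.domain).fst‖ ^ 2)) := by field_simp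
    rw [h2]
    refine mul_le_mul_of_nonneg_left ?_ (by positivity)
    have := sq_nonneg ‖(p : L2Pair T.domain).fst‖
    linarith
  exact (abs_le_of_sq_le_sq' hle (by positivity)).2

/-- There are arbitrarily many linearly independent eigenfunctions. -/
lemma exists_eigenfunctions (k : ℕ) : ∃ (Λ : ℝ) (u : Fin k → L2 T.domain),
    LinearIndependent ℝ u ∧
      ∀ i, ∃ μ : ℝ, μ ≤ Λ ∧ IsMixedEigenfunction T.domain T.legs μ (u i) := by
  obtain ⟨K, hK, hΩ⟩ := T.exists_isCompact_domain_subset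
  obtain ⟨v, hv, hvi⟩ := T.exists_linearIndependent_smooth k
  have : CompleteSpace (mixedSpace T.domain T.legs) :=
    (Submodule.isClosed_topologicalClosure _).completeSpace_coe
  obtain ⟨p, κ, hp, h⟩ := exists_singularVectors T.mixedInclusion
    T.isCompactOperator_mixedInclusion (v := fun i => ⟨v i, hv i⟩) hvi
  -- The relation reads `⟨u, v⟩ = κ (⟨u, v⟩ + ⟨∇u, ∇v⟩)`, so the eigenvalue is `1 / κ - 1`.
  obtain ⟨Λ, hΛ⟩ := Finite.exists_le fun i => 1 / κ i - 1
  refine ⟨Λ, fun i => (p i : L2Pair T.domain).fst, hp, fun i => ⟨1 / κ i - 1, hΛ i, ?_⟩⟩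
  rw [isMixedEigenfunction_iff hK hΩ]
  refine ⟨p i, (p i).2, rfl, fun q hq => ?_⟩
  have h1 := (h i).2 ⟨q, hq⟩
  rw [mixedInclusion_apply, mixedInclusion_apply, Submodule.coe_inner,
    WithLp.prod_inner_apply] at h1
  have hκ := (h i).1
  change inner ℝ (p i : L2Pair T.domain).fst q.fst = κ i *
    (inner ℝ (p i : L2Pair T.domain).fst q.fst + inner ℝ (p i : L2Pair T.domain).snd q.snd) at h1
  field_simp
  linarith

end Trapezoid

/-! ### The rectangle: sines of the abscissa as eigenfunctions. -/

lemma norm_gradient (φ : Plane → ℝ) (x : Plane) : ‖gradient φ x‖ = ‖fderiv ℝ φ x‖ :=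
  (InnerProductSpace.toDual ℝ Plane).symm.norm_map _

section

variable {Ω S K : Set Plane}

lemma smoothPair_add (hK : IsCompact K) (hΩ : Ω ⊆ K) {φ ψ χ : Plane → ℝ} (hφ : ContDiff ℝ ∞ φ)
    (hψ : ContDiff ℝ ∞ ψ) (hχ : ContDiff ℝ ∞ χ) (h : ∀ x, χ x = φ x + ψ x) :
    smoothPair hK hΩ hχ = smoothPair hK hΩ hφ + smoothPair hK hΩ hψ := by
  obtain rfl : χ = φ + ψ := funext h
  have e : gradient (φ + ψ) = gradient φ + gradient ψ :=
    funext (gradient_add' (hφ.differentiable (by simp)) (hψ.differentiable (by simp)))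
  have h2 : (hχ.continuous_gradient.memLp_restrict hK hΩ).toLp (gradient (φ + ψ)) =
      (hφ.continuous_gradient.memLp_restrict hK hΩ).toLp (gradient φ) +
        (hψ.continuous_gradient.memLp_restrict hK hΩ).toLp (gradient ψ) := by
    rw [← MemLp.toLp_add]
    exact MemLp.toLp_congr _ _ (.of_forall fun x => congrFun e x)
  rw [smoothPair, h2]
  rfl

lemma norm_smoothPair_sq (hK : IsCompact K) (hΩ : Ω ⊆ K) {φ : Plane → ℝ} (hφ : ContDiff ℝ ∞ φ) :
    ‖smoothPair hK hΩ hφ‖ ^ 2 = (∫ x in Ω, φ x ^ 2) + ∫ x in Ω, ‖fderiv ℝ φ x‖ ^ 2 := by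
  rw [WithLp.prod_norm_sq_eq_of_L2,
    norm_L2_sq_of_ae_eq (u := (smoothPair hK hΩ hφ).fst)
      ((hφ.continuous.memLp_restrict hK hΩ).coeFn_toLp),
    norm_L2_sq_of_ae_eq (u := (smoothPair hK hΩ hφ).snd)
      ((hφ.continuous_gradient.memLp_restrict hK hΩ).coeFn_toLp)]
  simp_rw [norm_gradient, Real.norm_eq_abs, sq_abs]

/-- Smooth functions that are bounded together with their derivatives and tend to zero locally
tend to zero in `W^{1,2}`. -/
lemma tendsto_smoothPair_zero (hK : IsCompact K) (hΩ : Ω ⊆ K) (hΩm : MeasurableSet Ω)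
    {r : ℕ → Plane → ℝ}
    (hr : ∀ n, ContDiff ℝ ∞ (r n)) {C : ℝ} (h0 : ∀ n, ∀ x ∈ Ω, |r n x| ≤ C)
    (h1 : ∀ n, ∀ x ∈ Ω, ‖fderiv ℝ (r n) x‖ ≤ C)
    (h2 : ∀ x ∈ Ω, ∀ᶠ n in Filter.atTop, r n =ᶠ[nhds x] 0) :
    Filter.Tendsto (fun n => smoothPair hK hΩ (hr n)) Filter.atTop (nhds 0) := by
  have hfin := isFiniteMeasure_restrict_of_subset hK hΩ
  rw [tendsto_zero_iff_norm_tendsto_zero]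
  have key {f : ℕ → Plane → ℝ} (hf : ∀ n, Continuous (f n)) (hb : ∀ n, ∀ x ∈ Ω, |f n x| ≤ C)
      (hz : ∀ x ∈ Ω, ∀ᶠ n in Filter.atTop, f n x = 0) :
      Filter.Tendsto (fun n => ∫ x in Ω, f n x ^ 2) Filter.atTop (nhds 0) := by
    have := tendsto_integral_of_dominated_convergence (μ := volume.restrict Ω)
      (F := fun n x => f n x ^ 2) (f := fun _ => 0) (fun _ => C ^ 2)
      (fun n => ((hf n).pow 2).aestronglyMeasurable) (integrable_const _)
      (fun n => (ae_restrict_iff' hΩm).mpr (.of_forall fun x hx => ?_))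
      ((ae_restrict_iff' hΩm).mpr (.of_forall fun x hx => ?_))
    · simpa using this
    · rw [Real.norm_eq_abs, abs_pow]
      exact pow_le_pow_left₀ (abs_nonneg _) (hb n x hx) 2
    · refine tendsto_const_nhds.congr' ?_
      filter_upwards [hz x hx] with n hn
      rw [hn, zero_pow two_ne_zero]
  have hsq : Filter.Tendsto (fun n => ‖smoothPair hK hΩ (hr n)‖ ^ 2) Filter.atTop (nhds 0) := by
    simp_rw [norm_smoothPair_sq]
    rw [← add_zero (0 : ℝ)]
    refine (key (fun n => (hr n).continuous) h0 fun x hx => ?_).add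
      (key (fun n => ((hr n).continuous_fderiv (by simp)).norm) (fun n x hx => ?_) fun x hx => ?_)
    · filter_upwards [h2 x hx] with n hn using hn.eq_of_nhds
    · rw [abs_norm]
      exact h1 n x hx
    · filter_upwards [h2 x hx] with n hn
      rw [hn.fderiv_eq]
      simp
  have := (Real.continuous_sqrt.tendsto 0).comp hsq
  simpa [Function.comp_def, Real.sqrt_sq] using this

/-- The form domain contains the smooth multiples of a smooth function that vanishes on `S` and has
no zeros in `Ω`. -/
lemma smoothPair_mul_mem_mixedSpace (hK : IsCompact K) (hΩ : Ω ⊆ K) (hΩm : MeasurableSet Ω)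
    {s w : Plane → ℝ} (hs : ContDiff ℝ ∞ s) (hw : ContDiff ℝ ∞ w) (hsS : ∀ x ∈ S, s x = 0)
    (hs0 : ∀ x ∈ Ω, s x ≠ 0) : smoothPair hK hΩ (hs.mul hw) ∈ mixedSpace Ω S := by
  -- The approximants `s w (1 - χ(n s))` vanish wherever `|n s| < 1`, in particular near `S`; the
  -- remainders `s w χ(n s)` live where `|n s| < 2`.
  set χ : ContDiffBump (0 : ℝ) := ⟨1, 2, one_pos, one_lt_two⟩
  have hχ : ContDiff ℝ ∞ χ := χ.contDiff
  have hns (n : ℕ) : ContDiff ℝ ∞ fun x => (n : ℝ) * s x := contDiff_const.mul hs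
  have hr (n : ℕ) : ContDiff ℝ ∞ fun x => s x * w x * χ (n * s x) :=
    (hs.mul hw).mul (hχ.comp (hns n))
  have hp (n : ℕ) : ContDiff ℝ ∞ fun x => s x * w x * (1 - χ (n * s x)) :=
    (hs.mul hw).mul (contDiff_const.sub (hχ.comp (hns n)))
  -- Differentiating `χ(n s)` produces a factor `n`, but the factor `s` in front turns it into `(n
  -- s) χ'(n s)`, which is bounded uniformly in `n`.
  obtain ⟨C, hC⟩ : ∃ C, ∀ t : ℝ, ‖t * deriv χ t‖ ≤ C :=
    (χ.hasCompactSupport.deriv.mul_left (f := fun t : ℝ => t)).exists_bound_of_continuous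
      (continuous_id.mul (hχ.continuous_deriv (by simp)))
  have hder (n : ℕ) (x : Plane) : fderiv ℝ (fun x => s x * w x * χ (n * s x)) x =
      (w x * ((n * s x) * deriv χ (n * s x))) • fderiv ℝ s x +
        χ (n * s x) • fderiv ℝ (fun x => s x * w x) x := by
    have d1 := ((hs.differentiable (by simp)) x).hasFDerivAt
    have d2 := (((hs.mul hw).differentiable (by simp)) x).hasFDerivAt
    have d3 := (((hχ.differentiable (by simp)) (n * s x)).hasDerivAt).comp_hasFDerivAt x
      (d1.const_mul (n : ℝ))
    refine (d2.mul d3).fderiv.trans ?_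
    congr 1
    rw [smul_smul, smul_smul]
    congr 1
    ring
  obtain ⟨C₀, hC₀⟩ := hK.exists_bound_of_continuousOn (hs.mul hw).continuous.continuousOn
  obtain ⟨C₁, hC₁⟩ := hK.exists_bound_of_continuousOn
    ((hs.mul hw).continuous_fderiv (by simp)).continuousOn
  obtain ⟨C₂, hC₂⟩ := hK.exists_bound_of_continuousOn hw.continuous.continuousOn
  obtain ⟨C₃, hC₃⟩ := hK.exists_bound_of_continuousOn
    (hs.continuous_fderiv (by simp)).continuousOn
  have hχ1 (t : ℝ) : |χ t| ≤ 1 := by rw [abs_of_nonneg χ.nonneg]; exact χ.le_one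
  have ht := tendsto_smoothPair_zero hK hΩ hΩm hr (C := max C₀ (C₂ * C * C₃ + 1 * C₁))
    (fun n x hx => ?_) (fun n x hx => ?_) (fun x hx => ?_)
  · refine mem_closure_of_tendsto (f := fun n => smoothPair hK hΩ (hp n)) (b := Filter.atTop) ?_
      (.of_forall fun n => smoothPair_mem hK hΩ (hp n) ?_)
    · have h1 := (tendsto_const_nhds (x := smoothPair hK hΩ (hs.mul hw))).sub ht
      rw [sub_zero] at h1
      refine h1.congr fun n => ?_
      rw [sub_eq_iff_eq_add]
      exact smoothPair_add hK hΩ (hp n) (hr n) _ fun x => by ring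
    · have hcl : IsClosed {x | 1 ≤ |n * s x|} :=
        isClosed_le continuous_const (hns n).continuous.abs
      have hsub : tsupport (fun x => s x * w x * (1 - χ (n * s x))) ⊆ {x | 1 ≤ |n * s x|} := by
        refine closure_minimal (fun x hx => ?_) hcl
        by_contra hlt
        refine hx ?_
        have : χ (n * s x) = 1 := χ.one_of_mem_closedBall (by
          rw [mem_closedBall_zero_iff, Real.norm_eq_abs]
          exact (not_le.mp hlt).le)
        simp only [this, sub_self, mul_zero]
      refine Set.disjoint_left.mpr fun x hx hxS => ?_
      have := hsub hx
      rw [Set.mem_ofPred_eq, hsS x hxS, mul_zero, abs_zero] at this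
      linarith
  · refine le_max_of_le_left ?_
    rw [abs_mul]
    exact (mul_le_of_le_one_right (abs_nonneg _) (hχ1 _)).trans (hC₀ x (hΩ hx))
  · refine le_max_of_le_right ?_
    rw [hder]
    refine (norm_add_le _ _).trans ?_
    rw [norm_smul, norm_smul, norm_mul]
    have hxK := hΩ hx
    gcongr
    · exact mul_nonneg ((norm_nonneg _).trans (hC₂ x hxK)) ((norm_nonneg _).trans (hC 0))
    · exact (norm_nonneg _).trans (hC₂ x hxK)
    · exact hC₂ x hxK
    · exact hC _
    · exact hC₃ x hxK
    · exact hχ1 _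
    · exact hC₁ x hxK
  -- Since `s x ≠ 0`, the remainder is identically zero near `x` for large `n`; with the uniform
  -- bounds, dominated convergence applies.
  · have hpos : 0 < |s x| / 2 := by have := abs_pos.mpr (hs0 x hx); positivity
    obtain ⟨N, hN⟩ := exists_nat_ge (2 / (|s x| / 2))
    filter_upwards [Filter.eventually_ge_atTop N] with n hn
    have hev : ∀ᶠ y in nhds x, |s x| / 2 < |s y| :=
      (hs.continuous.abs.tendsto x).eventually_const_lt (half_lt_self (by linarith))
    filter_upwards [hev] with y hy
    have hz : χ (n * s y) = 0 := χ.zero_of_le_dist (by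
      rw [dist_zero_right, Real.norm_eq_abs, abs_mul, Nat.abs_cast]
      rw [div_le_iff₀ hpos] at hN
      refine hN.trans ?_
      gcongr)
    rw [hz, mul_zero, Pi.zero_apply]

end

namespace TrapezoidFrame

variable {T : Trapezoid} (Fr : TrapezoidFrame T)

lemma eq_zero_of_isRectangle (hT : T.IsRectangle) : Fr.σ = 0 ∧ Fr.ρ = 0 := by
  have h01 : inner ℝ (Fr.basis 0) (Fr.basis 1) = 0 := Fr.basis.orthonormal.2 (by decide)
  have hb := Fr.b_pos.ne'
  have hh := Fr.h_pos.ne'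
  have hσ : Fr.σ = 0 := by
    have h := hT.2
    rw [Fr.B_eq, Fr.D_eq, add_sub_cancel_left, add_sub_cancel_left, real_inner_smul_left,
      inner_add_right, real_inner_smul_right, real_inner_smul_right, h01, mul_zero, zero_add,
      real_inner_self_eq_norm_sq, Fr.basis.norm_eq_one] at h
    simpa [hb, hh] using h
  refine ⟨hσ, ?_⟩
  have h := congrArg norm hT.1
  have htop := Fr.top_pos
  rw [Fr.B_eq, Fr.D_eq, Fr.C_eq, add_sub_cancel_left, add_sub_add_left_eq_sub,
    add_sub_add_left_eq_sub, ← sub_smul, norm_smul, norm_smul, Fr.basis.norm_eq_one, mul_one,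
    mul_one, Real.norm_eq_abs, Real.norm_eq_abs, abs_of_pos htop, abs_of_pos Fr.b_pos, hσ,
    zero_mul, sub_zero, add_eq_left] at h
  simpa [hh] using h

lemma meanWidth_eq_of_isRectangle (hT : T.IsRectangle) : T.meanWidth = Fr.b := by
  have h := Fr.period_eq
  obtain ⟨hσ, hρ⟩ := Fr.eq_zero_of_isRectangle hT
  rw [period, hσ, hρ] at h
  linarith

lemma _root_.Trapezoid.dist_A_D_of_isRectangle (hT : T.IsRectangle) :
    dist T.A T.D = T.height := by
  obtain ⟨Fr⟩ := T.nonempty_frame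
  rw [Fr.D_eq, (Fr.eq_zero_of_isRectangle hT).1, zero_mul, zero_smul, add_zero,
    dist_self_add_right, norm_smul, Fr.basis.norm_eq_one, mul_one, Real.norm_eq_abs,
    abs_of_pos Fr.h_pos, Fr.height_eq]

lemma chart_preimage_domain_of_isRectangle (hT : T.IsRectangle) :
    Fr.chart ⁻¹' T.domain = Set.Ioo 0 Fr.h ×ˢ Set.Ioo 0 Fr.b := by
  ext q
  rw [Set.mem_preimage, chart_mem_domain_iff, wedge]
  obtain ⟨hσ, hρ⟩ := Fr.eq_zero_of_isRectangle hT
  simp [hσ, hρ]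

lemma hasDerivAt_chart_abscissa {φ : Plane → ℝ} (hφ : Differentiable ℝ φ) (y x : ℝ) :
    HasDerivAt (fun x => φ (Fr.chart (y, x))) (fderiv ℝ φ (Fr.chart (y, x)) (Fr.basis 0)) x := by
  have h1 : HasDerivAt (fun x => Fr.chart (y, x)) (Fr.basis 0) x := by
    have := ((hasDerivAt_id x).smul_const (Fr.basis 0)).const_add (y • Fr.basis 1)
    rw [one_smul] at this
    exact this.const_add T.A
  exact (hφ (Fr.chart (y, x))).hasFDerivAt.comp_hasDerivAt x h1

/-- Integration by parts on a rectangle for a function that vanishes on the legs. -/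
lemma integral_mul_fderiv_of_isRectangle (hT : T.IsRectangle) {f f' : ℝ → ℝ}
    (hf : ∀ x, HasDerivAt f (f' x) x) (hf' : Continuous f') {φ : Plane → ℝ} (hφ : ContDiff ℝ ∞ φ)
    (hleg : ∀ p ∈ T.legs, φ p = 0) :
    ∫ p in T.domain, f (Fr.coord p).2 * fderiv ℝ φ p (Fr.basis 0) =
      -∫ p in T.domain, f' (Fr.coord p).2 * φ p := by
  have hφd : Differentiable ℝ φ := hφ.differentiable (by simp)
  have hfc : Continuous f := continuous_iff_continuousAt.mpr fun x => (hf x).continuousAt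
  have hd : Continuous fun p => fderiv ℝ φ p (Fr.basis 0) :=
    (hφ.continuous_fderiv (by simp)).clm_apply continuous_const
  have hx : Continuous fun p => (Fr.coord p).2 := Fr.continuous_coord.snd
  have c1 : Continuous fun p => f' (Fr.coord p).2 * φ p := (hf'.comp hx).mul hφ.continuous
  have c2 : Continuous fun p => f (Fr.coord p).2 * fderiv ℝ φ p (Fr.basis 0) := (hfc.comp hx).mul hd
  rw [eq_neg_iff_add_eq_zero, ← integral_add (c2.integrableOn_domain T) (c1.integrableOn_domain T),
    ← Fr.measurePreserving_chart.setIntegral_preimage_emb Fr.measurableEmbedding_chart,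
    Fr.chart_preimage_domain_of_isRectangle hT]
  have c3 := (c2.add c1).comp Fr.continuous_chart
  rw [Measure.volume_eq_prod, setIntegral_prod]
  · refine setIntegral_eq_zero_of_forall_eq_zero fun y hy => ?_
    rw [← integral_Ioc_eq_integral_Ioo, ← intervalIntegral.integral_of_le Fr.b_pos.le]
    simp_rw [coord_chart]
    have hder (x : ℝ) : HasDerivAt (fun x => f x * φ (Fr.chart (y, x)))
        (f x * fderiv ℝ φ (Fr.chart (y, x)) (Fr.basis 0) + f' x * φ (Fr.chart (y, x))) x := by
      rw [add_comm]
      exact (hf x).mul (Fr.hasDerivAt_chart_abscissa hφd y x)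
    rw [intervalIntegral.integral_eq_sub_of_hasDerivAt (fun x _ => hder x)]
    · obtain ⟨hσ, hρ⟩ := Fr.eq_zero_of_isRectangle hT
      have h1 := hleg _ (Fr.chart_left_mem_legs hy.1.le hy.2.le)
      have h2 := hleg _ (Fr.chart_right_mem_legs hy.1.le hy.2.le)
      rw [hσ, zero_mul] at h1
      rw [hρ, zero_mul, add_zero] at h2
      rw [h1, h2, mul_zero, mul_zero, sub_zero]
    · have c4 : Continuous fun x : ℝ => ((y, x) : ℝ × ℝ) := by fun_prop
      have c5 := c3.comp c4
      refine Continuous.intervalIntegrable ?_ _ _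
      convert c5 using 2 with x
      simp [coord_chart]
  · have hcomp : IsCompact (Set.Icc 0 Fr.h ×ˢ Set.Icc 0 Fr.b) := isCompact_Icc.prod isCompact_Icc
    exact (c3.continuousOn.integrableOn_compact hcomp).mono_set
      (Set.prod_mono Set.Ioo_subset_Icc_self Set.Ioo_subset_Icc_self)

/-- The function `sin ((n + 1) π x / b)` of the abscissa `x`. -/
noncomputable def sineMode (n : ℕ) (p : Plane) : ℝ :=
  Real.sin ((n + 1) * Real.pi / Fr.b * (Fr.coord p).2)

lemma contDiff_abscissa : ContDiff ℝ ∞ fun p => (Fr.coord p).2 := contDiff_snd.comp Fr.contDiff_coord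

lemma contDiff_sineMode (n : ℕ) : ContDiff ℝ ∞ (Fr.sineMode n) :=
  Real.contDiff_sin.comp (contDiff_const.mul Fr.contDiff_abscissa)

lemma fderiv_sineMode (n : ℕ) (p v : Plane) : fderiv ℝ (Fr.sineMode n) p v =
    (n + 1) * Real.pi / Fr.b * Real.cos ((n + 1) * Real.pi / Fr.b * (Fr.coord p).2) *
      inner ℝ (Fr.basis 0) v := by
  have h1 : HasFDerivAt (fun p => (Fr.coord p).2) (innerSL ℝ (Fr.basis 0)) p :=
    (innerSL ℝ (Fr.basis 0)).hasFDerivAt.comp p ((hasFDerivAt_id p).sub_const T.A)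
  have h2 : HasFDerivAt (Fr.sineMode n) _ p := (h1.const_mul ((n + 1) * Real.pi / Fr.b)).sin
  rw [h2.fderiv]
  simp only [_root_.smul_apply, innerSL_apply_apply, smul_eq_mul]
  ring

/-- Higher modes have zeros inside the rectangle, so the cutoff argument cannot be applied to them
directly. The identity `sin ((n + 1) t) = sin t · U_n (cos t)` makes each a smooth multiple of the
first mode, which has none. -/
lemma sineMode_eq_mul (n : ℕ) (p : Plane) : Fr.sineMode n p = Fr.sineMode 0 p *
    (Polynomial.Chebyshev.U ℝ n).eval (Real.cos (Real.pi / Fr.b * (Fr.coord p).2)) := by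
  rw [sineMode, sineMode, mul_comm (Real.sin _), Nat.cast_zero, zero_add, one_mul,
    Polynomial.Chebyshev.U_real_cos]
  congr 1
  push_cast
  ring

lemma sineMode_zero_pos (hT : T.IsRectangle) {p : Plane} (hp : p ∈ T.domain) :
    0 < Fr.sineMode 0 p := by
  have h : Fr.coord p ∈ Fr.chart ⁻¹' T.domain := by rwa [Set.mem_preimage, chart_coord]
  rw [Fr.chart_preimage_domain_of_isRectangle hT] at h
  have hb := Fr.b_pos
  have h0 := h.2.1
  have h1 := h.2.2
  have hπ := Real.pi_pos
  rw [sineMode, Nat.cast_zero, zero_add, one_mul]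
  refine Real.sin_pos_of_pos_of_lt_pi (by positivity) ?_
  rw [div_mul_eq_mul_div, div_lt_iff₀ hb]
  gcongr

lemma sineMode_eq_zero_of_mem_legs (hT : T.IsRectangle) (n : ℕ) {p : Plane} (hp : p ∈ T.legs) :
    Fr.sineMode n p = 0 := by
  obtain ⟨hσ, hρ⟩ := Fr.eq_zero_of_isRectangle hT
  rcases Fr.coord_of_mem_legs hp with h | h
  · rw [sineMode, h, hσ]
    simp
  · rw [sineMode, h, hρ, zero_mul, add_zero, div_mul_cancel₀ _ Fr.b_pos.ne']
    exact_mod_cast Real.sin_nat_mul_pi (n + 1)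

lemma exists_mem_domain_sineMode_ne_zero (hT : T.IsRectangle) (n : ℕ) :
    ∃ p ∈ T.domain, Fr.sineMode n p ≠ 0 := by
  have hb := Fr.b_pos
  have hh := Fr.h_pos
  have hn : (0 : ℝ) ≤ n := n.cast_nonneg
  refine ⟨Fr.chart (Fr.h / 2, Fr.b / (2 * (n + 1))), ?_, ?_⟩
  · rw [← Set.mem_preimage, Fr.chart_preimage_domain_of_isRectangle hT]
    refine ⟨⟨half_pos hh, half_lt_self hh⟩, by positivity, ?_⟩
    rw [div_lt_iff₀ (by positivity)]
    nlinarith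
  · rw [sineMode, coord_chart]
    have : (n + 1) * Real.pi / Fr.b * (Fr.b / (2 * (n + 1))) = Real.pi / 2 := by field_simp
    rw [this, Real.sin_pi_div_two]
    exact one_ne_zero

variable {K : Set Plane}

lemma sineMode_mem_mixedSpace (hT : T.IsRectangle) (hK : IsCompact K) (hΩ : T.domain ⊆ K) (n : ℕ) :
    smoothPair hK hΩ (Fr.contDiff_sineMode n) ∈ mixedSpace T.domain T.legs := by
  have hw : ContDiff ℝ ∞ fun p =>
      (Polynomial.Chebyshev.U ℝ n).eval (Real.cos (Real.pi / Fr.b * (Fr.coord p).2)) :=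
    ((Polynomial.Chebyshev.U ℝ n).contDiff_aeval (𝕜 := ℝ) ∞).comp
      (Real.contDiff_cos.comp (contDiff_const.mul Fr.contDiff_abscissa))
  have h := smoothPair_mul_mem_mixedSpace hK hΩ T.isOpen_domain.measurableSet
    (Fr.contDiff_sineMode 0) hw (fun p hp => Fr.sineMode_eq_zero_of_mem_legs hT 0 hp)
    (fun p hp => (Fr.sineMode_zero_pos hT hp).ne')
  have e := funext (Fr.sineMode_eq_mul n)
  convert h using 2

/-- The gradient of the mode points along the first axis, so integration by parts runs in the
abscissa alone: the parallel sides contribute nothing, and the legs nothing because the test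
function vanishes there. -/
lemma inner_sineMode (hT : T.IsRectangle) (hK : IsCompact K) (hΩ : T.domain ⊆ K) (n : ℕ)
    {q : L2Pair T.domain} (hq : q ∈ mixedSpace T.domain T.legs) :
    inner ℝ (smoothPair hK hΩ (Fr.contDiff_sineMode n)).snd q.snd =
      ((n + 1) * Real.pi / Fr.b) ^ 2 *
        inner ℝ (smoothPair hK hΩ (Fr.contDiff_sineMode n)).fst q.fst := by
  set p := smoothPair hK hΩ (Fr.contDiff_sineMode n) with hp
  set a : ℝ := (n + 1) * Real.pi / Fr.b with ha
  have hcl : IsClosed {q : L2Pair T.domain | inner ℝ p.snd q.snd = a ^ 2 * inner ℝ p.fst q.fst} :=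
    isClosed_eq (continuous_const.inner (by fun_prop))
      (continuous_const.mul (continuous_const.inner (by fun_prop)))
  refine closure_minimal ?_ hcl hq
  rintro q ⟨φ, hφ, hS, h1, h2⟩
  have hleg (x) (hx : x ∈ T.legs) : φ x = 0 :=
    image_eq_zero_of_notMem_tsupport (hS.notMem_of_mem_right hx)
  have hf (x : ℝ) : HasDerivAt (fun x => a * Real.cos (a * x)) (-(a ^ 2 * Real.sin (a * x))) x := by
    have := (((hasDerivAt_id x).const_mul a).cos).const_mul a
    refine this.congr_deriv ?_
    simp only [id]
    ring
  have key := Fr.integral_mul_fderiv_of_isRectangle hT hf (by fun_prop) hφ hleg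
  change inner ℝ p.snd q.snd = a ^ 2 * inner ℝ p.fst q.fst
  rw [inner_L2Field_eq, inner_L2_eq, ← integral_const_mul]
  refine Eq.trans ?_ (key.trans ?_)
  · refine integral_congr_ae ?_
    filter_upwards [h2, ((Fr.contDiff_sineMode n).continuous_gradient.memLp_restrict hK hΩ).coeFn_toLp]
      with x e1 e2
    have e3 : p.snd x = gradient (Fr.sineMode n) x := e2
    have e4 (v : Plane) : inner ℝ (gradient (Fr.sineMode n) x) v = fderiv ℝ (Fr.sineMode n) x v := by
      rw [gradient, InnerProductSpace.toDual_symm_apply]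
    rw [e1, e3, e4, fderiv_sineMode, real_inner_comm, gradient,
      InnerProductSpace.toDual_symm_apply]
  · rw [← integral_neg]
    refine integral_congr_ae ?_
    filter_upwards [h1, ((Fr.contDiff_sineMode n).continuous.memLp_restrict hK hΩ).coeFn_toLp]
      with x e1 e2
    have e3 : p.fst x = Fr.sineMode n x := e2
    rw [e1, e3, sineMode]
    ring

end TrapezoidFrame

namespace Trapezoid

/-- The eigenfunctions of a rectangle that depend on the abscissa only. -/
lemma exists_eigenfunctions_of_isRectangle {T : Trapezoid} (hT : T.IsRectangle) (k : ℕ) :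
    ∃ u : Fin k → L2 T.domain, LinearIndependent ℝ u ∧ ∀ i, ∃ μ : ℝ,
      μ ≤ Real.pi ^ 2 * (k : ℝ) ^ 2 / T.meanWidth ^ 2 ∧
        IsMixedEigenfunction T.domain T.legs μ (u i) := by
  obtain ⟨Fr⟩ := T.nonempty_frame
  obtain ⟨K, hK, hΩ⟩ := T.exists_isCompact_domain_subset
  have hb := Fr.b_pos
  have hπ := Real.pi_pos
  set p : ℕ → L2Pair T.domain := fun n => smoothPair hK hΩ (Fr.contDiff_sineMode n) with hp
  have hmem (n : ℕ) : p n ∈ mixedSpace T.domain T.legs := Fr.sineMode_mem_mixedSpace hT hK hΩ n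
  have heig (n : ℕ) {q : L2Pair T.domain} (hq : q ∈ mixedSpace T.domain T.legs) :
      inner ℝ (p n).snd q.snd = ((n + 1) * Real.pi / Fr.b) ^ 2 * inner ℝ (p n).fst q.fst :=
    Fr.inner_sineMode hT hK hΩ n hq
  refine ⟨fun i => (p i).fst, linearIndependent_of_ne_zero_of_inner_eq_zero (fun i h0 => ?_)
    (fun i j hij => ?_), fun i => ⟨((i + 1) * Real.pi / Fr.b) ^ 2, ?_,
      (isMixedEigenfunction_iff hK hΩ).mpr ⟨p i, hmem i, rfl, fun q hq => heig i hq⟩⟩⟩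
  · have hae : (p i).fst =ᵐ[volume.restrict T.domain] Fr.sineMode i :=
      ((Fr.contDiff_sineMode i).continuous.memLp_restrict hK hΩ).coeFn_toLp
    have h0' : (p i).fst = 0 := h0
    rw [h0'] at hae
    obtain ⟨x, hx, hne⟩ := Fr.exists_mem_domain_sineMode_ne_zero hT i
    exact hne (Measure.eqOn_open_of_ae_eq (hae.symm.trans (Lp.coeFn_zero _ _ _)) T.isOpen_domain
      (Fr.contDiff_sineMode i).continuous.continuousOn continuousOn_const hx)
  · have h1 := heig i (hmem j)
    have h2 := heig j (hmem i)
    rw [real_inner_comm, real_inner_comm (p i).fst] at h2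
    have h3 : (((i : ℕ) + 1) * Real.pi / Fr.b) ^ 2 ≠ (((j : ℕ) + 1) * Real.pi / Fr.b) ^ 2 := by
      intro h
      rw [sq_eq_sq₀ (by positivity) (by positivity), div_left_inj' hb.ne',
        mul_left_inj' hπ.ne', add_left_inj, Nat.cast_inj] at h
      exact hij (Fin.ext h)
    have h4 := h1.symm.trans h2
    by_contra hne
    exact h3 (mul_right_cancel₀ hne h4)
  · have hi : ((i : ℕ) : ℝ) + 1 ≤ k := by exact_mod_cast i.2
    rw [Fr.meanWidth_eq_of_isRectangle hT, ← mul_pow, ← div_pow, mul_comm Real.pi]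
    gcongr

end Trapezoid

/-! ### The comparison with the rectangle. -/

theorem theorem1p8 (Γ R : Trapezoid) (hR : R.IsRectangle)
    (hwidth : dist R.A R.B = Γ.meanWidth) (hheight : dist R.A R.D = Γ.height)
    (k : ℕ) (hk : 1 ≤ k) (hratio : Γ.height / Γ.meanWidth ≤ 1 / (k : ℝ)) :
    R.eigenvalueLegs k ≤ Γ.eigenvalueLegs k ∧
      R.eigenvalueLegs k = Real.pi ^ 2 * (k : ℝ) ^ 2 / Γ.meanWidth ^ 2 := by
  obtain ⟨Fr⟩ := R.nonempty_frame
  have hw : R.meanWidth = Γ.meanWidth := by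
    rw [Fr.meanWidth_eq_of_isRectangle hR, ← Fr.dist_A_B, hwidth]
  have hh : R.height = Γ.height := by rw [← R.dist_A_D_of_isRectangle hR, hheight]
  have hratio' : R.height / R.meanWidth ≤ 1 / (k : ℝ) := by rwa [hw, hh]
  have hrect : R.eigenvalueLegs k = Real.pi ^ 2 * (k : ℝ) ^ 2 / Γ.meanWidth ^ 2 := by
    rw [← hw]
    -- The rectangle is itself a trapezoid with the same ratio, so the general lower bound applies
    -- to it, and the sines attain it.
    refine IsLeast.csInf_eq ⟨R.exists_eigenfunctions_of_isRectangle hR k, ?_⟩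
    rintro Λ ⟨u, hu, h⟩
    exact R.le_of_eigenfunctions hk hratio' hu h
  refine ⟨?_, hrect⟩
  rw [hrect]
  -- Existence of eigenfunctions is essential: the infimum of the empty set of reals is `0` by
  -- convention, which would violate the bound.
  refine le_csInf (Γ.exists_eigenfunctions k) ?_
  rintro Λ ⟨u, hu, h⟩
  exact Γ.le_of_eigenfunctions hk hratio hu h
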